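/- **Setting.** Let $T,s\ge 0$ be integers, let $M_l,N_l\ge 0$ ($1\le l\le s$) be integers, and put $S=\bigcup_{l}\{-(M_l+N_l),\dots,-M_l\}$, $S^+=-S$, $Z^S=\{1,2,\dots\}\setminus S^+$, $\Lambda=\{-1,-2,\dots\}\setminus S$, $U=S\cup\{0,1,2,\dots\}$. Let $\vec a(j)\in\mathbb C^T$ satisfy $\sum_{j\in Z^S}\sum_k|a_k(j)|<\infty$, and put $A(e^{i\lambda})=\sum_{j\in Z^S}\vec a(j)e^{-ij\lambda}$. A spectral density is a $T\times T$ matrix function on $(-\pi,\pi]$ with integrable entries that is positive semidefinite a.e. Let $\vec\xi,\vec\eta$ be uncorrelated stationary sequences with spectral densities $F,G$. The functional $A\vec\xi=\sum_{j\in Z^S}\vec a(j)^\top\vec\xi(-j)$ is estimated from $\vec\xi(j)+\vec\eta(j)$, $j\in\Lambda$. Let $L_2^s(F+G)$ be the closed span of $e^{in\lambda}\delta_k$ ($n\in\Lambda$, $1\le k\le T$) in $L_2(F+G)$. The estimate with spectral characteristic $h\in L_2^s(F+G)$ has the mean-square error $$\Delta(h;F,G)=\frac1{2\pi}\int_{-\pi}^{\pi}(A-h)^\top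 F\,\overline{(A-h)}\,d\lambda+\frac1{2\pi}\int_{-\pi}^{\pi}h^\top G\,\overline{h}\,d\lambda ,$$ and $\Delta(F,G)=\min_{h\in L_2^s(F+G)}\Delta(h;F,G)$. For a class $D=D_F\times D_G$ of pairs of spectral densities, $(F^0,G^0)\in D$ is *least favorable* if $\Delta(F^0,G^0)=\max_{D}\Delta(F,G)$. With $H_D=\bigcap_{(F,G)\in D}L_2^s(F+G)$, a function $h^0\in H_D$ is *minimax-robust* if $\max_D\Delta(h^0;F,G)$ is attained and is at most $\sup_D\Delta(h;F,G)$ for every $h\in H_D$. **Operators.** A pair $(F,G)$ satisfies the *minimality condition* if $F+G$ is invertible a.e. and $(F+G)^{-1}$ is integrable. Then let $B(k,j)$, $R(k,j)$, $Q(k,j)$ be the Fourier coefficients (with $\frac1{2\pi}\int\cdot\,e^{-in\lambda}d\lambda$) of $(F+G)^{-1}$ at $n=k-j$, of $F(F+G)^{-1}$ at $n=k+j$, and of $F(F+G)^{-1}G$ at $n=k-j$, and put $$(\mathbf Bc)(k)^\top=\sum_{j\in U}c(j)^\top B(k,j),\qquad (\mathbf Ra)(k)^\top=\sum_{j\in Z^S}\vec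 a(j)^\top R(k,j)\quad(k\in U),$$ $$\langle\mathbf Qa,a\rangle=\sum_{k,j\in Z^S}\vec a(k)^\top Q(k,j)\overline{\vec a(j)} .$$ $\mathbf B$ may be unbounded, so $c=\mathbf B^{-1}\mathbf Ra$ is understood as follows: there are finitely supported sequences $u_n$ on $U$ with $u_n(k)\to c(k)$ and $(\mathbf Bu_n)(k)\to(\mathbf Ra)(k)$ for every $k\in U$, whose symbols $\sum_k u_n(k)e^{ik\lambda}$ converge in $L_2((F+G)^{-1})$ to a function $C(\lambda)$, which is denoted $\sum_{k\in U}c(k)e^{ik\lambda}$; and $\langle\mathbf Ra,\mathbf B^{-1}\mathbf Ra\rangle=\lim_n\langle\mathbf Ra,u_n\rangle$. Define $$h(F,G)^\top=\bigl(A^\top F-C^\top\bigr)(F+G)^{-1}.\tag{4}$$ **Classes.** Let $G_1$ be a fixed spectral density with entries $g^1_{ij}$, let $p,\delta,p_k,\delta_k,\delta_{ij}$ be real numbers and let $P,B_1,B_2$ be positive definite Hermitian matrices. Write $\langle B,F\rangle=\sum_{k,l}b_{kl}f_{kl}$ and $\|u\|^2=\frac1{2\pi}\int_{-\pi}^\pi|u|^2d\lambda$.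 The four pairs of classes $D_0^k\times D_{2\delta}^k$ consist of the pairs $(F,G)$ of spectral densities with 1. $\frac1{2\pi}\int\mathrm{Tr}\,F=p$ and $\|\mathrm{Tr}(G-G_1)\|^2\le\delta$; 2. $\frac1{2\pi}\int f_{kk}=p_k$ and $\|g_{kk}-g^1_{kk}\|^2\le\delta_k$ for all $k$; 3. $\frac1{2\pi}\int\langle B_1,F\rangle=p$ and $\|\langle B_2,G-G_1\rangle\|^2\le\delta$; 4. $\frac1{2\pi}\int F=P$ and $\|g_{ij}-g^1_{ij}\|^2\le\delta_{ij}$ for all $i,j$. **Relations.** For $(F^0,G^0)$ satisfying the minimality condition, let $\Sigma=F^0+G^0$, let $C^0$ be the function $C$ of this pair, and let $\rho_G^\top=A^\top G^0+(C^0)^\top$, $\rho_F^\top=A^\top F^0-(C^0)^\top$. The relations for the four pairs are the following, a.e., together with equality in all the inequality constraints on $G^0$: 1. $\overline{\rho_G}\rho_G^\top=\alpha^2\Sigma^2$ and $\overline{\rho_F}\rho_F^\top=\beta^2\,\mathrm{Tr}(G^0-G_1)\,\Sigma^2$, with $\alpha,\beta\in\mathbb R$; 2. $\overline{\rho_G}\rho_G^\top=\Sigma\{\alpha_k^2\delta_{kl}\}\Sigma$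 and $\overline{\rho_F}\rho_F^\top=\Sigma\{\beta_k^2(g^0_{kk}-g^1_{kk})\delta_{kl}\}\Sigma$, with $\alpha_k,\beta_k\in\mathbb R$; 3. $\overline{\rho_G}\rho_G^\top=\alpha^2\Sigma B_1^\top\Sigma$ and $\overline{\rho_F}\rho_F^\top=\beta^2\langle B_2,G^0-G_1\rangle\,\Sigma^2$, with $\alpha,\beta\in\mathbb R$; 4. $\overline{\rho_G}\rho_G^\top=\Sigma\,\vec\alpha\vec\alpha^{*}\,\Sigma$ and $\overline{\rho_F}\rho_F^\top=\Sigma\{\beta_{ij}(g^0_{ij}-g^1_{ij})\}\Sigma$, with $\vec\alpha\in\mathbb C^T$ and $\beta_{ij}\ge0$. **Theorem.** Let $D=D_0^k\times D_{2\delta}^k$ be one of the four pairs of classes, and let $(F^0,G^0)\in D$ satisfy the minimality condition. Then $(\mathbf B^0)^{-1}\mathbf R^0a$ exists, and $h^0=h(F^0,G^0)$ given by (4) is the spectral characteristic of the optimal estimate for $(F^0,G^0)$. Moreover: (a) $(F^0,G^0)$ is least favorable in $D$ if and only if it solves the extremal problem of maximizing $\langle\mathbf Ra,\mathbf B^{-1}\mathbf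 Ra\rangle+\langle\mathbf Qa,a\rangle$ over the pairs in $D$ that satisfy the minimality condition. (b) If $(F^0,G^0)$ is least favorable and $h^0\in H_D$, then $h^0$ is minimax-robust, and every minimax-robust spectral characteristic equals $h^0$ a.e. (c) If $(F^0,G^0)$ satisfies the relations of its pair of classes for some multipliers, then it solves the extremal problem, it is least favorable in $D$, $h^0\in H_D$, and $h^0$ given by (4) is the minimax-robust spectral characteristic, unique up to a.e. equality. -/

import Mathlib

open MeasureTheory Filter Topology Matrix
open scoped ENNReal ComplexOrder

noncomputable section

/-- Lebesgue measure on one period `(-π, π]`. -/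
def periodMeasure : Measure ℝ := volume.restrict (Set.Ioc (-Real.pi) Real.pi)

/-- Normalized integral `(1/2π) ∫_{-π}^{π} f`. -/
def mean (f : ℝ → ℂ) : ℂ := (2 * Real.pi : ℂ)⁻¹ * ∫ x, f x ∂periodMeasure

/-- Normalized integral of a real function. -/
def meanR (f : ℝ → ℝ) : ℝ := (2 * Real.pi)⁻¹ * ∫ x, f x ∂periodMeasure

/-- The exponential `e^{inx}`. -/
def expo (n : ℤ) (x : ℝ) : ℂ := Complex.exp (Complex.I * n * x)

/-- The Fourier coefficient `(1/2π) ∫ f(x) e^{-inx} dx`. -/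
def fcoef (f : ℝ → ℂ) (n : ℤ) : ℂ := mean fun x => f x * expo (-n) x

/-- Matrix-valued functions on the frequency axis. -/
abbrev MatFun (T : ℕ) := ℝ → Matrix (Fin T) (Fin T) ℂ

/-- Vector-valued functions on the frequency axis. -/
abbrev VecFun (T : ℕ) := ℝ → Fin T → ℂ

section Weighted

variable {T : ℕ}

/-- Spectral density of a `T`-dimensional stationary sequence: integrable entries, positive
semidefinite (in particular Hermitian) almost everywhere. -/
def IsSpectralDensity (F : MatFun T) : Prop :=
  (∀ i j, Integrable (fun x => F x i j) periodMeasure) ∧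
    ∀ᵐ x ∂periodMeasure, (F x).PosSemidef

/-- Minimality condition `∫ (F + G)⁻¹ < ∞`. -/
def MinimalityCondition (F G : MatFun T) : Prop :=
  (∀ᵐ x ∂periodMeasure, IsUnit (F x + G x).det) ∧
    ∀ i j, Integrable (fun x => (F x + G x)⁻¹ i j) periodMeasure

/-- `∫ h(x)ᵀ W(x) \overline{h(x)} dx`, for a positive semidefinite weight `W`. -/
def energy (W : MatFun T) (h : VecFun T) : ℝ≥0∞ :=
  ∫⁻ x, ENNReal.ofReal (h x ⬝ᵥ (W x *ᵥ star (h x))).re ∂periodMeasure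

/-- The space `L₂(W)`. -/
def L2 (W : MatFun T) : Set (VecFun T) :=
  {h | AEStronglyMeasurable h periodMeasure ∧ energy W h < ⊤}

/-- The pairing `⟨B, F⟩ = ∑ b_{kl} f_{kl} = Tr (Bᵀ F)` (real if both are Hermitian). -/
def pairing (B F : Matrix (Fin T) (Fin T) ℂ) : ℂ := ∑ k, ∑ l, B k l * F k l

end Weighted

/-- The data of the filtering problem: the gaps `{M_l, …, M_l + N_l}`, `l = 1, …, s`, and the
coefficients `a(j)` of the functional `Aξ = ∑_{j ∈ Z^S} a(j)ᵀ ξ(-j)`. -/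
structure FilteringProblem (T : ℕ) where
  s : ℕ
  M : Fin s → ℕ
  N : Fin s → ℕ
  a : ℤ → Fin T → ℂ

namespace FilteringProblem

variable {T : ℕ} (X : FilteringProblem T)

/-- `S = ⋃ {-(M_l + N_l), …, -M_l}`. -/
def S : Set ℤ := ⋃ l, Set.Icc (-((X.M l : ℤ) + X.N l)) (-(X.M l : ℤ))

/-- `S⁺ = ⋃ {M_l, …, M_l + N_l}`. -/
def Splus : Set ℤ := ⋃ l, Set.Icc (X.M l : ℤ) ((X.M l : ℤ) + X.N l)

/-- `Z^S = {1, 2, …} \ S⁺`. -/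
def ZS : Set ℤ := {j | 1 ≤ j} \ X.Splus

/-- Times of observation `{…, -2, -1} \ S`. -/
def obs : Set ℤ := {j | j ≤ -1} \ X.S

/-- `U = S ∪ {0, 1, 2, …}`. -/
def U : Set ℤ := X.S ∪ {j | 0 ≤ j}

/-- `∑_{j ∈ Z^S} ∑_k |a_k(j)| < ∞`. -/
def SummableCoeffs : Prop := Summable fun j : X.ZS => ∑ k, ‖X.a j k‖

/-- `A(e^{ix}) = ∑_{j ∈ Z^S} a(j) e^{-ijx}`. -/
def A : VecFun T := fun x => ∑' j : X.ZS, expo (-(j : ℤ)) x • X.a j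

/-- Linear span of the functions `e^{inx} δ_k`, `n` a time of observation. -/
def obsPoly : Submodule ℂ (VecFun T) :=
  Submodule.span ℂ {f | ∃ n ∈ X.obs, ∃ k : Fin T, f = fun x => Pi.single k (expo n x)}

/-- `L₂ˢ(W)`: the closure of the above span in `L₂(W)`. -/
def L2s (W : MatFun T) : Set (VecFun T) :=
  {h | h ∈ L2 W ∧ ∀ ε : ℝ≥0∞, 0 < ε → ∃ q ∈ X.obsPoly, energy W (h - q) < ε}

/-- The mean-square error `Δ(h; F, G)` of the estimate with spectral characteristic `h`. -/
def err (h : VecFun T) (F G : MatFun T) : ℝ≥0∞ :=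
  ENNReal.ofReal (2 * Real.pi)⁻¹ * (energy F (X.A - h) + energy G h)

/-- `h` is the spectral characteristic of a mean-square optimal linear estimate. -/
def IsOptimal (h : VecFun T) (F G : MatFun T) : Prop :=
  h ∈ X.L2s (F + G) ∧ ∀ g ∈ X.L2s (F + G), X.err h F G ≤ X.err g F G

/-- `Δ(F, G)`: the mean-square error of the optimal linear estimate. -/
def minErr (F G : MatFun T) : ℝ≥0∞ := ⨅ h ∈ X.L2s (F + G), X.err h F G

/-- Least favorable densities in `D_F × D_G`. -/
def IsLeastFavorable (DF DG : Set (MatFun T)) (F₀ G₀ : MatFun T) : Prop :=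
  F₀ ∈ DF ∧ G₀ ∈ DG ∧ ∀ F ∈ DF, ∀ G ∈ DG, X.minErr F G ≤ X.minErr F₀ G₀

/-- `H_D`: the intersection of the spaces `L₂ˢ(F + G)`. -/
def HD (DF DG : Set (MatFun T)) : Set (VecFun T) :=
  {h | ∀ F ∈ DF, ∀ G ∈ DG, h ∈ X.L2s (F + G)}

/-- Minimax-robust spectral characteristic: `h` lies in `H_D`, the maximum of `Δ(h; F, G)` over
`D_F × D_G` is attained, and it does not exceed the supremum for any other element of `H_D`. -/
def IsMinimaxRobust (DF DG : Set (MatFun T)) (h : VecFun T) : Prop :=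
  h ∈ X.HD DF DG ∧
    ∃ m : ℝ≥0∞, IsGreatest {e | ∃ F ∈ DF, ∃ G ∈ DG, e = X.err h F G} m ∧
      ∀ g ∈ X.HD DF DG, m ≤ ⨆ F ∈ DF, ⨆ G ∈ DG, X.err g F G

section Operators

variable (F G : MatFun T)

/-- The block `B(k,j)`: Fourier coefficient of `(F + G)⁻¹` at `k - j`. -/
def blockB (k j : ℤ) : Matrix (Fin T) (Fin T) ℂ :=
  Matrix.of fun p q => fcoef (fun x => (F x + G x)⁻¹ p q) (k - j)

/-- The block `R(k,j)`: Fourier coefficient of `F (F + G)⁻¹` at `k + j`. -/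
def blockR (k j : ℤ) : Matrix (Fin T) (Fin T) ℂ :=
  Matrix.of fun p q => fcoef (fun x => (F x * (F x + G x)⁻¹) p q) (k + j)

/-- The block `Q(k,j)`: Fourier coefficient of `F (F + G)⁻¹ G` at `k - j`. -/
def blockQ (k j : ℤ) : Matrix (Fin T) (Fin T) ℂ :=
  Matrix.of fun p q => fcoef (fun x => (F x * (F x + G x)⁻¹ * G x) p q) (k - j)

/-- `(R a)(k)ᵀ = ∑_{j ∈ Z^S} a(j)ᵀ R(k,j)`. -/
def Ra (k : ℤ) : Fin T → ℂ := ∑' j : X.ZS, X.a j ᵥ* blockR F G k j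

/-- `⟨Q a, a⟩ = ∑_{k,j ∈ Z^S} a(k)ᵀ Q(k,j) \overline{a(j)}`. -/
def Qaa : ℂ := ∑' k : X.ZS, ∑' j : X.ZS, X.a k ⬝ᵥ (blockQ F G k j *ᵥ star (X.a j))

/-- `(B u)(k)ᵀ = ∑_j u(j)ᵀ B(k,j)` for a finitely supported sequence `u`. -/
def opB (u : ℤ →₀ (Fin T → ℂ)) (k : ℤ) : Fin T → ℂ := u.sum fun j v => v ᵥ* blockB F G k j

/-- `⟨R a, u⟩` for a finitely supported sequence `u`. -/
def RaInner (u : ℤ →₀ (Fin T → ℂ)) : ℂ := u.sum fun k v => X.Ra F G k ⬝ᵥ star v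

/-- `∑_k u(k) e^{ikx}` for a finitely supported sequence `u`. -/
def trigSum (u : ℤ →₀ (Fin T → ℂ)) : VecFun T := fun x => u.sum fun k v => expo k x • v

/-- The sequence `c = B⁻¹ R a` on `U` and its symbol `C(x) = ∑_{k ∈ U} c(k) e^{ikx}`.

Under the minimality condition alone `B` need not be bounded, so `B` is taken with its
closed-form domain: `c` is a limit of finitely supported sequences `u n` on `U` whose symbols
converge to `C` in `L₂((F + G)⁻¹)`, the norm given by `⟨B u, u⟩`, and along which
`(B (u n))(k) → (R a)(k)` for `k ∈ U`. -/
structure ApproxInvBRa (u : ℕ → ℤ →₀ (Fin T → ℂ)) (c : ℤ → Fin T → ℂ) (C : VecFun T) :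
    Prop where
  support : ∀ n, ∀ k, k ∉ X.U → u n k = 0
  coeff : ∀ k, Tendsto (fun n => u n k) atTop (𝓝 (c k))
  measurable : AEStronglyMeasurable C periodMeasure
  symbol : Tendsto (fun n => energy (fun x => (F x + G x)⁻¹) (C - trigSum (u n))) atTop (𝓝 0)
  equation : ∀ k ∈ X.U, Tendsto (fun n => opB F G (u n) k) atTop (𝓝 (X.Ra F G k))

/-- `c = B⁻¹ R a`, with symbol `C`. -/
def IsInvBRa (c : ℤ → Fin T → ℂ) (C : VecFun T) : Prop := ∃ u, X.ApproxInvBRa F G u c C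

/-- `v = ⟨R a, B⁻¹ R a⟩ + ⟨Q a, a⟩`. -/
def IsOperatorValue (v : ℝ) : Prop :=
  ∃ u c C, X.ApproxInvBRa F G u c C ∧
    Tendsto (fun n => X.RaInner F G (u n) + X.Qaa F G) atTop (𝓝 (v : ℂ))

/-- The numerator `A(e^{ix})ᵀ F(x) - C(x)ᵀ` of `r_F(x)ᵀ`. -/
def numF (C : VecFun T) : VecFun T := fun x => X.A x ᵥ* F x - C x

/-- The numerator `A(e^{ix})ᵀ G(x) + C(x)ᵀ` of `r_G(x)ᵀ`. -/
def numG (C : VecFun T) : VecFun T := fun x => X.A x ᵥ* G x + C x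

/-- `h(e^{ix})ᵀ = A(e^{ix})ᵀ F (F + G)⁻¹ - C(x)ᵀ (F + G)⁻¹`. -/
def specChar (C : VecFun T) : VecFun T := fun x =>
  X.A x ᵥ* (F x * (F x + G x)⁻¹) - C x ᵥ* (F x + G x)⁻¹

end Operators

/-- `(F₀, G₀)` solves the constrained optimization problem of maximizing
`⟨R a, B⁻¹ R a⟩ + ⟨Q a, a⟩` over the pairs in `D_F × D_G` for which the operators are defined. -/
def SolvesExtremal (DF DG : Set (MatFun T)) (F₀ G₀ : MatFun T) : Prop :=
  F₀ ∈ DF ∧ G₀ ∈ DG ∧ ∃ v₀, X.IsOperatorValue F₀ G₀ v₀ ∧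
    ∀ F ∈ DF, ∀ G ∈ DG, MinimalityCondition F G → ∀ v, X.IsOperatorValue F G v → v ≤ v₀

end FilteringProblem

/-- The four pairs of classes `D₀ᵏ × D_{2δ}ᵏ`, with their parameters. -/
inductive ClassPair (T : ℕ) where
  | first (p δ : ℝ) (G₁ : MatFun T)
  | second (p δ : Fin T → ℝ) (G₁ : MatFun T)
  | third (p δ : ℝ) (B₁ B₂ : Matrix (Fin T) (Fin T) ℂ) (G₁ : MatFun T)
  | fourth (P : Matrix (Fin T) (Fin T) ℂ) (δ : Fin T → Fin T → ℝ) (G₁ : MatFun T)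

namespace ClassPair

variable {T : ℕ}

/-- `G₁` is a spectral density, `P`, `B₁`, `B₂` are positive definite Hermitian matrices. -/
def Valid : ClassPair T → Prop
  | first _ _ G₁ => IsSpectralDensity G₁
  | second _ _ G₁ => IsSpectralDensity G₁
  | third _ _ B₁ B₂ G₁ => B₁.PosDef ∧ B₂.PosDef ∧ IsSpectralDensity G₁
  | fourth P _ G₁ => P.PosDef ∧ IsSpectralDensity G₁

/-- The class `D₀ᵏ`. -/
def DF : ClassPair T → Set (MatFun T)
  | first p _ _ => {F | IsSpectralDensity F ∧ mean (fun x => (F x).trace) = p}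
  | second p _ _ => {F | IsSpectralDensity F ∧ ∀ k, mean (fun x => F x k k) = p k}
  | third p _ B₁ _ _ => {F | IsSpectralDensity F ∧ mean (fun x => pairing B₁ (F x)) = p}
  | fourth P _ _ => {F | IsSpectralDensity F ∧ ∀ i j, mean (fun x => F x i j) = P i j}

/-- The class `D_{2δ}ᵏ`. -/
def DG : ClassPair T → Set (MatFun T)
  | first _ δ G₁ => {G | IsSpectralDensity G ∧
      Integrable (fun x => ‖(G x - G₁ x).trace‖ ^ 2) periodMeasure ∧
      meanR (fun x => ‖(G x - G₁ x).trace‖ ^ 2) ≤ δ}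
  | second _ δ G₁ => {G | IsSpectralDensity G ∧ ∀ k,
      Integrable (fun x => ‖G x k k - G₁ x k k‖ ^ 2) periodMeasure ∧
      meanR (fun x => ‖G x k k - G₁ x k k‖ ^ 2) ≤ δ k}
  | third _ δ _ B₂ G₁ => {G | IsSpectralDensity G ∧
      Integrable (fun x => ‖pairing B₂ (G x - G₁ x)‖ ^ 2) periodMeasure ∧
      meanR (fun x => ‖pairing B₂ (G x - G₁ x)‖ ^ 2) ≤ δ}
  | fourth _ δ G₁ => {G | IsSpectralDensity G ∧ ∀ i j,
      Integrable (fun x => ‖G x i j - G₁ x i j‖ ^ 2) periodMeasure ∧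
      meanR (fun x => ‖G x i j - G₁ x i j‖ ^ 2) ≤ δ i j}

/-- The relation between `r_G` and `F + G`. Here `y` is the numerator of `r_G`, so that
`vecMulVec (star (y x)) (y x)` has entries `\overline{y_k} y_l`. -/
def RelationF (D : ClassPair T) (F G : MatFun T) (y : VecFun T) : Prop :=
  match D with
  | first _ _ _ => ∃ α : ℝ, ∀ᵐ x ∂periodMeasure,
      vecMulVec (star (y x)) (y x) = ((α ^ 2 : ℝ) : ℂ) • (F x + G x) ^ 2
  | second _ _ _ => ∃ α : Fin T → ℝ, ∀ᵐ x ∂periodMeasure,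
      vecMulVec (star (y x)) (y x) =
        (F x + G x) * diagonal (fun k => ((α k ^ 2 : ℝ) : ℂ)) * (F x + G x)
  | third _ _ B₁ _ _ => ∃ α : ℝ, ∀ᵐ x ∂periodMeasure,
      vecMulVec (star (y x)) (y x) =
        ((α ^ 2 : ℝ) : ℂ) • ((F x + G x) * B₁ᵀ * (F x + G x))
  | fourth _ _ _ => ∃ α : Fin T → ℂ, ∀ᵐ x ∂periodMeasure,
      vecMulVec (star (y x)) (y x) = (F x + G x) * vecMulVec α (star α) * (F x + G x)

/-- The relation between `r_F` and `F + G`. Here `z` is the numerator of `r_F`. -/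
def RelationG (D : ClassPair T) (F G : MatFun T) (z : VecFun T) : Prop :=
  match D with
  | first _ _ G₁ => ∃ β : ℝ, ∀ᵐ x ∂periodMeasure,
      vecMulVec (star (z x)) (z x) =
        (((β ^ 2 : ℝ) : ℂ) * (G x - G₁ x).trace) • (F x + G x) ^ 2
  | second _ _ G₁ => ∃ β : Fin T → ℝ, ∀ᵐ x ∂periodMeasure,
      vecMulVec (star (z x)) (z x) =
        (F x + G x) * diagonal (fun k => ((β k ^ 2 : ℝ) : ℂ) * (G x k k - G₁ x k k)) *
          (F x + G x)
  | third _ _ _ B₂ G₁ => ∃ β : ℝ, ∀ᵐ x ∂periodMeasure,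
      vecMulVec (star (z x)) (z x) =
        (((β ^ 2 : ℝ) : ℂ) * pairing B₂ (G x - G₁ x)) • (F x + G x) ^ 2
  | fourth _ _ G₁ => ∃ β : Fin T → Fin T → ℝ, (∀ i j, 0 ≤ β i j) ∧
      ∀ᵐ x ∂periodMeasure, vecMulVec (star (z x)) (z x) =
        (F x + G x) * Matrix.of (fun i j => (β i j : ℂ) * (G x i j - G₁ x i j)) * (F x + G x)

/-- The inequality constraints of the class `D_{2δ}ᵏ` hold as equalities. -/
def Active (D : ClassPair T) (G : MatFun T) : Prop :=
  match D with
  | first _ δ G₁ => meanR (fun x => ‖(G x - G₁ x).trace‖ ^ 2) = δ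
  | second _ δ G₁ => ∀ k, meanR (fun x => ‖G x k k - G₁ x k k‖ ^ 2) = δ k
  | third _ δ _ B₂ G₁ => meanR (fun x => ‖pairing B₂ (G x - G₁ x)‖ ^ 2) = δ
  | fourth _ δ G₁ => ∀ i j, meanR (fun x => ‖G x i j - G₁ x i j‖ ^ 2) = δ i j

end ClassPair

end

/-!
Put `W = F + G`, `Δ(h; F, G)` for the error of `h`, and `z = A F W⁻¹`. Completing the square
(`quad_sub_add_quad`) gives `2π Δ(h; F, G) = ‖h - z‖²_W + ‖A‖²_Q`, where `Q = F W⁻¹ G`, so the best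
estimate is the projection of `z` onto the span of the times of observation in `L₂(W)`.

*The optimal estimate.* Let `C` be the projection of `A F` onto the closed span of the frequencies
in `U` in `L₂(W⁻¹)` (`exists_projection`, by a measurable square root of the weight). The Fourier
coefficients of `h⁰ = (A F - C) W⁻¹` vanish on `U`, and this is the equation `B c = R a`
(`exists_isInvBRa`). Two facts are needed in the absence of boundedness of `W` and `W⁻¹`: that `h⁰`
lies in the closed span of the observations, and that `C` is orthogonal to this span. Both follow
from a form of Smirnov's theorem, `integral_sum_mul_eq_zero_of_analytic`: if `f` has frequencies
`≥ 0` and `g` has frequencies `> 0`, both integrable, and `∑ f_k g_k` is integrable, then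
`∫ ∑ f_k g_k = 0`. It is proved by multiplying Fejér means of `f_k` and `g_k` with the squares of the
analytic functions `(1 + H / c)⁻¹`, where `Re H` on the circle is the Fejér mean of
`∑ (|f_k| + |g_k|)`: these multipliers make the products bounded and tend to one. Hence
`err_eq_add`: the error of an estimate `h` exceeds that of `h⁰` by the squared distance of `h` to
`h⁰`, and the minimal error is `⟨R a, B⁻¹ R a⟩ + ⟨Q a, a⟩`.

*Least favorable pairs.* The error `Δ(h; F, G)` is affine in the pair, hence the minimal error is
concave (`minErr_mix_ge`). A mixture of any pair of `D` with `(F⁰, G⁰)` satisfies the minimality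
condition, so the extremal problem over the pairs with this condition has the same value as the
problem over `D`. If `(F⁰, G⁰)` is least favorable, differentiating the concave function along
segments that start at `(F⁰, G⁰)` gives `Δ(h⁰; F, G) ≤ Δ(h⁰; F⁰, G⁰)` on `D`
(`err_le_of_isLeastFavorable`): `(h⁰, (F⁰, G⁰))` is a saddle point. Robustness follows, and
uniqueness follows from `err_eq_add`.

*The relations.* In all cases the classes are given by linear functionals `⟨B_i, ·⟩` of the densities:
their means are fixed for `F`, and their `L₂` distances from those of `G₁` are bounded for `G`. The
relations say that `\overline{r_G} r_Gᵀ` with `r_G = A - h⁰` is a constant combination of the `B_iᵀ`,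
so that the first term of `Δ(h⁰; F, G)` is constant on the class, and that `\overline{r_F} r_Fᵀ` with
`r_F = h⁰` is a nonnegative combination with coefficients proportional to the deviations of `G⁰`, so
that the second term is largest at `G⁰` (`energy_le_of_mem_deviationClass`). Thus
`Δ(h⁰; F, G) ≤ Δ(h⁰; F⁰, G⁰)` on `D`, which makes `(F⁰, G⁰)` least favorable.
-/

noncomputable section

/-! ### Fourier coefficients on one period -/

instance : IsFiniteMeasure periodMeasure := by
  unfold periodMeasure; infer_instance

lemma continuous_expo (n : ℤ) : Continuous (expo n) := by
  unfold expo; fun_prop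

@[simp] lemma norm_expo (n : ℤ) (x : ℝ) : ‖expo n x‖ = 1 := by
  have : Complex.I * n * x = ((n * x : ℝ) : ℂ) * Complex.I := by push_cast; ring
  rw [expo, this, Complex.norm_exp_ofReal_mul_I]

lemma expo_add (m n : ℤ) (x : ℝ) : expo (m + n) x = expo m x * expo n x := by
  simp only [expo, ← Complex.exp_add]; congr 1; push_cast; ring

@[simp] lemma expo_zero (x : ℝ) : expo 0 x = 1 := by simp [expo]

@[simp] lemma star_expo (n : ℤ) (x : ℝ) : star (expo n x) = expo (-n) x := by
  simp only [expo, Complex.star_def, ← Complex.exp_conj]; congr 1; simp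

lemma expo_natCast (n : ℕ) (x : ℝ) : expo n x = expo 1 x ^ n := by
  simp only [expo, ← Complex.exp_nat_mul]; congr 1; push_cast; ring

lemma expo_one (x : ℝ) : expo 1 x = circleMap 0 1 x := by
  simp [expo, circleMap, mul_comm]

lemma two_pi_ne_zero : (2 * Real.pi : ℂ) ≠ 0 := by
  exact_mod_cast Real.two_pi_pos.ne'

lemma integral_periodMeasure {E : Type*} [NormedAddCommGroup E] [NormedSpace ℝ E] (f : ℝ → E) :
    ∫ x, f x ∂periodMeasure = ∫ x in -Real.pi..Real.pi, f x := by
  rw [intervalIntegral.integral_of_le (by linarith [Real.pi_pos])]; rfl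

/-- Mean value property: the mean over the unit circle of a function analytic in the disc. -/
lemma mean_comp_expo {Ψ : ℂ → ℂ} (h : DiffContOnCl ℂ Ψ (Metric.ball 0 1)) :
    mean (fun x => Ψ (expo 1 x)) = Ψ 0 := by
  have h1 : Real.circleAverage Ψ 0 1 = Ψ 0 := DiffContOnCl.circleAverage (by simpa using h)
  rw [← h1, mean, Real.circleAverage, integral_periodMeasure]
  have hper : Function.Periodic (fun x : ℝ => Ψ (circleMap 0 1 x)) (2 * Real.pi) := fun x => by
    simp only [periodic_circleMap 0 1 x]
  have := hper.intervalIntegral_add_eq (-Real.pi) 0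
  rw [show -Real.pi + 2 * Real.pi = Real.pi by ring, zero_add] at this
  simp only [expo_one, this, Complex.real_smul]
  push_cast; rfl

lemma mean_add {f g : ℝ → ℂ} (hf : Integrable f periodMeasure) (hg : Integrable g periodMeasure) :
    mean (fun x => f x + g x) = mean f + mean g := by
  rw [mean, integral_add hf hg, mul_add]; rfl

lemma mean_sub {f g : ℝ → ℂ} (hf : Integrable f periodMeasure) (hg : Integrable g periodMeasure) :
    mean (fun x => f x - g x) = mean f - mean g := by
  rw [mean, integral_sub hf hg, mul_sub]; rfl

lemma mean_const_mul (c : ℂ) (f : ℝ → ℂ) : mean (fun x => c * f x) = c * mean f := by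
  rw [mean, integral_const_mul, mean]; ring

lemma mean_mul_const (c : ℂ) (f : ℝ → ℂ) : mean (fun x => f x * c) = mean f * c := by
  rw [mean, integral_mul_const, mean]; ring

lemma mean_finsetSum {ι : Type*} (s : Finset ι) {f : ι → ℝ → ℂ}
    (hf : ∀ i ∈ s, Integrable (f i) periodMeasure) :
    mean (fun x => ∑ i ∈ s, f i x) = ∑ i ∈ s, mean (f i) := by
  rw [mean, integral_finsetSum _ hf, Finset.mul_sum]; rfl

lemma mean_congr_ae {f g : ℝ → ℂ} (h : f =ᵐ[periodMeasure] g) : mean f = mean g := by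
  rw [mean, integral_congr_ae h, mean]

lemma mean_star (f : ℝ → ℂ) : mean (fun x => star (f x)) = star (mean f) := by
  simp only [mean, Complex.star_def, integral_conj, map_mul, map_inv₀, Complex.conj_ofReal,
    map_ofNat]

lemma norm_mean_le (f : ℝ → ℂ) :
    ‖mean f‖ ≤ (2 * Real.pi)⁻¹ * ∫ x, ‖f x‖ ∂periodMeasure := by
  rw [mean, norm_mul, norm_inv, show ‖(2 * Real.pi : ℂ)‖ = 2 * Real.pi by
    simp [abs_of_pos Real.pi_pos]]
  gcongr
  exact norm_integral_le_integral_norm f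

lemma mean_one : mean (fun _ => 1) = 1 := by
  have := mean_comp_expo (Ψ := fun _ => 1) (differentiable_const _).diffContOnCl
  simpa using this

lemma mean_expo (n : ℤ) : mean (expo n) = if n = 0 then 1 else 0 := by
  have key : ∀ m : ℕ, mean (expo m) = if m = 0 then 1 else 0 := fun m => by
    have h : Differentiable ℂ (fun z : ℂ => z ^ m) := by fun_prop
    have h1 := mean_comp_expo (Ψ := fun z => z ^ m) h.diffContOnCl
    simp only [← expo_natCast] at h1
    rw [show mean (expo m) = mean (fun x => expo m x) from rfl, h1]
    exact zero_pow_eq m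
  obtain ⟨m, rfl | rfl⟩ := n.eq_nat_or_neg
  · simpa using key m
  · have : mean (expo (-m)) = star (mean (expo m)) := by
      rw [← mean_star]; simp
    rw [this, key]; split_ifs <;> simp_all

lemma Integrable.mul_expo {f : ℝ → ℂ} (hf : Integrable f periodMeasure) (n : ℤ) :
    Integrable (fun x => f x * expo n x) periodMeasure :=
  hf.mul_bdd (c := 1) (continuous_expo n).aestronglyMeasurable (by simp)

lemma integrable_expo (n : ℤ) : Integrable (expo n) periodMeasure := by
  simpa using Integrable.mul_expo (integrable_const (1 : ℂ)) n

lemma fcoef_add {f g : ℝ → ℂ} (hf : Integrable f periodMeasure) (hg : Integrable g periodMeasure)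
    (n : ℤ) : fcoef (fun x => f x + g x) n = fcoef f n + fcoef g n := by
  simp only [fcoef, add_mul]; exact mean_add (Integrable.mul_expo hf _) (Integrable.mul_expo hg _)

lemma fcoef_sub {f g : ℝ → ℂ} (hf : Integrable f periodMeasure) (hg : Integrable g periodMeasure)
    (n : ℤ) : fcoef (fun x => f x - g x) n = fcoef f n - fcoef g n := by
  simp only [fcoef, sub_mul]; exact mean_sub (Integrable.mul_expo hf _) (Integrable.mul_expo hg _)

lemma fcoef_const_mul (c : ℂ) (f : ℝ → ℂ) (n : ℤ) :
    fcoef (fun x => c * f x) n = c * fcoef f n := by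
  simp only [fcoef, mul_assoc]; exact mean_const_mul _ _

lemma fcoef_finsetSum {ι : Type*} (s : Finset ι) {f : ι → ℝ → ℂ}
    (hf : ∀ i ∈ s, Integrable (f i) periodMeasure) (n : ℤ) :
    fcoef (fun x => ∑ i ∈ s, f i x) n = ∑ i ∈ s, fcoef (f i) n := by
  simp only [fcoef, Finset.sum_mul]
  exact mean_finsetSum s fun i hi => Integrable.mul_expo (hf i hi) _

lemma fcoef_expo (k n : ℤ) : fcoef (expo k) n = if k = n then 1 else 0 := by
  have : (fun x => expo k x * expo (-n) x) = expo (k - n) := by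
    ext x; rw [sub_eq_add_neg, expo_add]
  rw [fcoef, this, mean_expo]; simp [sub_eq_zero]

lemma fcoef_mul_expo (f : ℝ → ℂ) (m n : ℤ) :
    fcoef (fun x => f x * expo m x) n = fcoef f (n - m) := by
  simp only [fcoef, mul_assoc, ← expo_add]; congr! 4; ring

lemma fcoef_star (f : ℝ → ℂ) (n : ℤ) :
    fcoef (fun x => star (f x)) n = star (fcoef f (-n)) := by
  rw [fcoef, fcoef, ← mean_star]; simp

lemma norm_fcoef_le (f : ℝ → ℂ) (n : ℤ) :
    ‖fcoef f n‖ ≤ (2 * Real.pi)⁻¹ * ∫ x, ‖f x‖ ∂periodMeasure := by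
  refine (norm_mean_le _).trans_eq ?_
  simp

lemma integral_eq_two_pi_mul_mean (f : ℝ → ℂ) :
    ∫ x, f x ∂periodMeasure = 2 * Real.pi * mean f := by
  rw [mean, mul_inv_cancel_left₀ two_pi_ne_zero]

/-! ### Fejér means -/

/-- The Fejér mean of order `N` of `f`, the average of the partial sums of its Fourier series,
written as a double sum so that its kernel `N⁻¹ |∑_{j < N} e^{ijx}|²` is visibly nonnegative. -/
def fejer (N : ℕ) (f : ℝ → ℂ) (x : ℝ) : ℂ :=
  (N : ℂ)⁻¹ * ∑ j ∈ Finset.range N, ∑ l ∈ Finset.range N,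
    fcoef f ((j : ℤ) - l) * expo ((j : ℤ) - l) x

lemma continuous_fejer (N : ℕ) (f : ℝ → ℂ) : Continuous (fejer N f) := by
  have := continuous_expo
  unfold fejer; fun_prop

lemma integrable_fejer (N : ℕ) (f : ℝ → ℂ) : Integrable (fejer N f) periodMeasure :=
  ((continuous_fejer N f).integrableOn_Icc (a := -Real.pi) (b := Real.pi)).mono_set
    Set.Ioc_subset_Icc_self

/-- The nonnegative Fejér kernel. -/
def fejerKernel (N : ℕ) (x t : ℝ) : ℝ :=
  (N : ℝ)⁻¹ * ‖∑ j ∈ Finset.range N, expo j x * expo (-j) t‖ ^ 2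

lemma fejer_eq_mean {N : ℕ} {f : ℝ → ℂ} (hf : Integrable f periodMeasure) (x : ℝ) :
    fejer N f x = mean (fun t => f t * (fejerKernel N x t : ℂ)) := by
  have h1 : ∀ t, f t * (fejerKernel N x t : ℂ) = (N : ℂ)⁻¹ * ∑ j ∈ Finset.range N,
      ∑ l ∈ Finset.range N, (f t * expo (-((j : ℤ) - l)) t) * expo ((j : ℤ) - l) x := fun t => by
    have h2 : ((‖∑ j ∈ Finset.range N, expo j x * expo (-j) t‖ ^ 2 : ℝ) : ℂ) =
        ∑ j ∈ Finset.range N, ∑ l ∈ Finset.range N,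
          expo (-((j : ℤ) - l)) t * expo ((j : ℤ) - l) x := by
      push_cast
      rw [← Complex.mul_conj', map_sum, Finset.sum_mul_sum]
      refine Finset.sum_congr rfl fun j _ => Finset.sum_congr rfl fun l _ => ?_
      rw [map_mul, ← Complex.star_def, star_expo, star_expo, neg_neg, neg_sub, sub_eq_add_neg,
        sub_eq_add_neg, expo_add, expo_add]
      ring
    rw [fejerKernel, Complex.ofReal_mul, h2]
    push_cast
    simp only [mul_assoc, ← Finset.mul_sum]
    ring
  simp only [h1]
  rw [mean_const_mul, mean_finsetSum]
  · rw [fejer]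
    congr 1
    refine Finset.sum_congr rfl fun j _ => ?_
    rw [mean_finsetSum]
    · refine Finset.sum_congr rfl fun l _ => ?_
      rw [mean_mul_const]; rfl
    · exact fun l _ => (Integrable.mul_expo hf _).mul_const _
  · exact fun j _ => integrable_finsetSum _ fun l _ => (Integrable.mul_expo hf _).mul_const _

lemma fejer_ofReal {N : ℕ} {w : ℝ → ℝ} (hw : Integrable w periodMeasure) (x : ℝ) :
    fejer N (fun t => (w t : ℂ)) x =
      (((2 * Real.pi)⁻¹ * ∫ t, w t * fejerKernel N x t ∂periodMeasure : ℝ) : ℂ) := by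
  rw [fejer_eq_mean (f := fun t => (w t : ℂ)) hw.ofReal, mean]
  push_cast
  rw [← integral_complex_ofReal]
  push_cast
  rfl

lemma fejerKernel_nonneg (N : ℕ) (x t : ℝ) : 0 ≤ fejerKernel N x t := by
  unfold fejerKernel; positivity

lemma continuous_fejerKernel (N : ℕ) (x : ℝ) : Continuous (fejerKernel N x) := by
  have := continuous_expo
  unfold fejerKernel; fun_prop

lemma fejerKernel_le (N : ℕ) (x t : ℝ) : fejerKernel N x t ≤ (N : ℝ)⁻¹ * N ^ 2 := by
  unfold fejerKernel
  gcongr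
  refine (norm_sum_le _ _).trans (by simp)

lemma Integrable.mul_fejerKernel {w : ℝ → ℝ} (hw : Integrable w periodMeasure) (N : ℕ) (x : ℝ) :
    Integrable (fun t => w t * fejerKernel N x t) periodMeasure :=
  hw.mul_bdd (c := (N : ℝ)⁻¹ * N ^ 2) (continuous_fejerKernel N x).aestronglyMeasurable
    (.of_forall fun t => by
      rw [Real.norm_of_nonneg (fejerKernel_nonneg N x t)]; exact fejerKernel_le N x t)

lemma norm_fejer_le {N : ℕ} {f : ℝ → ℂ} {w : ℝ → ℝ} (hf : Integrable f periodMeasure)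
    (hw : Integrable w periodMeasure) (hfw : ∀ t, ‖f t‖ ≤ w t) (x : ℝ) :
    ‖fejer N f x‖ ≤ (fejer N (fun t => (w t : ℂ)) x).re := by
  rw [fejer_eq_mean hf, fejer_ofReal hw, Complex.ofReal_re]
  refine (norm_mean_le _).trans ?_
  gcongr ?_ * ?_
  refine integral_mono_of_nonneg (.of_forall fun t => norm_nonneg _)
    (Integrable.mul_fejerKernel hw N x) (.of_forall fun t => ?_)
  simp only [norm_mul, Complex.norm_real, Real.norm_of_nonneg (fejerKernel_nonneg N x t)]
  exact mul_le_mul_of_nonneg_right (hfw t) (fejerKernel_nonneg N x t)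

lemma mean_fejer {N : ℕ} (hN : N ≠ 0) (f : ℝ → ℂ) : mean (fejer N f) = mean f := by
  unfold fejer
  rw [mean_const_mul, mean_finsetSum]
  · have : ∀ j ∈ Finset.range N, mean (fun x => ∑ l ∈ Finset.range N,
        fcoef f ((j : ℤ) - l) * expo ((j : ℤ) - l) x) = mean f := fun j hj => by
      rw [mean_finsetSum _ fun l _ => (integrable_expo _).const_mul _]
      simp only [mean_const_mul]
      rw [Finset.sum_eq_single j]
      · simp [mean_expo, fcoef]
      · intro l _ hl
        rw [mean_expo, if_neg (by omega), mul_zero]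
      · exact fun h => absurd hj h
    rw [Finset.sum_congr rfl this]
    simp [hN]
  · exact fun j _ => integrable_finsetSum _ fun l _ => (integrable_expo _).const_mul _

/-- Fejér means are contractions of `L₁`. -/
lemma integral_norm_fejer_le {N : ℕ} (hN : N ≠ 0) {f : ℝ → ℂ} (hf : Integrable f periodMeasure) :
    ∫ x, ‖fejer N f x‖ ∂periodMeasure ≤ ∫ x, ‖f x‖ ∂periodMeasure := by
  have h1 : ∫ x, ‖fejer N f x‖ ∂periodMeasure ≤
      ∫ x, (fejer N (fun t => (‖f t‖ : ℂ)) x).re ∂periodMeasure :=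
    integral_mono (integrable_fejer N f).norm (integrable_fejer N _).re
      fun x => norm_fejer_le hf hf.norm (fun _ => le_rfl) x
  refine h1.trans_eq ?_
  have h2 := integral_re (𝕜 := ℂ) (integrable_fejer N (fun t => (‖f t‖ : ℂ)))
  have h3 := congrArg Complex.re (integral_eq_two_pi_mul_mean (fejer N (fun t => (‖f t‖ : ℂ))))
  rw [mean_fejer hN, ← integral_eq_two_pi_mul_mean, integral_complex_ofReal,
    Complex.ofReal_re] at h3
  exact h2.trans h3

lemma fejer_sub {N : ℕ} {f g : ℝ → ℂ} (hf : Integrable f periodMeasure)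
    (hg : Integrable g periodMeasure) (x : ℝ) :
    fejer N (fun t => f t - g t) x = fejer N f x - fejer N g x := by
  simp only [fejer, fcoef_sub hf hg, sub_mul, Finset.sum_sub_distrib, mul_sub]

lemma fejer_sum {N : ℕ} {ι : Type*} (s : Finset ι) {f : ι → ℝ → ℂ}
    (hf : ∀ i ∈ s, Integrable (f i) periodMeasure) (x : ℝ) :
    fejer N (fun t => ∑ i ∈ s, f i t) x = ∑ i ∈ s, fejer N (f i) x := by
  simp only [fejer, fcoef_finsetSum s hf]
  rw [← Finset.mul_sum (s := s)]
  congr 1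
  symm
  rw [Finset.sum_comm]
  refine Finset.sum_congr rfl fun j _ => ?_
  rw [Finset.sum_comm]
  simp only [Finset.sum_mul]

lemma fejer_const_mul {N : ℕ} (c : ℂ) (f : ℝ → ℂ) (x : ℝ) :
    fejer N (fun t => c * f t) x = c * fejer N f x := by
  simp only [fejer, fcoef_const_mul, mul_assoc, ← Finset.mul_sum]; ring

lemma fejer_expo (N : ℕ) (k : ℤ) (x : ℝ) :
    fejer N (expo k) x = (N : ℂ)⁻¹ * ((N - k.natAbs : ℕ) : ℂ) * expo k x := by
  have h1 : ∀ j l : ℕ, fcoef (expo k) ((j : ℤ) - l) * expo ((j : ℤ) - l) x =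
      if k = (j : ℤ) - l then expo k x else 0 := fun j l => by
    rw [fcoef_expo]; split_ifs with h
    · rw [h, one_mul]
    · rw [zero_mul]
  have h2 : ((Finset.range N ×ˢ Finset.range N).filter
      fun p : ℕ × ℕ => k = (p.1 : ℤ) - p.2).card = N - k.natAbs := by
    rw [← Finset.card_range (N - k.natAbs)]
    refine (Finset.card_nbij' (fun i => (i + k.toNat, i + (-k).toNat)) (fun p => min p.1 p.2)
      ?_ ?_ ?_ ?_).symm
    · intro i hi
      simp only [Finset.coe_range, Set.mem_Iio, Finset.coe_filter, Finset.mem_product,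
        Finset.mem_range, Set.mem_ofPred_eq] at *
      omega
    · intro p hp
      simp only [Finset.coe_range, Set.mem_Iio, Finset.coe_filter, Finset.mem_product,
        Finset.mem_range, Set.mem_ofPred_eq] at *
      omega
    · intro i hi
      dsimp only
      omega
    · rintro ⟨a, b⟩ hp
      simp only [Finset.coe_filter, Finset.mem_product, Finset.mem_range, Set.mem_ofPred_eq] at hp
      simp only [Prod.mk.injEq]
      omega
  rw [fejer]
  simp only [h1]
  rw [← Finset.sum_product', ← Finset.sum_filter, Finset.sum_const, h2, nsmul_eq_mul, mul_assoc]

lemma tendsto_fejer_expo (k : ℤ) :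
    Tendsto (fun N => ∫ x, ‖fejer N (expo k) x - expo k x‖ ∂periodMeasure) atTop (𝓝 0) := by
  have h1 : ∀ᶠ N : ℕ in atTop, ∫ x, ‖fejer N (expo k) x - expo k x‖ ∂periodMeasure =
      k.natAbs / N * ∫ _, 1 ∂periodMeasure := by
    filter_upwards [eventually_ge_atTop (k.natAbs + 1)] with N hN
    rw [← integral_const_mul]
    refine integral_congr_ae (.of_forall fun x => ?_)
    have hN0 : (N : ℂ) ≠ 0 := by norm_cast; omega
    have : fejer N (expo k) x - expo k x = -((k.natAbs : ℂ) / N) * expo k x := by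
      rw [fejer_expo, Nat.cast_sub (by omega)]; field_simp; ring
    simp only [this, norm_mul, norm_neg, norm_div, norm_expo, mul_one, Complex.norm_natCast]
  rw [tendsto_congr' h1]
  simpa using (tendsto_const_div_atTop_nhds_zero_nat (k.natAbs : ℝ)).mul_const
    (∫ _, (1 : ℝ) ∂periodMeasure)

/-- Trigonometric polynomials are dense in `L₁` of one period. -/
lemma exists_trigPoly_integral_norm_sub_lt {f : ℝ → ℂ} (hf : Integrable f periodMeasure) {ε : ℝ}
    (hε : 0 < ε) : ∃ c : ℤ →₀ ℂ,
      ∫ x, ‖f x - ∑ k ∈ c.support, c k * expo k x‖ ∂periodMeasure < ε := by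
  have hT : Fact (0 < 2 * Real.pi) := ⟨Real.two_pi_pos⟩
  have hμ : periodMeasure = volume.restrict (Set.Ioc (-Real.pi) (-Real.pi + 2 * Real.pi)) := by
    rw [show -Real.pi + 2 * Real.pi = Real.pi by ring]; rfl
  set F : AddCircle (2 * Real.pi) → ℂ := AddCircle.liftIoc (2 * Real.pi) (-Real.pi) f with hF
  have hFm : MemLp F 1 AddCircle.haarAddCircle := by
    rw [memLp_haarAddCircle_iff]
    exact MemLp.memLp_liftIoc (by rw [← hμ]; exact memLp_one_iff_integrable.2 hf)
  have hmem : hFm.toLp F ∈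
      (Submodule.span ℂ (Set.range (@fourierLp (2 * Real.pi) _ 1 _))).topologicalClosure := by
    rw [span_fourierLp_closure_eq_top (by simp)]; trivial
  obtain ⟨g, hg, hgε⟩ := Metric.mem_closure_iff.1 hmem (ε / (2 * Real.pi))
    (div_pos hε Real.two_pi_pos)
  obtain ⟨c, rfl⟩ := (Finsupp.mem_span_range_iff_exists_finsupp).1 hg
  refine ⟨c, ?_⟩
  have hae : (↑↑(hFm.toLp F - c.sum fun i a => a • fourierLp (T := 2 * Real.pi) 1 i) :
      AddCircle (2 * Real.pi) → ℂ) =ᵐ[AddCircle.haarAddCircle]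
      fun t => F t - ∑ k ∈ c.support, c k * fourier k t := by
    have h1 : (↑↑(c.sum fun i a => a • fourierLp (T := 2 * Real.pi) 1 i) :
        AddCircle (2 * Real.pi) → ℂ) =ᵐ[AddCircle.haarAddCircle]
        fun t => ∑ k ∈ c.support, c k * fourier k t := by
      refine (Lp.coeFn_finsetSum _ _).trans ?_
      have : ∀ k : ℤ, (↑↑(c k • fourierLp (T := 2 * Real.pi) 1 k) : AddCircle (2 * Real.pi) → ℂ)
          =ᵐ[AddCircle.haarAddCircle] fun t => c k * fourier k t := fun k => by
        filter_upwards [Lp.coeFn_smul (c k) (fourierLp (T := 2 * Real.pi) 1 k),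
          coeFn_fourierLp (T := 2 * Real.pi) 1 k] with t h1 h2
        rw [h1, Pi.smul_apply, h2, smul_eq_mul]
      filter_upwards [ae_all_iff.2 this] with t ht
      simp [Finset.sum_apply, ht]
    filter_upwards [Lp.coeFn_sub (hFm.toLp F) (c.sum fun i a => a • fourierLp (T := 2 * Real.pi) 1 i),
      hFm.coeFn_toLp, h1] with t h2 h3 h4
    rw [h2, Pi.sub_apply, h3, h4]
  rw [dist_eq_norm, L1.norm_eq_integral_norm, integral_congr_ae (hae.mono fun t ht => by
    show _ = ‖F t - ∑ k ∈ c.support, c k * fourier k t‖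
    rw [ht]), AddCircle.integral_haarAddCircle, smul_eq_mul,
    inv_mul_lt_iff₀ Real.two_pi_pos, mul_div_cancel₀ _ Real.two_pi_pos.ne'] at hgε
  have h5 : ∫ t : AddCircle (2 * Real.pi), ‖F t - ∑ k ∈ c.support, c k * fourier k t‖ =
      ∫ x, ‖f x - ∑ k ∈ c.support, c k * expo k x‖ ∂periodMeasure := by
    rw [← AddCircle.intervalIntegral_preimage (2 * Real.pi) (-Real.pi), hμ,
      intervalIntegral.integral_of_le (by linarith [Real.pi_pos])]
    refine setIntegral_congr_fun measurableSet_Ioc fun x hx => ?_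
    have h6 : ∀ k : ℤ, fourier k (x : AddCircle (2 * Real.pi)) = expo k x := fun k => by
      rw [fourier_coe_apply, expo]
      congr 1
      have := Complex.ofReal_ne_zero.2 Real.pi_ne_zero
      push_cast
      field_simp
    simp only [hF, AddCircle.liftIoc_coe_apply hx, h6]
  rwa [h5] at hgε

/-- Fejér means converge in `L₁`. -/
lemma tendsto_fejer {f : ℝ → ℂ} (hf : Integrable f periodMeasure) :
    Tendsto (fun N => ∫ x, ‖fejer N f x - f x‖ ∂periodMeasure) atTop (𝓝 0) := by
  rw [Metric.tendsto_nhds]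
  intro ε hε
  obtain ⟨c, hc⟩ := exists_trigPoly_integral_norm_sub_lt hf (ε := ε / 3) (by positivity)
  set p : ℝ → ℂ := fun x => ∑ k ∈ c.support, c k * expo k x with hp
  have hpi : Integrable p periodMeasure :=
    integrable_finsetSum _ fun k _ => (integrable_expo k).const_mul _
  have hlim : Tendsto (fun N => ∑ k ∈ c.support,
      ‖c k‖ * ∫ x, ‖fejer N (expo k) x - expo k x‖ ∂periodMeasure) atTop (𝓝 0) := by
    have : Tendsto (fun N => ∑ k ∈ c.support,
      ‖c k‖ * ∫ x, ‖fejer N (expo k) x - expo k x‖ ∂periodMeasure) atTop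
        (𝓝 (∑ k ∈ c.support, ‖c k‖ * 0)) :=
      tendsto_finsetSum _ fun k _ => (tendsto_fejer_expo k).const_mul _
    simpa using this
  filter_upwards [hlim.eventually (gt_mem_nhds (show (0 : ℝ) < ε / 3 by positivity)),
    eventually_ge_atTop 1] with N hN hN1
  have hpN : ∀ x, fejer N p x - p x =
      ∑ k ∈ c.support, c k * (fejer N (expo k) x - expo k x) := fun x => by
    rw [hp, fejer_sum _ fun k _ => (integrable_expo k).const_mul _]
    simp only [fejer_const_mul, ← Finset.sum_sub_distrib, mul_sub]
  have hpN' : ∫ x, ‖fejer N p x - p x‖ ∂periodMeasure < ε / 3 := by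
    refine lt_of_le_of_lt ?_ hN
    have hi : ∀ k ∈ c.support, Integrable
        (fun x => ‖c k‖ * ‖fejer N (expo k) x - expo k x‖) periodMeasure := fun k _ =>
      ((integrable_fejer _ _).sub (integrable_expo k)).norm.const_mul _
    simp only [← integral_const_mul]
    rw [← integral_finsetSum _ hi]
    refine integral_mono ((integrable_fejer _ _).sub hpi).norm (integrable_finsetSum _ hi)
      fun x => ?_
    dsimp only
    rw [hpN]
    exact (norm_sum_le _ _).trans (by simp)
  have hd : ∫ x, ‖fejer N (fun t => f t - p t) x‖ ∂periodMeasure < ε / 3 :=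
    (integral_norm_fejer_le (by omega) (hf.sub hpi)).trans_lt hc
  rw [dist_zero_right, Real.norm_of_nonneg (integral_nonneg fun _ => norm_nonneg _)]
  have hA := ((integrable_fejer N fun t => f t - p t).norm)
  have hB : Integrable (fun x => ‖fejer N p x - p x‖) periodMeasure :=
    ((integrable_fejer N p).sub hpi).norm
  have hC : Integrable (fun x => ‖f x - p x‖) periodMeasure := (hf.sub hpi).norm
  have : ∫ x, ‖fejer N f x - f x‖ ∂periodMeasure ≤
      ∫ x, (‖fejer N (fun t => f t - p t) x‖ + ‖fejer N p x - p x‖ + ‖f x - p x‖)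
        ∂periodMeasure := by
    refine integral_mono ((integrable_fejer _ _).sub hf).norm ((hA.fun_add hB).fun_add hC) fun x => ?_
    dsimp only
    rw [fejer_sub hf hpi]
    have : fejer N f x - f x = (fejer N f x - fejer N p x) + (fejer N p x - p x) - (f x - p x) := by
      ring
    rw [this]
    exact (norm_sub_le _ _).trans (add_le_add_left (norm_add_le _ _) _)
  rw [integral_add (hA.fun_add hB) hC, integral_add hA hB] at this
  linarith

/-! ### Analytic polynomials attached to Fejér means -/

/-- The analytic part `N⁻¹ ∑_{l ≤ j < N} f̂(j - l) z^{j - l}` of the Fejér mean. -/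
def fejerAnalytic (N : ℕ) (f : ℝ → ℂ) (z : ℂ) : ℂ :=
  (N : ℂ)⁻¹ * ∑ j ∈ Finset.range N, ∑ l ∈ Finset.range N,
    if l ≤ j then fcoef f ((j : ℤ) - l) * z ^ (j - l) else 0

lemma differentiable_fejerAnalytic (N : ℕ) (f : ℝ → ℂ) :
    Differentiable ℂ (fejerAnalytic N f) := by
  unfold fejerAnalytic
  refine (Differentiable.fun_sum fun j _ => Differentiable.fun_sum fun l _ => ?_).const_mul _
  split_ifs <;> fun_prop

lemma fejerAnalytic_expo {N : ℕ} {f : ℝ → ℂ} (hf : ∀ n < 0, fcoef f n = 0) (x : ℝ) :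
    fejerAnalytic N f (expo 1 x) = fejer N f x := by
  unfold fejerAnalytic fejer
  congr 1
  refine Finset.sum_congr rfl fun j _ => Finset.sum_congr rfl fun l _ => ?_
  split_ifs with h
  · rw [← expo_natCast, Nat.cast_sub h]
  · rw [hf _ (by omega), zero_mul]

lemma fejerAnalytic_zero {N : ℕ} (hN : N ≠ 0) (f : ℝ → ℂ) :
    fejerAnalytic N f 0 = fcoef f 0 := by
  unfold fejerAnalytic
  have : ∀ j ∈ Finset.range N, (∑ l ∈ Finset.range N,
      if l ≤ j then fcoef f ((j : ℤ) - l) * (0 : ℂ) ^ (j - l) else 0) = fcoef f 0 := fun j hj => by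
    rw [Finset.sum_eq_single j]
    · simp
    · intro l _ hl
      split_ifs with h
      · rw [zero_pow (by omega), mul_zero]
      · rfl
    · exact fun h => absurd hj h
  rw [Finset.sum_congr rfl this]
  simp [hN]

/-- The analytic polynomial whose real part on the circle is the Fejér mean of a real function. -/
def fejerHerglotz (N : ℕ) (w : ℝ → ℂ) (z : ℂ) : ℂ := 2 * fejerAnalytic N w z - fcoef w 0

lemma re_fejerHerglotz_expo {N : ℕ} (hN : N ≠ 0) {w : ℝ → ℂ} (hw : ∀ x, star (w x) = w x)
    (x : ℝ) : (fejerHerglotz N w (expo 1 x)).re = (fejer N w x).re := by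
  have hc : ∀ n, fcoef w (-n) = star (fcoef w n) := fun n => by
    rw [← neg_neg n, neg_neg (-n), ← fcoef_star]; simp [hw]
  have h1 : fejerAnalytic N w (expo 1 x) + star (fejerAnalytic N w (expo 1 x)) =
      fejer N w x + fcoef w 0 := by
    have h2 : star (fejerAnalytic N w (expo 1 x)) =
        (N : ℂ)⁻¹ * ∑ j ∈ Finset.range N, ∑ l ∈ Finset.range N,
          if j ≤ l then fcoef w ((j : ℤ) - l) * expo ((j : ℤ) - l) x else 0 := by
      unfold fejerAnalytic
      rw [star_mul', star_sum]
      congr 1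
      · simp
      · simp only [star_sum]
        rw [Finset.sum_comm]
        refine Finset.sum_congr rfl fun j _ => Finset.sum_congr rfl fun l _ => ?_
        by_cases h : j ≤ l
        · rw [if_pos h, if_pos h, ← expo_natCast, star_mul', star_expo, ← hc, Nat.cast_sub h]
          simp
        · rw [if_neg h, if_neg h, star_zero]
    have h3 : fcoef w 0 = (N : ℂ)⁻¹ * ∑ j ∈ Finset.range N, ∑ l ∈ Finset.range N,
        if j = l then fcoef w 0 else 0 := by
      have hN' : (N : ℂ) ≠ 0 := by exact_mod_cast hN
      rw [Finset.sum_congr rfl fun j hj => by rw [Finset.sum_ite_eq, if_pos hj]]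
      simp [hN']
    rw [h2, h3, fejerAnalytic, fejer, ← mul_add, ← mul_add, ← Finset.sum_add_distrib,
      ← Finset.sum_add_distrib]
    congr 1
    refine Finset.sum_congr rfl fun j _ => ?_
    rw [← Finset.sum_add_distrib, ← Finset.sum_add_distrib]
    refine Finset.sum_congr rfl fun l _ => ?_
    rcases lt_trichotomy j l with h | h | h
    · rw [if_neg (by omega), if_pos h.le, if_neg h.ne]; ring
    · subst h; simp
    · rw [if_pos h.le, if_neg (by omega), if_neg h.ne', ← expo_natCast, Nat.cast_sub h.le]
  have h4 := congrArg Complex.re h1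
  have h5 : (fcoef w 0).im = 0 := by
    have := congrArg Complex.im (hc 0)
    simp at this; linarith
  simp only [fejerHerglotz, Complex.add_re, Complex.star_def, Complex.conj_re, Complex.sub_re,
    Complex.mul_re, Complex.re_ofNat, Complex.im_ofNat, zero_mul, sub_zero] at h4 ⊢
  linarith

lemma differentiable_fejerHerglotz (N : ℕ) (w : ℝ → ℂ) :
    Differentiable ℂ (fejerHerglotz N w) :=
  ((differentiable_fejerAnalytic N w).const_mul 2).sub_const _

/-- The Herglotz polynomial of a nonnegative function has nonnegative real part in the disc, by the
maximum principle for `exp (-H)`. -/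
lemma re_fejerHerglotz_nonneg {N : ℕ} (hN : N ≠ 0) {w : ℝ → ℝ} (hw : Integrable w periodMeasure)
    (hw0 : ∀ x, 0 ≤ w x) {z : ℂ} (hz : z ∈ Metric.closedBall (0 : ℂ) 1) :
    0 ≤ (fejerHerglotz N (fun x => (w x : ℂ)) z).re := by
  have hd : Differentiable ℂ fun z => Complex.exp (-fejerHerglotz N (fun x => (w x : ℂ)) z) :=
    (differentiable_fejerHerglotz N _).neg.cexp
  have := Complex.norm_le_of_forall_mem_frontier_norm_le (U := Metric.ball (0 : ℂ) 1)
    Metric.isBounded_ball hd.diffContOnCl (C := 1) (fun ζ hζ => ?_)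
    (z := z) (by rwa [closure_ball _ one_ne_zero])
  · rw [Complex.norm_exp, Complex.neg_re, Real.exp_le_one_iff] at this
    linarith
  · rw [frontier_ball _ one_ne_zero, mem_sphere_zero_iff_norm] at hζ
    obtain ⟨x, rfl⟩ : ∃ x : ℝ, expo 1 x = ζ := ⟨ζ.arg, by
      have := Complex.norm_mul_exp_arg_mul_I ζ
      rw [hζ] at this
      simpa [expo, mul_comm] using this⟩
    rw [Complex.norm_exp, Complex.neg_re, Real.exp_le_one_iff,
      re_fejerHerglotz_expo hN (by simp)]
    have : ‖fejer N (fun _ => (0 : ℂ)) x‖ ≤ _ :=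
      norm_fejer_le (N := N) (integrable_zero _ _ _) hw (by simpa using hw0) x
    linarith [norm_nonneg (fejer N (fun _ => (0 : ℂ)) x)]

/-! ### A Smirnov theorem -/

lemma exists_subseq_tendsto_ae_zero {α E : Type*} [MeasurableSpace α] [NormedAddCommGroup E]
    {ν : Measure α} {r : ℕ → α → E} (hr : ∀ n, AEStronglyMeasurable (r n) ν)
    (h : Tendsto (fun n => ∫⁻ x, ‖r n x‖ₑ ∂ν) atTop (𝓝 0)) :
    ∃ σ : ℕ → ℕ, StrictMono σ ∧ ∀ᵐ x ∂ν, Tendsto (fun i => r (σ i) x) atTop (𝓝 0) := by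
  have := tendstoInMeasure_of_tendsto_eLpNorm (p := 1) (g := fun _ => (0 : E)) one_ne_zero hr
    aestronglyMeasurable_const (l := atTop) (by
      simpa [eLpNorm_one_eq_lintegral_enorm] using h)
  exact this.exists_seq_tendsto_ae

lemma exists_subseq_tendsto_ae_zero_of_integral {α E : Type*} [MeasurableSpace α]
    [NormedAddCommGroup E] {ν : Measure α} {r : ℕ → α → E} (hr : ∀ n, Integrable (r n) ν)
    (h : Tendsto (fun n => ∫ x, ‖r n x‖ ∂ν) atTop (𝓝 0)) :
    ∃ σ : ℕ → ℕ, StrictMono σ ∧ ∀ᵐ x ∂ν, Tendsto (fun i => r (σ i) x) atTop (𝓝 0) := by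
  refine exists_subseq_tendsto_ae_zero (fun n => (hr n).1) ?_
  have := (ENNReal.continuous_ofReal.tendsto 0).comp h
  simp only [ENNReal.ofReal_zero] at this
  refine this.congr fun n => ?_
  rw [Function.comp_apply, ofReal_integral_norm_eq_lintegral_enorm (hr n)]

/-- The analytic multiplier `(1 + H / c)⁻¹`, where `H` is the Herglotz polynomial of `w ≥ 0`. It is
bounded by `1` in the disc, by `c / fejer N w` on the circle, and tends to `1` as `c → ∞`. -/
def damping (c : ℝ) (N : ℕ) (w : ℝ → ℝ) (z : ℂ) : ℂ :=
  (1 + fejerHerglotz N (fun x => (w x : ℂ)) z / c)⁻¹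

section damping

variable {c : ℝ} {N : ℕ} {w : ℝ → ℝ}

lemma one_le_re_damping_inv (hc : 0 < c) (hN : N ≠ 0) (hw : Integrable w periodMeasure)
    (hw0 : ∀ x, 0 ≤ w x) {z : ℂ} (hz : z ∈ Metric.closedBall (0 : ℂ) 1) :
    1 ≤ (1 + fejerHerglotz N (fun x => (w x : ℂ)) z / c).re := by
  have := div_nonneg (re_fejerHerglotz_nonneg hN hw hw0 hz) hc.le
  rw [Complex.add_re, Complex.one_re, Complex.div_ofReal_re]
  linarith

lemma expo_mem_closedBall (n : ℤ) (x : ℝ) : expo n x ∈ Metric.closedBall (0 : ℂ) 1 := by simp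

lemma diffContOnCl_damping (hc : 0 < c) (hN : N ≠ 0) (hw : Integrable w periodMeasure)
    (hw0 : ∀ x, 0 ≤ w x) : DiffContOnCl ℂ (damping c N w) (Metric.ball 0 1) := by
  refine DiffContOnCl.inv (Differentiable.diffContOnCl ?_) fun z hz h => ?_
  · exact ((differentiable_fejerHerglotz N _).div_const _).const_add 1
  · rw [closure_ball _ one_ne_zero] at hz
    have := one_le_re_damping_inv hc hN hw hw0 hz
    rw [h] at this
    norm_num at this

lemma norm_damping_le_one (hc : 0 < c) (hN : N ≠ 0) (hw : Integrable w periodMeasure)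
    (hw0 : ∀ x, 0 ≤ w x) (x : ℝ) : ‖damping c N w (expo 1 x)‖ ≤ 1 := by
  rw [damping, norm_inv]
  exact inv_le_one_of_one_le₀ ((one_le_re_damping_inv hc hN hw hw0
    (expo_mem_closedBall 1 x)).trans (Complex.re_le_norm _))

lemma mul_norm_damping_le (hc : 0 < c) (hN : N ≠ 0) (hw : Integrable w periodMeasure)
    (hw0 : ∀ x, 0 ≤ w x) (x : ℝ) :
    (fejer N (fun x => (w x : ℂ)) x).re * ‖damping c N w (expo 1 x)‖ ≤ c := by
  have h1 := one_le_re_damping_inv hc hN hw hw0 (expo_mem_closedBall 1 x)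
  have h2 := Complex.re_le_norm (1 + fejerHerglotz N (fun x => (w x : ℂ)) (expo 1 x) / c)
  rw [damping, norm_inv, ← div_eq_mul_inv, div_le_iff₀ (by linarith)]
  have h3 : (fejer N (fun x => (w x : ℂ)) x).re =
      c * ((1 + fejerHerglotz N (fun x => (w x : ℂ)) (expo 1 x) / c).re - 1) := by
    rw [← re_fejerHerglotz_expo hN (by simp), Complex.add_re, Complex.div_ofReal_re,
      Complex.one_re]
    field_simp; ring
  rw [h3]
  gcongr
  linarith

lemma continuous_damping_expo (hc : 0 < c) (hN : N ≠ 0) (hw : Integrable w periodMeasure)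
    (hw0 : ∀ x, 0 ≤ w x) : Continuous fun x => damping c N w (expo 1 x) := by
  have := (diffContOnCl_damping hc hN hw hw0).continuousOn_ball
  exact this.comp_continuous (continuous_expo 1) (expo_mem_closedBall 1)

lemma Continuous.integrable_periodMeasure {E : Type*} [NormedAddCommGroup E] {f : ℝ → E}
    (hf : Continuous f) : Integrable f periodMeasure :=
  (hf.integrableOn_Icc (a := -Real.pi) (b := Real.pi)).mono_set Set.Ioc_subset_Icc_self

lemma mean_ofReal (f : ℝ → ℝ) : mean (fun x => (f x : ℂ)) = (meanR f : ℂ) := by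
  rw [mean, meanR, integral_complex_ofReal]; push_cast; rfl

lemma integral_sq_norm_damping_sub_one_le (hc : 0 < c) (hN : N ≠ 0)
    (hw : Integrable w periodMeasure) (hw0 : ∀ x, 0 ≤ w x) :
    ∫ x, ‖damping c N w (expo 1 x) - 1‖ ^ 2 ∂periodMeasure ≤ 4 * Real.pi * meanR w / c := by
  set φ : ℝ → ℂ := fun x => damping c N w (expo 1 x) with hφ
  have hcont := continuous_damping_expo hc hN hw hw0
  have h0 : 0 ≤ meanR w :=
    mul_nonneg (inv_nonneg.2 Real.two_pi_pos.le) (integral_nonneg hw0)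
  have hmean : mean φ = (((1 + meanR w / c)⁻¹ : ℝ) : ℂ) := by
    rw [hφ, mean_comp_expo (diffContOnCl_damping hc hN hw hw0), damping, fejerHerglotz,
      fejerAnalytic_zero hN]
    have : fcoef (fun x => (w x : ℂ)) 0 = meanR w := by
      simp only [fcoef, neg_zero, expo_zero, mul_one, mean_ofReal]
    rw [this]; push_cast; ring
  have h1 : ∫ x, ‖φ x - 1‖ ^ 2 ∂periodMeasure ≤ ∫ x, (2 - 2 * (φ x).re) ∂periodMeasure := by
    refine integral_mono (Continuous.integrable_periodMeasure (by fun_prop))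
      (Continuous.integrable_periodMeasure (by fun_prop)) fun x => ?_
    have h2 : ‖φ x‖ ^ 2 ≤ 1 := pow_le_one₀ (norm_nonneg _) (norm_damping_le_one hc hN hw hw0 x)
    rw [← Complex.normSq_eq_norm_sq, Complex.normSq_apply] at h2
    dsimp only
    rw [← Complex.normSq_eq_norm_sq, Complex.normSq_apply]
    simp only [Complex.sub_re, Complex.one_re, Complex.sub_im, Complex.one_im]
    nlinarith
  have h3 : ∫ x, (2 - 2 * (φ x).re) ∂periodMeasure =
      2 * Real.pi * (2 - 2 * (1 + meanR w / c)⁻¹) := by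
    have h4 : ∫ x, (2 - 2 * φ x) ∂periodMeasure = 2 * Real.pi * (2 - 2 * mean φ) := by
      rw [integral_eq_two_pi_mul_mean, mean_sub, mean_const_mul]
      · have := mean_const_mul 2 (fun _ => 1)
        rw [mean_one, mul_one] at this
        rw [this]
      · exact integrable_const _
      · exact (Continuous.integrable_periodMeasure hcont).const_mul _
    have h5 := integral_re (𝕜 := ℂ) (μ := periodMeasure) (f := fun x => 2 - 2 * φ x)
      (Continuous.integrable_periodMeasure (by fun_prop))
    rw [h4, hmean] at h5
    have h6 : (2 * Real.pi * (2 - 2 * (((1 + meanR w / c)⁻¹ : ℝ) : ℂ)) : ℂ) =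
      ((2 * Real.pi * (2 - 2 * (1 + meanR w / c)⁻¹) : ℝ) : ℂ) := by push_cast; ring
    rw [h6] at h5
    refine Eq.trans ?_ (h5.trans (Complex.ofReal_re _))
    simp
  refine h1.trans (h3.trans_le ?_)
  have h7 : 0 ≤ meanR w / c := div_nonneg h0 hc.le
  have h8 : 1 - (1 + meanR w / c)⁻¹ ≤ meanR w / c := by
    have : 1 - meanR w / c ≤ (1 + meanR w / c)⁻¹ := by
      rw [← one_div, le_div_iff₀ (by linarith)]
      nlinarith
    linarith
  calc 2 * Real.pi * (2 - 2 * (1 + meanR w / c)⁻¹)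
      = 4 * Real.pi * (1 - (1 + meanR w / c)⁻¹) := by ring
    _ ≤ 4 * Real.pi * (meanR w / c) := by gcongr
    _ = _ := by ring

end damping

/-- **Smirnov's theorem** for sums of products: if `f k` has no negative frequencies, `g k` has only
positive frequencies, all are integrable, and `∑ k, f k * g k` is integrable, then its integral
vanishes. No integrability of the individual products is needed. -/
theorem integral_sum_mul_eq_zero_of_analytic {ι : Type*} [Fintype ι] {f g : ι → ℝ → ℂ}
    (hf : ∀ k, Integrable (f k) periodMeasure) (hg : ∀ k, Integrable (g k) periodMeasure)
    (hf0 : ∀ k, ∀ n < 0, fcoef (f k) n = 0) (hg0 : ∀ k, ∀ n ≤ 0, fcoef (g k) n = 0)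
    (hfg : Integrable (fun x => ∑ k, f k x * g k x) periodMeasure) :
    ∫ x, ∑ k, f k x * g k x ∂periodMeasure = 0 := by
  set w : ℝ → ℝ := fun x => ∑ k, (‖f k x‖ + ‖g k x‖) with hwdef
  have hw : Integrable w periodMeasure :=
    integrable_finsetSum _ fun k _ => (hf k).norm.add (hg k).norm
  have hw0 : ∀ x, 0 ≤ w x := fun x => Finset.sum_nonneg fun k _ => by positivity
  have hfw : ∀ k x, ‖f k x‖ ≤ w x := fun k x =>
    (le_add_of_nonneg_right (norm_nonneg _)).trans (Finset.single_le_sum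
      (f := fun k => ‖f k x‖ + ‖g k x‖) (fun i _ => by positivity) (Finset.mem_univ k))
  have hgw : ∀ k x, ‖g k x‖ ≤ w x := fun k x =>
    (le_add_of_nonneg_left (norm_nonneg _)).trans (Finset.single_le_sum
      (f := fun k => ‖f k x‖ + ‖g k x‖) (fun i _ => by positivity) (Finset.mem_univ k))
  set s : ℝ → ℂ := fun x => ∑ k, f k x * g k x with hs
  set sN : ℕ → ℝ → ℂ := fun N x => ∑ k, fejer N (f k) x * fejer N (g k) x with hsN
  have hsNc : ∀ N, Continuous (sN N) := fun N => by
    have := continuous_fejer N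
    fun_prop
  -- a common subsequence along which all Fejér means converge almost everywhere
  obtain ⟨σ, hσ, hσlim⟩ : ∃ σ : ℕ → ℕ, StrictMono σ ∧
      ∀ᵐ x ∂periodMeasure, Tendsto (fun i => sN (σ i) x) atTop (𝓝 (s x)) := by
    obtain ⟨σ, hσ, hlim⟩ := exists_subseq_tendsto_ae_zero_of_integral (ν := periodMeasure)
      (r := fun N x => ∑ k, (‖fejer N (f k) x - f k x‖ + ‖fejer N (g k) x - g k x‖))
      (fun N => integrable_finsetSum _ fun k _ =>
        ((integrable_fejer N _).sub (hf k)).norm.add ((integrable_fejer N _).sub (hg k)).norm) (by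
      have h1 : Tendsto (fun N => ∑ k, ((∫ x, ‖fejer N (f k) x - f k x‖ ∂periodMeasure) +
          ∫ x, ‖fejer N (g k) x - g k x‖ ∂periodMeasure)) atTop
          (𝓝 (∑ k : ι, (0 + 0))) :=
        tendsto_finsetSum _ fun k _ => (tendsto_fejer (hf k)).add (tendsto_fejer (hg k))
      simp only [add_zero, Finset.sum_const_zero] at h1
      refine h1.congr fun N => ?_
      have h2 : ∀ k, Integrable (fun x => ‖fejer N (f k) x - f k x‖) periodMeasure := fun k =>
        ((integrable_fejer N _).sub (hf k)).norm
      have h3 : ∀ k, Integrable (fun x => ‖fejer N (g k) x - g k x‖) periodMeasure := fun k =>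
        ((integrable_fejer N _).sub (hg k)).norm
      simp only [← integral_add (h2 _) (h3 _)]
      rw [← integral_finsetSum _ fun k _ => (h2 k).fun_add (h3 k)]
      refine integral_congr_ae (.of_forall fun x => ?_)
      exact (Real.norm_of_nonneg (Finset.sum_nonneg fun k _ => by positivity)).symm)
    refine ⟨σ, hσ, hlim.mono fun x hx => tendsto_finsetSum _ fun k _ => ?_⟩
    have hle : ∀ i, ‖fejer (σ i) (f k) x - f k x‖ + ‖fejer (σ i) (g k) x - g k x‖ ≤
        ∑ k, (‖fejer (σ i) (f k) x - f k x‖ + ‖fejer (σ i) (g k) x - g k x‖) := fun i =>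
      Finset.single_le_sum (f := fun k =>
        ‖fejer (σ i) (f k) x - f k x‖ + ‖fejer (σ i) (g k) x - g k x‖)
        (fun i _ => by positivity) (Finset.mem_univ k)
    refine Tendsto.mul ?_ ?_
    · exact tendsto_iff_norm_sub_tendsto_zero.2 (squeeze_zero (fun _ => norm_nonneg _)
        (fun i => (le_add_of_nonneg_right (norm_nonneg _)).trans (hle i)) hx)
    · exact tendsto_iff_norm_sub_tendsto_zero.2 (squeeze_zero (fun _ => norm_nonneg _)
        (fun i => (le_add_of_nonneg_left (norm_nonneg _)).trans (hle i)) hx)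
  -- Cauchy's theorem for the damped analytic polynomials
  have hcauchy : ∀ c > 0, ∀ N ≠ 0,
      ∫ x, sN N x * damping c N w (expo 1 x) ^ 2 ∂periodMeasure = 0 := fun c hc N hN => by
    have hd : DiffContOnCl ℂ (fun z => (∑ k, fejerAnalytic N (f k) z * fejerAnalytic N (g k) z) *
        (damping c N w z * damping c N w z)) (Metric.ball 0 1) := by
      have h1 := diffContOnCl_damping hc hN hw hw0
      have h2 : Differentiable ℂ fun z =>
          ∑ k, fejerAnalytic N (f k) z * fejerAnalytic N (g k) z :=
        Differentiable.fun_sum fun k _ =>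
          (differentiable_fejerAnalytic N _).mul (differentiable_fejerAnalytic N _)
      have h3 := h2.diffContOnCl (s := Metric.ball 0 1)
      exact h3.smul (h1.smul h1)
    have h4 := mean_comp_expo hd
    rw [integral_eq_two_pi_mul_mean]
    have h5 : (fun x => sN N x * damping c N w (expo 1 x) ^ 2) = fun x =>
        (∑ k, fejerAnalytic N (f k) (expo 1 x) * fejerAnalytic N (g k) (expo 1 x)) *
        (damping c N w (expo 1 x) * damping c N w (expo 1 x)) := by
      ext x
      simp only [fejerAnalytic_expo (hf0 _), hsN,
        fejerAnalytic_expo (fun n hn => hg0 _ n (le_of_lt hn)), sq]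
    rw [h5, h4]
    simp [fejerAnalytic_zero hN, hg0]
  have hbound : ∀ c > 0, ∀ N ≠ 0, ∀ x,
      ‖sN N x‖ * ‖damping c N w (expo 1 x)‖ ^ 2 ≤ Fintype.card ι * c ^ 2 := fun c hc N hN x => by
    have h1 : ‖sN N x‖ ≤ Fintype.card ι * (fejer N (fun x => (w x : ℂ)) x).re ^ 2 := by
      refine (norm_sum_le _ _).trans ((Finset.sum_le_card_nsmul Finset.univ _
        ((fejer N (fun x => (w x : ℂ)) x).re ^ 2) fun k _ => ?_).trans (by simp))
      rw [norm_mul, sq]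
      exact mul_le_mul (norm_fejer_le (hf k) hw (hfw k) x) (norm_fejer_le (hg k) hw (hgw k) x)
        (norm_nonneg _) ((norm_nonneg _).trans (norm_fejer_le (hf k) hw (hfw k) x))
    have h2 := mul_norm_damping_le hc hN hw hw0 x
    have h3 : 0 ≤ (fejer N (fun x => (w x : ℂ)) x).re :=
      (norm_nonneg _).trans (norm_fejer_le (N := N) (f := fun _ => 0) (integrable_zero _ _ _) hw
        (by simpa using hw0) x)
    calc ‖sN N x‖ * ‖damping c N w (expo 1 x)‖ ^ 2
        ≤ (Fintype.card ι * (fejer N (fun x => (w x : ℂ)) x).re ^ 2) *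
          ‖damping c N w (expo 1 x)‖ ^ 2 := by gcongr
      _ = Fintype.card ι * ((fejer N (fun x => (w x : ℂ)) x).re *
          ‖damping c N w (expo 1 x)‖) ^ 2 := by ring
      _ ≤ _ := by gcongr
  -- for fixed damping, the integrals of the damped limit tend to zero
  have hfixed : ∀ c > 0, Tendsto (fun i => ‖∫ x, s x * damping c (σ (i + 1)) w (expo 1 x) ^ 2
      ∂periodMeasure‖) atTop (𝓝 0) := fun c hc => by
    have hN : ∀ i, σ (i + 1) ≠ 0 := fun i => by have := hσ.id_le (i + 1); simp at this; omega
    have hdc := fun i => continuous_damping_expo hc (hN i) hw hw0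
    have h1 : Tendsto (fun i => ∫ x, ‖s x - sN (σ (i + 1)) x‖ *
        ‖damping c (σ (i + 1)) w (expo 1 x)‖ ^ 2 ∂periodMeasure) atTop
        (𝓝 (∫ _, (0 : ℝ) ∂periodMeasure)) := by
      refine tendsto_integral_of_dominated_convergence
        (fun x => ‖s x‖ + Fintype.card ι * c ^ 2) (fun i => ?_)
        (hfg.norm.add (integrable_const _)) (fun i => .of_forall fun x => ?_) ?_
      · exact ((hfg.1.sub (hsNc _).aestronglyMeasurable).norm).mul
          ((hdc i).norm.pow 2).aestronglyMeasurable
      · have h2 := norm_damping_le_one hc (hN i) hw hw0 x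
        have h3 := hbound c hc _ (hN i) x
        have h4 : ‖damping c (σ (i + 1)) w (expo 1 x)‖ ^ 2 ≤ 1 := pow_le_one₀ (norm_nonneg _) h2
        rw [Real.norm_of_nonneg (by positivity)]
        calc ‖s x - sN (σ (i + 1)) x‖ * ‖damping c (σ (i + 1)) w (expo 1 x)‖ ^ 2
            ≤ (‖s x‖ + ‖sN (σ (i + 1)) x‖) * ‖damping c (σ (i + 1)) w (expo 1 x)‖ ^ 2 := by
              gcongr; exact norm_sub_le _ _
          _ = ‖s x‖ * ‖damping c (σ (i + 1)) w (expo 1 x)‖ ^ 2 +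
              ‖sN (σ (i + 1)) x‖ * ‖damping c (σ (i + 1)) w (expo 1 x)‖ ^ 2 := by ring
          _ ≤ ‖s x‖ * 1 + Fintype.card ι * c ^ 2 := by gcongr
          _ = _ := by ring
      · filter_upwards [hσlim] with x hx
        have h5 := (tendsto_iff_norm_sub_tendsto_zero.1 (hx.comp (tendsto_add_atTop_nat 1)))
        refine squeeze_zero (fun _ => by positivity) (fun i => ?_) h5
        have h4 : ‖damping c (σ (i + 1)) w (expo 1 x)‖ ^ 2 ≤ 1 :=
          pow_le_one₀ (norm_nonneg _) (norm_damping_le_one hc (hN i) hw hw0 x)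
        rw [norm_sub_rev]
        exact mul_le_of_le_one_right (norm_nonneg _) h4
    rw [integral_zero] at h1
    refine squeeze_zero (fun _ => norm_nonneg _) (fun i => ?_) h1
    have hi1 : Integrable (fun x => s x * damping c (σ (i + 1)) w (expo 1 x) ^ 2)
        periodMeasure := hfg.mul_bdd (c := 1) ((hdc i).pow 2).aestronglyMeasurable
        (.of_forall fun x => by
          rw [norm_pow]
          exact pow_le_one₀ (norm_nonneg _) (norm_damping_le_one hc (hN i) hw hw0 x))
    have hi2 : Integrable (fun x => sN (σ (i + 1)) x * damping c (σ (i + 1)) w (expo 1 x) ^ 2)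
        periodMeasure := Continuous.integrable_periodMeasure ((hsNc _).mul ((hdc i).pow 2))
    have h6 := integral_sub hi1 hi2
    rw [hcauchy c hc _ (hN i), sub_zero] at h6
    rw [← h6]
    refine (norm_integral_le_integral_norm _).trans_eq ?_
    simp only [← sub_mul, norm_mul, norm_pow]
  -- let the damping tend to one along a diagonal sequence
  choose i hi using fun n : ℕ => ((hfixed (n + 1) (by positivity)).eventually
    (gt_mem_nhds (show (0 : ℝ) < 1 / ((n : ℝ) + 1) by positivity))).exists
  have hN : ∀ n, σ (i n + 1) ≠ 0 := fun n => by have := hσ.id_le (i n + 1); simp at this; omega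
  set ψ : ℕ → ℝ → ℂ := fun n x => damping (n + 1) (σ (i n + 1)) w (expo 1 x) with hψ
  have hψc : ∀ n, Continuous (ψ n) := fun n =>
    continuous_damping_expo (by positivity) (hN n) hw hw0
  obtain ⟨τ, hτ, hτlim⟩ := exists_subseq_tendsto_ae_zero_of_integral (ν := periodMeasure)
    (r := fun n x => ‖ψ n x - 1‖ ^ 2)
    (fun n => Continuous.integrable_periodMeasure (by have := hψc n; fun_prop)) (by
      have h1 : Tendsto (fun n : ℕ => (4 * Real.pi * meanR w) * (1 / ((n : ℝ) + 1))) atTop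
          (𝓝 ((4 * Real.pi * meanR w) * 0)) :=
        tendsto_one_div_add_atTop_nhds_zero_nat.const_mul _
      rw [mul_zero] at h1
      refine squeeze_zero (fun n => integral_nonneg fun _ => norm_nonneg _) (fun n => ?_) h1
      simp only [norm_pow, norm_norm]
      refine (integral_sq_norm_damping_sub_one_le (c := n + 1) (by positivity) (hN n)
        hw hw0).trans_eq ?_
      ring)
  have hlim1 : Tendsto (fun n => ∫ x, s x * ψ (τ n) x ^ 2 ∂periodMeasure) atTop
      (𝓝 (∫ x, s x ∂periodMeasure)) := by
    refine tendsto_integral_of_dominated_convergence (fun x => ‖s x‖)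
      (fun n => hfg.1.mul ((hψc _).pow 2).aestronglyMeasurable) hfg.norm
      (fun n => .of_forall fun x => ?_) ?_
    · rw [norm_mul, norm_pow]
      exact mul_le_of_le_one_right (norm_nonneg _) (pow_le_one₀ (norm_nonneg _)
        (norm_damping_le_one (by positivity) (hN _) hw hw0 x))
    · filter_upwards [hτlim] with x hx
      have h1 : Tendsto (fun n => ψ (τ n) x) atTop (𝓝 1) := by
        rw [tendsto_iff_norm_sub_tendsto_zero]
        have := (Real.continuous_sqrt.tendsto 0).comp hx
        simpa [Function.comp_def, Real.sqrt_sq] using this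
      simpa using (h1.pow 2).const_mul (s x)
  have hlim2 : Tendsto (fun n => ∫ x, s x * ψ (τ n) x ^ 2 ∂periodMeasure) atTop (𝓝 0) := by
    rw [tendsto_zero_iff_norm_tendsto_zero]
    exact squeeze_zero (fun _ => norm_nonneg _) (fun n => (hi (τ n)).le)
      (tendsto_one_div_add_atTop_nhds_zero_nat.comp hτ.tendsto_atTop)
  exact tendsto_nhds_unique hlim1 hlim2

variable {T : ℕ}

/-- Smirnov's theorem for the frequency sets of the filtering problem: a function with frequencies
in `U` and a function with frequencies in the set of observation times are orthogonal as soon as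
their pointwise product is integrable. Finitely many frequencies of `U` are negative; they are
removed by subtracting a trigonometric polynomial. -/
theorem FilteringProblem.integral_dotProduct_star_eq_zero (X : FilteringProblem T)
    {f g : VecFun T}
    (hf : ∀ k, Integrable (fun x => f x k) periodMeasure)
    (hg : ∀ k, Integrable (fun x => g x k) periodMeasure)
    (hf0 : ∀ k, ∀ n ∉ X.U, fcoef (fun x => f x k) n = 0)
    (hg0 : ∀ k, ∀ n ∉ X.obs, fcoef (fun x => g x k) n = 0)
    (hfg : Integrable (fun x => f x ⬝ᵥ star (g x)) periodMeasure) :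
    ∫ x, f x ⬝ᵥ star (g x) ∂periodMeasure = 0 := by
  have hS : X.S.Finite := Set.finite_iUnion fun l => Set.finite_Icc _ _
  set J : Finset ℤ := hS.toFinset.filter (· < 0) with hJ
  have hJS : ∀ j ∈ J, j ∈ X.S ∧ j < 0 := fun j hj => by simpa [hJ] using hj
  set p : Fin T → ℝ → ℂ := fun k x => ∑ j ∈ J, fcoef (fun x => f x k) j * expo j x with hp
  have hpi : ∀ k, Integrable (p k) periodMeasure := fun k =>
    integrable_finsetSum _ fun j _ => (integrable_expo j).const_mul _
  have hstar : ∀ k, Integrable (fun x => star (g x k)) periodMeasure := fun k =>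
    (hg k).congr' (continuous_star.comp_aestronglyMeasurable (hg k).1)
      (.of_forall fun x => (norm_star _).symm)
  have hterm : ∀ j n k, Integrable (fun x => fcoef (fun x => f x k) j * expo j x * star (g x n))
      periodMeasure := fun j n k => by
    have := (Integrable.mul_expo (hstar n) j).const_mul (fcoef (fun x => f x k) j)
    refine this.congr (.of_forall fun x => ?_)
    dsimp only
    ring
  have hpg : Integrable (fun x => ∑ k, p k x * star (g x k)) periodMeasure := by
    refine integrable_finsetSum _ fun k _ => ?_
    simp only [hp, Finset.sum_mul]
    exact integrable_finsetSum _ fun j _ => hterm j k k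
  have hpg0 : ∫ x, ∑ k, p k x * star (g x k) ∂periodMeasure = 0 := by
    simp only [hp, Finset.sum_mul]
    rw [integral_finsetSum _ fun k _ => integrable_finsetSum _ fun j _ => hterm j k k]
    refine Finset.sum_eq_zero fun k _ => ?_
    rw [integral_finsetSum _ fun j _ => hterm j k k]
    refine Finset.sum_eq_zero fun j hj => ?_
    have h1 : (fun x => fcoef (fun x => f x k) j * expo j x * star (g x k)) = fun x =>
        fcoef (fun x => f x k) j * (star (g x k) * expo (-(-j)) x) := by
      ext x; rw [neg_neg]; ring
    rw [h1, integral_const_mul, integral_eq_two_pi_mul_mean]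
    have h2 : mean (fun x => star (g x k) * expo (-(-j)) x) = 0 := by
      have h3 := fcoef_star (fun x => g x k) (-j)
      rw [neg_neg, hg0 k j fun h => h.2 (hJS j hj).1, star_zero] at h3
      exact h3
    rw [h2]; ring
  have hmain := integral_sum_mul_eq_zero_of_analytic (f := fun k x => f x k - p k x)
    (g := fun k x => star (g x k)) (fun k => (hf k).sub (hpi k)) hstar (fun k n hn => by
      rw [fcoef_sub (hf k) (hpi k)]
      have h1 : fcoef (p k) n = if n ∈ J then fcoef (fun x => f x k) n else 0 := by
        simp only [hp]
        rw [fcoef_finsetSum _ fun j _ => (integrable_expo j).const_mul _]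
        simp only [fcoef_const_mul, fcoef_expo]
        simp
      rw [h1]
      split_ifs with h
      · exact sub_self _
      · have : n ∉ X.U := by
          rintro (h2 | h2)
          · exact h (by simp [hJ, h2, hn])
          · exact absurd h2 (not_le.2 hn)
        rw [hf0 k n this, sub_zero])
    (fun k n hn => by
      rw [fcoef_star, hg0 k (-n) fun h => by have : -n ≤ -1 := h.1; omega, star_zero])
    ((hfg.sub hpg).congr (.of_forall fun x => by
      simp [dotProduct, ← Finset.sum_sub_distrib, sub_mul]))
  have h4 : (fun x => ∑ k, (f x k - p k x) * star (g x k)) =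
      fun x => f x ⬝ᵥ star (g x) - ∑ k, p k x * star (g x k) := by
    ext x; simp [dotProduct, ← Finset.sum_sub_distrib, sub_mul]
  rw [h4, integral_sub hfg hpg, hpg0, sub_zero] at hmain
  exact hmain

/-! ### Hermitian forms -/

/-- The sesquilinear form `aᵀ W \overline{b}`. -/
def sesq (W : Matrix (Fin T) (Fin T) ℂ) (a b : Fin T → ℂ) : ℂ := a ⬝ᵥ (W *ᵥ star b)

/-- The quadratic form `hᵀ W \overline{h}` of a Hermitian matrix. -/
def quad (W : Matrix (Fin T) (Fin T) ℂ) (h : Fin T → ℂ) : ℝ := (sesq W h h).re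

lemma energy_eq_lintegral_quad (W : MatFun T) (h : VecFun T) :
    energy W h = ∫⁻ x, ENNReal.ofReal (quad (W x) (h x)) ∂periodMeasure := rfl

section forms

variable {W F G : Matrix (Fin T) (Fin T) ℂ}

lemma sesq_add_left (a b c : Fin T → ℂ) : sesq W (a + b) c = sesq W a c + sesq W b c :=
  add_dotProduct _ _ _

lemma sesq_add_right (a b c : Fin T → ℂ) : sesq W a (b + c) = sesq W a b + sesq W a c := by
  simp [sesq, mulVec_add, dotProduct_add]

lemma sesq_eq_vecMul (a b : Fin T → ℂ) : sesq W a b = (a ᵥ* W) ⬝ᵥ star b := by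
  rw [sesq, dotProduct_mulVec]

lemma star_sesq (hW : W.IsHermitian) (a b : Fin T → ℂ) : star (sesq W a b) = sesq W b a := by
  rw [sesq, sesq_eq_vecMul, ← star_dotProduct_star, star_mulVec, star_star, hW.eq]

lemma quad_add (hW : W.IsHermitian) (a b : Fin T → ℂ) :
    quad W (a + b) = quad W a + quad W b + 2 * (sesq W a b).re := by
  have := congrArg Complex.re (star_sesq hW a b)
  simp only [Complex.star_def, Complex.conj_re] at this
  simp only [quad, sesq_add_left, sesq_add_right, Complex.add_re]
  linarith

lemma quad_nonneg (hW : W.PosSemidef) (h : Fin T → ℂ) : 0 ≤ quad W h := by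
  have := hW.dotProduct_mulVec_nonneg (star h)
  rw [star_star] at this
  exact (Complex.le_def.1 this).1

lemma sesq_self_eq_quad (hW : W.IsHermitian) (h : Fin T → ℂ) : sesq W h h = quad W h := by
  have := congrArg Complex.im (star_sesq hW h h)
  simp only [Complex.star_def, Complex.conj_im] at this
  apply Complex.ext <;> simp [quad]
  linarith

lemma quad_neg (h : Fin T → ℂ) : quad W (-h) = quad W h := by
  simp [quad, sesq, mulVec_neg]

lemma quad_add_weight (h : Fin T → ℂ) : quad (F + G) h = quad F h + quad G h := by
  simp [quad, sesq, add_mulVec, dotProduct_add]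

lemma quad_smul_weight (c : ℝ) (h : Fin T → ℂ) : quad ((c : ℂ) • F) h = c * quad F h := by
  simp [quad, sesq, smul_mulVec, dotProduct_smul]

open scoped MatrixOrder in
lemma exists_eq_mul_conjTranspose (hW : W.PosSemidef) :
    ∃ B : Matrix (Fin T) (Fin T) ℂ, W = B * Bᴴ := by
  obtain ⟨B, hB⟩ := CStarAlgebra.nonneg_iff_eq_mul_star_self.mp hW.nonneg
  exact ⟨B, hB⟩

lemma sesq_mul_conjTranspose (B : Matrix (Fin T) (Fin T) ℂ) (a b : Fin T → ℂ) :
    sesq (B * Bᴴ) a b = (a ᵥ* B) ⬝ᵥ star (b ᵥ* B) := by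
  rw [sesq, ← mulVec_mulVec, dotProduct_mulVec, star_vecMul]

/-- Cauchy–Schwarz inequality. -/
lemma norm_sesq_le (hW : W.PosSemidef) (a b : Fin T → ℂ) :
    ‖sesq W a b‖ ≤ √(quad W a) * √(quad W b) := by
  obtain ⟨B, rfl⟩ := exists_eq_mul_conjTranspose hW
  have hin : ∀ u v : Fin T → ℂ, u ⬝ᵥ star v = inner ℂ (WithLp.toLp 2 v) (WithLp.toLp 2 u) :=
    fun u v => by simp [PiLp.inner_apply, dotProduct]
  have hq : ∀ u, √(quad (B * Bᴴ) u) = ‖(WithLp.toLp 2 (u ᵥ* B) : EuclideanSpace ℂ (Fin T))‖ :=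
    fun u => by
      rw [quad, sesq_mul_conjTranspose, hin]
      exact (norm_eq_sqrt_re_inner (𝕜 := ℂ) _).symm
  rw [sesq_mul_conjTranspose, hin, hq, hq, mul_comm]
  exact norm_inner_le_norm _ _

lemma quad_add_le (hW : W.PosSemidef) {η : ℝ} (hη : 0 < η) (a b : Fin T → ℂ) :
    quad W (a + b) ≤ (1 + η) * quad W a + (1 + η⁻¹) * quad W b := by
  rw [quad_add hW.1]
  have h1 := (Complex.re_le_norm _).trans (norm_sesq_le hW a b)
  have h2 : 2 * (√(quad W a) * √(quad W b)) ≤ η * quad W a + η⁻¹ * quad W b := by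
    have h3 := sq_nonneg (√η * √(quad W a) - √η⁻¹ * √(quad W b))
    have h4 : √η * √η⁻¹ = 1 := by
      rw [Real.sqrt_inv, mul_inv_cancel₀ (Real.sqrt_pos.2 hη).ne']
    have h5 := Real.sq_sqrt hη.le
    have h6 := Real.sq_sqrt (inv_pos.2 hη).le
    have h7 := Real.sq_sqrt (quad_nonneg hW a)
    have h8 := Real.sq_sqrt (quad_nonneg hW b)
    calc 2 * (√(quad W a) * √(quad W b))
        = 2 * (√η * √η⁻¹) * (√(quad W a) * √(quad W b)) := by rw [h4]; ring
      _ ≤ √η ^ 2 * √(quad W a) ^ 2 + √η⁻¹ ^ 2 * √(quad W b) ^ 2 := by linarith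
      _ = _ := by rw [h5, h6, h7, h8]
  linarith

lemma sesq_single (i j : Fin T) : sesq W (Pi.single i 1) (Pi.single j 1) = W i j := by
  rw [sesq, ← Pi.single_star]
  simp

lemma quad_single (i : Fin T) : quad W (Pi.single i 1) = (W i i).re := by
  rw [quad, sesq_single]

lemma re_diag_le_re_trace (hW : W.PosSemidef) (i : Fin T) : (W i i).re ≤ W.trace.re := by
  rw [Matrix.trace, Complex.re_sum]
  refine Finset.single_le_sum (f := fun i => (W i i).re) (fun i _ => ?_) (Finset.mem_univ i)
  rw [← quad_single]; exact quad_nonneg hW _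

lemma norm_apply_le_re_trace (hW : W.PosSemidef) (i j : Fin T) : ‖W i j‖ ≤ W.trace.re := by
  have h1 := norm_sesq_le hW (Pi.single i 1) (Pi.single j 1)
  rw [sesq_single, quad_single, quad_single] at h1
  refine h1.trans ?_
  have h0 : 0 ≤ W.trace.re := (Complex.le_def.1 hW.trace_nonneg).1
  calc √(W i i).re * √(W j j).re ≤ √W.trace.re * √W.trace.re := by
        exact mul_le_mul (Real.sqrt_le_sqrt (re_diag_le_re_trace hW _))
          (Real.sqrt_le_sqrt (re_diag_le_re_trace hW _)) (Real.sqrt_nonneg _) (Real.sqrt_nonneg _)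
    _ = _ := Real.mul_self_sqrt h0

/-- `W⁻¹` is the form of `W` in the variables `c W⁻¹`. -/
lemma sesq_vecMul_inv (hW : W.IsHermitian) (hu : IsUnit W.det) (a b : Fin T → ℂ) :
    sesq W (a ᵥ* W⁻¹) (b ᵥ* W⁻¹) = sesq W⁻¹ a b := by
  rw [sesq, star_vecMul, conjTranspose_nonsing_inv, hW.eq, mulVec_mulVec, mul_nonsing_inv _ hu,
    one_mulVec, sesq_eq_vecMul]

lemma quad_vecMul_inv (hW : W.IsHermitian) (hu : IsUnit W.det) (a : Fin T → ℂ) :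
    quad W (a ᵥ* W⁻¹) = quad W⁻¹ a := by
  rw [quad, sesq_vecMul_inv hW hu, quad]

/-- Cauchy–Schwarz inequality for the dual norms given by `W` and `W⁻¹`. -/
lemma norm_dotProduct_star_le (hW : W.PosSemidef) (hu : IsUnit W.det) (a b : Fin T → ℂ) :
    ‖a ⬝ᵥ star b‖ ≤ √(quad W a) * √(quad W⁻¹ b) := by
  have h := norm_sesq_le hW a (b ᵥ* W⁻¹)
  rwa [quad_vecMul_inv hW.1 hu, sesq, star_vecMul, conjTranspose_nonsing_inv, hW.1.eq, mulVec_mulVec,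
    mul_nonsing_inv _ hu, one_mulVec] at h

/-- If `t W₀ ≤ W` then `W⁻¹ ≤ t⁻¹ W₀⁻¹`. -/
lemma quad_inv_le {W₀ : Matrix (Fin T) (Fin T) ℂ} {t : ℝ} (ht : 0 < t) (hW : W.PosSemidef)
    (hW₀ : W₀.PosSemidef) (hu : IsUnit W.det) (hu₀ : IsUnit W₀.det)
    (hle : ∀ h, t * quad W₀ h ≤ quad W h) (b : Fin T → ℂ) :
    quad W⁻¹ b ≤ t⁻¹ * quad W₀⁻¹ b := by
  set z := b ᵥ* W⁻¹ with hz
  have h1 : z ⬝ᵥ star b = quad W⁻¹ b := by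
    rw [hz, ← sesq_eq_vecMul, sesq_self_eq_quad hW.1.inv]
  have h2 := norm_dotProduct_star_le hW₀ hu₀ z b
  have h3 : 0 ≤ quad W⁻¹ b := quad_nonneg hW.inv b
  rw [h1, Complex.norm_real, Real.norm_of_nonneg h3] at h2
  have h4 : t * quad W₀ z ≤ quad W⁻¹ b := by
    rw [← quad_vecMul_inv hW.1 hu]; exact hle z
  have h5 : quad W⁻¹ b ^ 2 ≤ quad W₀ z * quad W₀⁻¹ b := by
    calc quad W⁻¹ b ^ 2 ≤ (√(quad W₀ z) * √(quad W₀⁻¹ b)) ^ 2 := by gcongr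
      _ = _ := by
        rw [mul_pow, Real.sq_sqrt (quad_nonneg hW₀ _), Real.sq_sqrt (quad_nonneg hW₀.inv _)]
  have h6 := quad_nonneg hW₀.inv b
  rw [inv_mul_eq_div, le_div_iff₀ ht]
  rcases h3.eq_or_lt with h7 | h7
  · rw [← h7]; simpa using h6
  · have : quad W⁻¹ b * (quad W⁻¹ b * t) ≤ quad W⁻¹ b * quad W₀⁻¹ b := by nlinarith
    exact le_of_mul_le_mul_left this h7

lemma PosSemidef.isUnit_det_of_le {W₀ : Matrix (Fin T) (Fin T) ℂ} {t : ℝ} (ht : 0 < t)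
    (hW : W.PosSemidef) (hW₀ : W₀.PosSemidef) (hu₀ : IsUnit W₀.det)
    (hle : ∀ h, t * quad W₀ h ≤ quad W h) : IsUnit W.det := by
  have h0 : W₀.PosDef := hW₀.posDef_iff_det_ne_zero.2 hu₀.ne_zero
  rw [isUnit_iff_ne_zero, ← hW.posDef_iff_det_ne_zero]
  refine PosDef.of_dotProduct_mulVec_pos hW.1 fun v hv => ?_
  have h1 := h0.dotProduct_mulVec_pos hv
  have h2 := hle (star v)
  have h3 := sesq_self_eq_quad hW.1 (star v)
  have h4 := (Complex.lt_def.1 h1).1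
  simp only [sesq, star_star] at h3
  rw [h3]
  have h5 : quad W₀ (star v) = (star v ⬝ᵥ W₀ *ᵥ v).re := by simp [quad, sesq]
  rw [← h5] at h4
  have : 0 < quad W (star v) := lt_of_lt_of_le (mul_pos ht (by simpa using h4)) h2
  exact_mod_cast this

lemma eq_zero_of_quad_eq_zero (hW : W.PosSemidef) (hu : IsUnit W.det) {h : Fin T → ℂ}
    (h0 : quad W h = 0) : h = 0 := by
  ext k
  have h1 := norm_dotProduct_star_le hW hu h (Pi.single k 1)
  rw [h0, Real.sqrt_zero, zero_mul, ← Pi.single_star] at h1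
  simpa using h1

end forms

/-! ### Weighted energies -/

lemma aestronglyMeasurable_matrix_iff {W : MatFun T} {ν : Measure ℝ} :
    AEStronglyMeasurable W ν ↔ ∀ i j, AEStronglyMeasurable (fun x => W x i j) ν := by
  constructor
  · intro h i j
    have hc : Continuous fun M : Matrix (Fin T) (Fin T) ℂ => M i j := by fun_prop
    exact hc.comp_aestronglyMeasurable h
  · intro h
    have h1 : AEMeasurable (β := Fin T → Fin T → ℂ) W ν :=
      aemeasurable_pi_iff.2 fun i => aemeasurable_pi_iff.2 fun j => (h i j).aemeasurable
    exact h1.aestronglyMeasurable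

lemma aestronglyMeasurable_vec_iff {h : VecFun T} {ν : Measure ℝ} :
    AEStronglyMeasurable h ν ↔ ∀ i, AEStronglyMeasurable (fun x => h x i) ν := by
  constructor
  · exact fun h i => (continuous_apply i).comp_aestronglyMeasurable h
  · intro h
    exact (aemeasurable_pi_iff.2 fun i => (h i).aemeasurable).aestronglyMeasurable

lemma AEStronglyMeasurable.vecMul {W : MatFun T} {h : VecFun T} {ν : Measure ℝ}
    (hh : AEStronglyMeasurable h ν) (hW : AEStronglyMeasurable W ν) :
    AEStronglyMeasurable (fun x => h x ᵥ* W x) ν := by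
  have hc : Continuous fun p : (Fin T → ℂ) × Matrix (Fin T) (Fin T) ℂ => p.1 ᵥ* p.2 :=
    Continuous.matrix_vecMul continuous_fst continuous_snd
  exact hc.comp_aestronglyMeasurable₂ hh hW

lemma AEStronglyMeasurable.matrix_inv {W : MatFun T} {ν : Measure ℝ}
    (hW : AEStronglyMeasurable W ν) : AEStronglyMeasurable (fun x => (W x)⁻¹) ν := by
  have h1 : AEStronglyMeasurable (fun x => (W x).det) ν :=
    (Continuous.matrix_det continuous_id).comp_aestronglyMeasurable hW
  have h2 : AEStronglyMeasurable (fun x => (W x).adjugate) ν :=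
    (Continuous.matrix_adjugate continuous_id).comp_aestronglyMeasurable hW
  have h3 := (h1.aemeasurable.inv.aestronglyMeasurable).smul h2
  refine h3.congr (.of_forall fun x => ?_)
  simp [Matrix.inv_def]

lemma continuous_sesq : Continuous fun p : Matrix (Fin T) (Fin T) ℂ × (Fin T → ℂ) × (Fin T → ℂ) =>
    sesq p.1 p.2.1 p.2.2 := by
  unfold sesq
  exact Continuous.dotProduct (by fun_prop) (Continuous.matrix_mulVec (by fun_prop) (by fun_prop))

lemma AEStronglyMeasurable.sesq {W : MatFun T} {a b : VecFun T} {ν : Measure ℝ}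
    (hW : AEStronglyMeasurable W ν) (ha : AEStronglyMeasurable a ν)
    (hb : AEStronglyMeasurable b ν) : AEStronglyMeasurable (fun x => sesq (W x) (a x) (b x)) ν :=
  continuous_sesq.comp_aestronglyMeasurable (hW.prodMk (ha.prodMk hb))

lemma AEStronglyMeasurable.quad {W : MatFun T} {a : VecFun T} {ν : Measure ℝ}
    (hW : AEStronglyMeasurable W ν) (ha : AEStronglyMeasurable a ν) :
    AEStronglyMeasurable (fun x => quad (W x) (a x)) ν :=
  Complex.continuous_re.comp_aestronglyMeasurable (AEStronglyMeasurable.sesq hW ha ha)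

/-- A measurable matrix weight, positive semidefinite almost everywhere. -/
structure IsWeight (W : MatFun T) : Prop where
  meas : AEStronglyMeasurable W periodMeasure
  psd : ∀ᵐ x ∂periodMeasure, (W x).PosSemidef

lemma IsSpectralDensity.isWeight {F : MatFun T} (hF : IsSpectralDensity F) : IsWeight F :=
  ⟨aestronglyMeasurable_matrix_iff.2 fun i j => (hF.1 i j).1, hF.2⟩

lemma IsWeight.add {F G : MatFun T} (hF : IsWeight F) (hG : IsWeight G) : IsWeight (F + G) :=
  ⟨hF.meas.add hG.meas, by filter_upwards [hF.psd, hG.psd] with x h1 h2 using h1.add h2⟩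

lemma IsSpectralDensity.add {F G : MatFun T} (hF : IsSpectralDensity F)
    (hG : IsSpectralDensity G) : IsSpectralDensity (F + G) :=
  ⟨fun i j => (hF.1 i j).add (hG.1 i j), (hF.isWeight.add hG.isWeight).psd⟩

section energy

variable {W F G : MatFun T} {a b h : VecFun T}

lemma IsWeight.aemeasurable_ofReal_quad (hW : IsWeight W)
    (hh : AEStronglyMeasurable h periodMeasure) :
    AEMeasurable (fun x => ENNReal.ofReal (quad (W x) (h x))) periodMeasure :=
  (AEStronglyMeasurable.quad hW.meas hh).aemeasurable.ennreal_ofReal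

lemma energy_congr_ae (h1 : ∀ᵐ x ∂periodMeasure, quad (F x) (a x) = quad (G x) (b x)) :
    energy F a = energy G b :=
  lintegral_congr_ae (h1.mono fun _ hx => congrArg ENNReal.ofReal hx)

lemma energy_mono_ae (h1 : ∀ᵐ x ∂periodMeasure, quad (F x) (a x) ≤ quad (G x) (b x)) :
    energy F a ≤ energy G b :=
  lintegral_mono_ae (h1.mono fun _ hx => ENNReal.ofReal_le_ofReal hx)

lemma energy_neg (W : MatFun T) (h : VecFun T) : energy W (-h) = energy W h :=
  energy_congr_ae (.of_forall fun _ => quad_neg _)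

lemma energy_sub_comm (W : MatFun T) (a b : VecFun T) : energy W (a - b) = energy W (b - a) := by
  rw [← energy_neg, neg_sub]

lemma energy_add_weight (hF : IsWeight F) (hG : IsWeight G)
    (hh : AEStronglyMeasurable h periodMeasure) :
    energy (F + G) h = energy F h + energy G h := by
  simp only [energy_eq_lintegral_quad]
  rw [← lintegral_add_left' (hF.aemeasurable_ofReal_quad hh)]
  refine lintegral_congr_ae ?_
  filter_upwards [hF.psd, hG.psd] with x h1 h2
  rw [← ENNReal.ofReal_add (quad_nonneg h1 _) (quad_nonneg h2 _), ← quad_add_weight]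
  rfl

lemma energy_smul_weight {c : ℝ} (hc : 0 ≤ c) (F : MatFun T) (h : VecFun T) :
    energy (fun x => (c : ℂ) • F x) h = ENNReal.ofReal c * energy F h := by
  simp only [energy_eq_lintegral_quad, quad_smul_weight, ENNReal.ofReal_mul hc]
  rw [lintegral_const_mul' _ _ ENNReal.ofReal_ne_top]

lemma energy_add_le (hW : IsWeight W) (ha : AEStronglyMeasurable a periodMeasure) {η : ℝ}
    (hη : 0 < η) : energy W (a + b) ≤
      ENNReal.ofReal (1 + η) * energy W a + ENNReal.ofReal (1 + η⁻¹) * energy W b := by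
  have hη' := inv_pos.2 hη
  simp only [energy_eq_lintegral_quad]
  rw [← lintegral_const_mul' _ _ ENNReal.ofReal_ne_top,
    ← lintegral_const_mul' _ _ ENNReal.ofReal_ne_top,
    ← lintegral_add_left' ((hW.aemeasurable_ofReal_quad ha).const_mul _)]
  refine lintegral_mono_ae ?_
  filter_upwards [hW.psd] with x hx
  rw [← ENNReal.ofReal_mul (by positivity), ← ENNReal.ofReal_mul (by positivity),
    ← ENNReal.ofReal_add (mul_nonneg (by positivity) (quad_nonneg hx _))
      (mul_nonneg (by positivity) (quad_nonneg hx _))]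
  exact ENNReal.ofReal_le_ofReal (quad_add_le hx hη _ _)

lemma energy_add_le_two (hW : IsWeight W) (ha : AEStronglyMeasurable a periodMeasure) :
    energy W (a + b) ≤ 2 * energy W a + 2 * energy W b := by
  have := energy_add_le (b := b) hW ha one_pos
  simpa [show (1 + 1 : ℝ) = 2 by norm_num] using this

lemma energy_sub_le_two (hW : IsWeight W) (ha : AEStronglyMeasurable a periodMeasure) :
    energy W (a - b) ≤ 2 * energy W a + 2 * energy W b := by
  have := energy_add_le_two (b := -b) hW ha
  rwa [energy_neg, ← sub_eq_add_neg] at this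

lemma L2.sub (hW : IsWeight W) (ha : a ∈ L2 W) (hb : b ∈ L2 W) : a - b ∈ L2 W :=
  ⟨ha.1.sub hb.1, (energy_sub_le_two hW ha.1).trans_lt
    (ENNReal.add_lt_top.2 ⟨ENNReal.mul_lt_top (by simp) ha.2, ENNReal.mul_lt_top (by simp) hb.2⟩)⟩

lemma L2.add (hW : IsWeight W) (ha : a ∈ L2 W) (hb : b ∈ L2 W) : a + b ∈ L2 W :=
  ⟨ha.1.add hb.1, (energy_add_le_two hW ha.1).trans_lt
    (ENNReal.add_lt_top.2 ⟨ENNReal.mul_lt_top (by simp) ha.2, ENNReal.mul_lt_top (by simp) hb.2⟩)⟩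

lemma lintegral_enorm_le_sqrt_energy {f : ℝ → ℂ} (hF : IsWeight F)
    (ha : AEStronglyMeasurable a periodMeasure) (hG : IsWeight G)
    (hb : AEStronglyMeasurable b periodMeasure)
    (h : ∀ᵐ x ∂periodMeasure, ‖f x‖ ≤ √(quad (F x) (a x)) * √(quad (G x) (b x))) :
    ∫⁻ x, ‖f x‖ₑ ∂periodMeasure ≤ energy F a ^ (1 / 2 : ℝ) * energy G b ^ (1 / 2 : ℝ) := by
  have h1 : ∀ᵐ x ∂periodMeasure, ‖f x‖ₑ ≤
      ((fun x => ENNReal.ofReal √(quad (F x) (a x))) *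
        fun x => ENNReal.ofReal √(quad (G x) (b x))) x := by
    filter_upwards [h] with x hx
    rw [Pi.mul_apply, ← ENNReal.ofReal_mul (Real.sqrt_nonneg _), ← ofReal_norm]
    exact ENNReal.ofReal_le_ofReal hx
  refine (lintegral_mono_ae h1).trans ?_
  refine (ENNReal.lintegral_mul_le_Lp_mul_Lq periodMeasure Real.HolderConjugate.two_two
    (AEStronglyMeasurable.quad hF.meas ha).aemeasurable.sqrt.ennreal_ofReal
    (AEStronglyMeasurable.quad hG.meas hb).aemeasurable.sqrt.ennreal_ofReal).trans_eq ?_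
  have h2 : ∀ {W : MatFun T} {h : VecFun T}, IsWeight W →
      ∫⁻ x, ENNReal.ofReal √(quad (W x) (h x)) ^ (2 : ℝ) ∂periodMeasure = energy W h := by
    intro W h hW
    refine lintegral_congr_ae ?_
    filter_upwards [hW.psd] with x hx
    rw [ENNReal.ofReal_rpow_of_nonneg (Real.sqrt_nonneg _) (by norm_num), Real.rpow_two,
      Real.sq_sqrt (quad_nonneg hx _)]
    rfl
  rw [h2 hF, h2 hG]

lemma lintegral_enorm_sesq_le (hW : IsWeight W) (ha : AEStronglyMeasurable a periodMeasure)
    (hb : AEStronglyMeasurable b periodMeasure) :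
    ∫⁻ x, ‖sesq (W x) (a x) (b x)‖ₑ ∂periodMeasure ≤
      energy W a ^ (1 / 2 : ℝ) * energy W b ^ (1 / 2 : ℝ) :=
  lintegral_enorm_le_sqrt_energy hW ha hW hb (hW.psd.mono fun _ hx => norm_sesq_le hx _ _)

lemma integrable_sesq (hW : IsWeight W) (ha : a ∈ L2 W) (hb : b ∈ L2 W) :
    Integrable (fun x => sesq (W x) (a x) (b x)) periodMeasure :=
  ⟨AEStronglyMeasurable.sesq hW.meas ha.1 hb.1,
    (lintegral_enorm_sesq_le hW ha.1 hb.1).trans_lt (ENNReal.mul_lt_top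
      (ENNReal.rpow_lt_top_of_nonneg (by norm_num) ha.2.ne)
      (ENNReal.rpow_lt_top_of_nonneg (by norm_num) hb.2.ne))⟩

lemma energy_eq_ofReal_integral (hW : IsWeight W) (ha : a ∈ L2 W) :
    energy W a = ENNReal.ofReal (∫ x, quad (W x) (a x) ∂periodMeasure) := by
  have hi : Integrable (fun x => quad (W x) (a x)) periodMeasure := (integrable_sesq hW ha ha).re
  rw [ofReal_integral_eq_lintegral_ofReal hi
    (hW.psd.mono fun x hx => quad_nonneg hx _)]
  rfl

lemma ofReal_re_integral_sesq_self (hW : IsWeight W) (ha : a ∈ L2 W) :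
    ENNReal.ofReal (∫ x, sesq (W x) (a x) (a x) ∂periodMeasure).re = energy W a := by
  rw [energy_eq_ofReal_integral hW ha]
  congr 1
  exact (integral_re (𝕜 := ℂ) (integrable_sesq hW ha ha)).symm

lemma integral_quad_nonneg (hW : IsWeight W) (a : VecFun T) :
    0 ≤ ∫ x, quad (W x) (a x) ∂periodMeasure :=
  integral_nonneg_of_ae (hW.psd.mono fun _ hx => quad_nonneg hx _)

/-- Pythagoras' theorem in `L₂(W)`. -/
lemma energy_add_of_orthogonal (hW : IsWeight W) (ha : a ∈ L2 W) (hb : b ∈ L2 W)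
    (h : ∫ x, sesq (W x) (a x) (b x) ∂periodMeasure = 0) :
    energy W (a + b) = energy W a + energy W b := by
  rw [energy_eq_ofReal_integral hW (L2.add hW ha hb), energy_eq_ofReal_integral hW ha,
    energy_eq_ofReal_integral hW hb,
    ← ENNReal.ofReal_add (integral_quad_nonneg hW a) (integral_quad_nonneg hW b)]
  congr 1
  have hia : Integrable (fun x => quad (W x) (a x)) periodMeasure :=
    (integrable_sesq hW ha ha).re
  have hib : Integrable (fun x => quad (W x) (b x)) periodMeasure :=
    (integrable_sesq hW hb hb).re
  have hiab : Integrable (fun x => 2 * (sesq (W x) (a x) (b x)).re) periodMeasure :=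
    (integrable_sesq hW ha hb).re.const_mul 2
  have h0 : ∫ x, (sesq (W x) (a x) (b x)).re ∂periodMeasure = 0 := by
    have := integral_re (𝕜 := ℂ) (integrable_sesq hW ha hb)
    rw [h] at this
    simpa using this
  rw [integral_congr_ae (hW.psd.mono fun x hx => by
    show _ = quad (W x) (a x) + quad (W x) (b x) + 2 * (sesq (W x) (a x) (b x)).re
    exact quad_add hx.1 _ _), integral_add (hia.fun_add hib) hiab, integral_add hia hib,
    integral_const_mul, h0]
  ring

lemma energy_lt_top_of_bounded (hW : IsSpectralDensity W) {C : ℝ} (hh : ∀ x i, ‖h x i‖ ≤ C) :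
    energy W h < ⊤ := by
  have hi : Integrable (fun x => ∑ i, ∑ j, C * (‖W x i j‖ * C)) periodMeasure :=
    integrable_finsetSum _ fun i _ => integrable_finsetSum _ fun j _ =>
      ((hW.1 i j).norm.mul_const _).const_mul _
  refine lt_of_le_of_lt (lintegral_mono fun x => ?_) hi.lintegral_lt_top
  refine ENNReal.ofReal_le_ofReal ((Complex.re_le_norm _).trans ?_)
  simp only [dotProduct, mulVec]
  refine (norm_sum_le _ _).trans (Finset.sum_le_sum fun i _ => ?_)
  rw [norm_mul, ← Finset.mul_sum]
  refine mul_le_mul (hh x i) ((norm_sum_le _ _).trans (Finset.sum_le_sum fun j _ => ?_))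
    (norm_nonneg _) ((norm_nonneg _).trans (hh x i))
  rw [norm_mul, Pi.star_apply, norm_star]
  exact mul_le_mul_of_nonneg_left (hh x j) (norm_nonneg _)

end energy

/-! ### Regular weights -/

/-- An integrable, almost everywhere invertible weight with integrable inverse: the minimality
condition for `W = F + G`. -/
structure IsRegularWeight (W : MatFun T) : Prop where
  density : IsSpectralDensity W
  unit : ∀ᵐ x ∂periodMeasure, IsUnit (W x).det
  inv_integrable : ∀ i j, Integrable (fun x => (W x)⁻¹ i j) periodMeasure

namespace IsRegularWeight

variable {W : MatFun T} {a b h : VecFun T}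

lemma inv (hW : IsRegularWeight W) : IsRegularWeight fun x => (W x)⁻¹ where
  density := ⟨hW.inv_integrable, hW.density.2.mono fun _ hx => hx.inv⟩
  unit := hW.unit.mono fun x hx => by
    rw [det_nonsing_inv]; exact hx.ringInverse
  inv_integrable i j := (hW.density.1 i j).congr (hW.unit.mono fun x hx => by
    simp only [nonsing_inv_nonsing_inv _ hx])

lemma weight (hW : IsRegularWeight W) : IsWeight W := hW.density.isWeight

lemma energy_vecMul_inv (hW : IsRegularWeight W) (a : VecFun T) :
    energy W (fun x => a x ᵥ* (W x)⁻¹) = energy (fun x => (W x)⁻¹) a :=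
  energy_congr_ae (by
    filter_upwards [hW.weight.psd, hW.unit] with x h1 h2 using quad_vecMul_inv h1.1 h2 _)

lemma energy_inv_vecMul (hW : IsRegularWeight W) (a : VecFun T) :
    energy (fun x => (W x)⁻¹) (fun x => a x ᵥ* W x) = energy W a := by
  rw [← hW.energy_vecMul_inv]
  refine energy_congr_ae (hW.unit.mono fun x hx => ?_)
  rw [vecMul_vecMul, mul_nonsing_inv _ hx, vecMul_one]

lemma lintegral_enorm_dotProduct_le (hW : IsRegularWeight W)
    (ha : AEStronglyMeasurable a periodMeasure) (hb : AEStronglyMeasurable b periodMeasure) :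
    ∫⁻ x, ‖a x ⬝ᵥ star (b x)‖ₑ ∂periodMeasure ≤
      energy W a ^ (1 / 2 : ℝ) * energy (fun x => (W x)⁻¹) b ^ (1 / 2 : ℝ) :=
  lintegral_enorm_le_sqrt_energy hW.weight ha hW.inv.weight hb (by
    filter_upwards [hW.weight.psd, hW.unit] with x h1 h2 using norm_dotProduct_star_le h1 h2 _ _)

lemma integrable_dotProduct (hW : IsRegularWeight W) (ha : a ∈ L2 W)
    (hb : b ∈ L2 fun x => (W x)⁻¹) :
    Integrable (fun x => a x ⬝ᵥ star (b x)) periodMeasure :=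
  ⟨(Continuous.dotProduct continuous_fst continuous_snd).comp_aestronglyMeasurable
      (ha.1.prodMk (continuous_star.comp_aestronglyMeasurable hb.1)),
    (hW.lintegral_enorm_dotProduct_le ha.1 hb.1).trans_lt (ENNReal.mul_lt_top
      (ENNReal.rpow_lt_top_of_nonneg (by norm_num) ha.2.ne)
      (ENNReal.rpow_lt_top_of_nonneg (by norm_num) hb.2.ne))⟩

lemma const_mem_L2 (hW : IsSpectralDensity W) (v : Fin T → ℂ) : (fun _ => v) ∈ L2 W :=
  ⟨aestronglyMeasurable_const, energy_lt_top_of_bounded hW (C := ‖v‖) fun _ i => norm_le_pi_norm v i⟩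

lemma lintegral_enorm_apply_le (hW : IsRegularWeight W)
    (ha : AEStronglyMeasurable a periodMeasure) (k : Fin T) :
    ∫⁻ x, ‖a x k‖ₑ ∂periodMeasure ≤ energy W a ^ (1 / 2 : ℝ) *
      energy (fun x => (W x)⁻¹) (fun _ => Pi.single k 1) ^ (1 / 2 : ℝ) := by
  have := hW.lintegral_enorm_dotProduct_le ha (b := fun _ => Pi.single k 1)
    aestronglyMeasurable_const
  simpa [← Pi.single_star] using this

lemma integrable_apply (hW : IsRegularWeight W) (ha : a ∈ L2 W) (k : Fin T) :
    Integrable (fun x => a x k) periodMeasure := by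
  have := hW.integrable_dotProduct ha (const_mem_L2 hW.inv.density (Pi.single k 1))
  simpa [← Pi.single_star] using this

lemma tendsto_lintegral_enorm_apply (hW : IsRegularWeight W) {r : ℕ → VecFun T}
    (hr : ∀ n, AEStronglyMeasurable (r n) periodMeasure)
    (h : Tendsto (fun n => energy W (r n)) atTop (𝓝 0)) (k : Fin T) :
    Tendsto (fun n => ∫⁻ x, ‖r n x k‖ₑ ∂periodMeasure) atTop (𝓝 0) := by
  have h1 : Tendsto (fun n => energy W (r n) ^ (1 / 2 : ℝ) *
      energy (fun x => (W x)⁻¹) (fun _ => Pi.single k 1) ^ (1 / 2 : ℝ)) atTop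
      (𝓝 (0 ^ (1 / 2 : ℝ) *
      energy (fun x => (W x)⁻¹) (fun _ => Pi.single k 1) ^ (1 / 2 : ℝ))) :=
    ENNReal.Tendsto.mul_const ((ENNReal.continuous_rpow_const.tendsto 0).comp h)
      (.inr (ENNReal.rpow_lt_top_of_nonneg (by norm_num)
        (const_mem_L2 hW.inv.density (Pi.single k 1)).2.ne).ne)
  rw [ENNReal.zero_rpow_of_pos (by norm_num), zero_mul] at h1
  exact tendsto_of_tendsto_of_tendsto_of_le_of_le tendsto_const_nhds h1
    (fun _ => zero_le) (fun n => hW.lintegral_enorm_apply_le (hr n) k)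

/-- Convergence in `L₂(W)` implies convergence of the Fourier coefficients. -/
lemma tendsto_fcoef (hW : IsRegularWeight W) {r : ℕ → VecFun T} (hr : ∀ n, r n ∈ L2 W)
    (ha : a ∈ L2 W) (h : Tendsto (fun n => energy W (a - r n)) atTop (𝓝 0)) (k : Fin T) (m : ℤ) :
    Tendsto (fun n => fcoef (fun x => r n x k) m) atTop (𝓝 (fcoef (fun x => a x k) m)) := by
  have h1 := hW.tendsto_lintegral_enorm_apply (fun n => ha.1.sub (hr n).1) h k
  have hi : ∀ n, Integrable (fun x => (a - r n) x k) periodMeasure := fun n =>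
    hW.integrable_apply (L2.sub hW.weight ha (hr n)) k
  have h2 : Tendsto (fun n => ∫ x, ‖(a - r n) x k‖ ∂periodMeasure) atTop (𝓝 0) := by
    have h3 := (ENNReal.tendsto_toReal ENNReal.zero_ne_top).comp h1
    refine h3.congr fun n => ?_
    rw [Function.comp_apply, ← ofReal_integral_norm_eq_lintegral_enorm (hi n),
      ENNReal.toReal_ofReal (integral_nonneg fun _ => norm_nonneg _)]
  rw [tendsto_iff_norm_sub_tendsto_zero]
  have h4 := h2.const_mul (2 * Real.pi)⁻¹
  rw [mul_zero] at h4
  refine squeeze_zero (fun _ => norm_nonneg _) (fun n => ?_) h4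
  rw [norm_sub_rev, ← fcoef_sub (hW.integrable_apply ha k) (hW.integrable_apply (hr n) k)]
  exact norm_fcoef_le _ _

lemma ae_eq_of_energy_sub_eq_zero (hW : IsRegularWeight W)
    (ha : AEStronglyMeasurable a periodMeasure) (hb : AEStronglyMeasurable b periodMeasure)
    (h : energy W (a - b) = 0) : a =ᵐ[periodMeasure] b := by
  rw [energy_eq_lintegral_quad,
    lintegral_eq_zero_iff' (hW.weight.aemeasurable_ofReal_quad (ha.sub hb))] at h
  filter_upwards [h, hW.weight.psd, hW.unit] with x h1 h2 h3
  have h4 : quad (W x) ((a - b) x) = 0 :=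
    le_antisymm (ENNReal.ofReal_eq_zero.1 h1) (quad_nonneg h2 _)
  exact sub_eq_zero.1 (eq_zero_of_quad_eq_zero h2 h3 h4)

end IsRegularWeight

lemma MinimalityCondition.isRegularWeight {F G : MatFun T} (h : MinimalityCondition F G)
    (hF : IsSpectralDensity F) (hG : IsSpectralDensity G) : IsRegularWeight (F + G) :=
  ⟨hF.add hG, h.1, h.2⟩

/-! ### Orthogonal projection in weighted spaces -/

/-- A measurable Hermitian square root of a matrix weight. -/
structure IsHermitianRoot (W V : MatFun T) : Prop where
  meas : AEStronglyMeasurable V periodMeasure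
  herm : ∀ᵐ x ∂periodMeasure, (V x).IsHermitian
  sq : ∀ᵐ x ∂periodMeasure, V x * V x = W x

open scoped MatrixOrder Matrix.Norms.L2Operator in
/-- Measurable square roots exist: on positive semidefinite matrices the square root agrees with
the everywhere continuous function `M ↦ √√(Mᴴ M)`. -/
lemma IsWeight.exists_root {W : MatFun T} (hW : IsWeight W) : ∃ V, IsHermitianRoot W V := by
  have hs := CFC.continuousOn_sqrt (A := Matrix (Fin T) (Fin T) ℂ)
  have hc : Continuous fun M : Matrix (Fin T) (Fin T) ℂ => CFC.sqrt (CFC.sqrt (Mᴴ * M)) :=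
    hs.comp_continuous (hs.comp_continuous (by fun_prop)
      fun M => (posSemidef_conjTranspose_mul_self M).nonneg) fun M => CFC.sqrt_nonneg (Mᴴ * M)
  refine ⟨fun x => CFC.sqrt (CFC.sqrt ((W x)ᴴ * W x)), hc.comp_aestronglyMeasurable hW.meas,
    .of_forall fun x => (CFC.sqrt_nonneg _).posSemidef.1, hW.psd.mono fun x hx => ?_⟩
  rw [CFC.sqrt_mul_sqrt_self _ (CFC.sqrt_nonneg _), hx.1.eq, CFC.sqrt_mul_self _ hx.nonneg]

/-- The function `h V` with values in Euclidean space. -/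
def rowMul (h : VecFun T) (V : MatFun T) (x : ℝ) : EuclideanSpace ℂ (Fin T) :=
  WithLp.toLp 2 (h x ᵥ* V x)

lemma inner_toLp (u v : Fin T → ℂ) :
    inner ℂ (WithLp.toLp 2 v : EuclideanSpace ℂ (Fin T)) (WithLp.toLp 2 u) = u ⬝ᵥ star v := by
  simp [PiLp.inner_apply, dotProduct]

namespace IsHermitianRoot

variable {W V : MatFun T} {h : VecFun T}

lemma inner_rowMul (hV : IsHermitianRoot W V) (a b : VecFun T) :
    ∀ᵐ x ∂periodMeasure, inner ℂ (rowMul b V x) (rowMul a V x) = sesq (W x) (a x) (b x) := by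
  filter_upwards [hV.herm, hV.sq] with x h1 h2
  rw [rowMul, rowMul, inner_toLp, ← h2]
  nth_rw 4 [← h1.eq]
  rw [sesq_mul_conjTranspose]

lemma aestronglyMeasurable_rowMul (hV : IsHermitianRoot W V)
    (hh : AEStronglyMeasurable h periodMeasure) :
    AEStronglyMeasurable (rowMul h V) periodMeasure :=
  (PiLp.continuous_toLp 2 _).comp_aestronglyMeasurable (AEStronglyMeasurable.vecMul hh hV.meas)

lemma energy_eq (hV : IsHermitianRoot W V) (h : VecFun T) :
    energy W h = eLpNorm (rowMul h V) 2 periodMeasure ^ 2 := by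
  have h1 := eLpNorm_nnreal_pow_eq_lintegral (f := rowMul h V) (μ := periodMeasure) (p := 2)
    two_ne_zero
  simp only [NNReal.coe_ofNat, ENNReal.rpow_ofNat, ENNReal.coe_ofNat] at h1
  rw [h1, energy_eq_lintegral_quad]
  refine lintegral_congr_ae ?_
  filter_upwards [hV.inner_rowMul h h] with x hx
  have h2 := inner_self_eq_norm_sq (𝕜 := ℂ) (rowMul h V x)
  rw [hx] at h2
  rw [← ofReal_norm, ← ENNReal.ofReal_pow (norm_nonneg _), ← h2]
  rfl

lemma memLp_rowMul (hV : IsHermitianRoot W V) (hh : h ∈ L2 W) :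
    MemLp (rowMul h V) 2 periodMeasure := by
  refine ⟨hV.aestronglyMeasurable_rowMul hh.1, ?_⟩
  have := hh.2
  rw [hV.energy_eq] at this
  by_contra hc
  rw [not_lt_top_iff] at hc
  simp [hc] at this

end IsHermitianRoot

/-- The trigonometric polynomial with coefficients `c (n, k)` at `e^{inx} δ_k`, `n ∈ A`. -/
def vecPoly {A : Set ℤ} (c : A × Fin T →₀ ℂ) : VecFun T := fun x =>
  c.sum fun p a => a • Pi.single p.2 (expo p.1 x)

/-- The function `e^{inx} δ_k`. -/
def vecExpo (n : ℤ) (k : Fin T) : VecFun T := fun x => Pi.single k (expo n x)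

lemma continuous_vecExpo (n : ℤ) (k : Fin T) : Continuous (vecExpo n k) := by
  have h : ∀ i, Continuous fun x => vecExpo n k x i := fun i => by
    by_cases hi : i = k
    · subst hi; simpa [vecExpo] using continuous_expo n
    · simpa [vecExpo, hi] using continuous_const
  exact continuous_pi h

lemma norm_vecExpo_apply_le (n : ℤ) (k i : Fin T) (x : ℝ) : ‖vecExpo n k x i‖ ≤ 1 := by
  by_cases hi : i = k
  · subst hi; simp [vecExpo]
  · simp [vecExpo, hi]

lemma vecExpo_mem_L2 {W : MatFun T} (hW : IsSpectralDensity W) (n : ℤ) (k : Fin T) :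
    vecExpo n k ∈ L2 W :=
  ⟨(continuous_vecExpo n k).aestronglyMeasurable,
    energy_lt_top_of_bounded hW fun x i => norm_vecExpo_apply_le n k i x⟩

lemma vecPoly_eq {A : Set ℤ} (c : A × Fin T →₀ ℂ) :
    vecPoly c = ∑ p ∈ c.support, c p • vecExpo (p.1 : ℤ) p.2 := by
  ext x i
  simp [vecPoly, vecExpo, Finsupp.sum, Finset.sum_apply]

lemma sesq_vecExpo (W : Matrix (Fin T) (Fin T) ℂ) (a : Fin T → ℂ) (n : ℤ) (k : Fin T) (x : ℝ) :
    sesq W a (vecExpo n k x) = (a ᵥ* W) k * expo (-n) x := by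
  rw [sesq_eq_vecMul, vecExpo, ← Pi.single_star, star_expo, dotProduct_single]

/-- Orthogonal projection in `L₂(W)` onto the closed span of the functions `e^{inx} δ_k`, `n ∈ A`.
Orthogonality of the remainder is expressed by the Fourier coefficients of `(y - p) W`. -/
theorem IsRegularWeight.exists_projection {W : MatFun T} (hW : IsRegularWeight W) (A : Set ℤ)
    {y : VecFun T} (hy : y ∈ L2 W) :
    ∃ p ∈ L2 W, (∀ n ∈ A, ∀ k, fcoef (fun x => ((y x - p x) ᵥ* W x) k) n = 0) ∧
      ∀ ε : ℝ≥0∞, 0 < ε → ∃ c : A × Fin T →₀ ℂ, energy W (p - vecPoly c) < ε := by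
  obtain ⟨V, hV⟩ := hW.weight.exists_root
  have hVu : ∀ᵐ x ∂periodMeasure, IsUnit (V x).det := by
    filter_upwards [hV.sq, hW.unit] with x h1 h2
    rw [← h1, det_mul] at h2
    exact isUnit_of_mul_isUnit_left h2
  have hbm : ∀ p : A × Fin T, MemLp (rowMul (vecExpo (p.1 : ℤ) p.2) V) 2 periodMeasure :=
    fun p => hV.memLp_rowMul (vecExpo_mem_L2 hW.density _ _)
  set b : A × Fin T → Lp (EuclideanSpace ℂ (Fin T)) 2 periodMeasure := fun p => (hbm p).toLp _
    with hb
  set Y : Lp (EuclideanSpace ℂ (Fin T)) 2 periodMeasure := (hV.memLp_rowMul hy).toLp _ with hY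
  set K := (Submodule.span ℂ (Set.range b)).topologicalClosure with hK
  have : CompleteSpace K := (Submodule.isClosed_topologicalClosure _).completeSpace_coe
  set P : Lp (EuclideanSpace ℂ (Fin T)) 2 periodMeasure := K.starProjection Y with hP
  have hPK : P ∈ K := K.starProjection_apply_mem Y
  have hPorth : ∀ z ∈ K, inner ℂ z (Y - P) = 0 := fun z hz =>
    K.inner_right_of_mem_orthogonal hz (K.sub_starProjection_mem_orthogonal Y)
  set p : VecFun T := fun x => (P x).ofLp ᵥ* (V x)⁻¹ with hp
  have hpV : rowMul p V =ᵐ[periodMeasure] P := by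
    filter_upwards [hVu] with x hx
    rw [rowMul, hp]
    dsimp only
    rw [vecMul_vecMul, nonsing_inv_mul _ hx, vecMul_one]
  have hpm : AEStronglyMeasurable p periodMeasure :=
    AEStronglyMeasurable.vecMul ((PiLp.continuous_ofLp 2 _).comp_aestronglyMeasurable
      (Lp.aestronglyMeasurable P)) (AEStronglyMeasurable.matrix_inv hV.meas)
  have hpL : p ∈ L2 W := by
    refine ⟨hpm, ?_⟩
    rw [hV.energy_eq, eLpNorm_congr_ae hpV]
    exact ENNReal.pow_lt_top (Lp.eLpNorm_lt_top P)
  refine ⟨p, hpL, fun n hn k => ?_, fun ε hε => ?_⟩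
  · have h1 := hPorth (b (⟨n, hn⟩, k)) (Submodule.le_topologicalClosure _
      (Submodule.subset_span ⟨_, rfl⟩))
    rw [L2.inner_def] at h1
    rw [fcoef, mean]
    refine mul_eq_zero_of_right _ (Eq.trans (integral_congr_ae ?_) h1)
    filter_upwards [Lp.coeFn_sub Y P, (hbm (⟨n, hn⟩, k)).coeFn_toLp,
      (hV.memLp_rowMul hy).coeFn_toLp, hpV, hV.inner_rowMul (y - p) (vecExpo n k)]
      with x h2 h3 h4 h5 h6
    rw [h2, h3, Pi.sub_apply, h4, ← h5]
    have h7 : rowMul y V x - rowMul p V x = rowMul (y - p) V x := by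
      simp only [rowMul, Pi.sub_apply, sub_vecMul]; rfl
    rw [h7, h6, sesq_vecExpo]
    rfl
  · obtain ⟨δ, hδ, hδε⟩ : ∃ δ : ℝ, 0 < δ ∧ ENNReal.ofReal δ ^ 2 < ε := by
      have h1 : Tendsto (fun δ : ℝ => ENNReal.ofReal δ ^ 2) (𝓝 0) (𝓝 (ENNReal.ofReal 0 ^ 2)) :=
        ((ENNReal.continuous_pow 2).comp ENNReal.continuous_ofReal).tendsto 0
      rw [ENNReal.ofReal_zero, zero_pow two_ne_zero] at h1
      have h2 := (h1.eventually (gt_mem_nhds hε)).filter_mono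
        (nhdsWithin_le_nhds (s := Set.Ioi 0))
      obtain ⟨δ, h3, h4⟩ := (h2.and self_mem_nhdsWithin).exists
      exact ⟨δ, h4, h3⟩
    obtain ⟨g, hg, hgδ⟩ := Metric.mem_closure_iff.1 hPK δ hδ
    obtain ⟨c, rfl⟩ := (Finsupp.mem_span_range_iff_exists_finsupp).1 hg
    refine ⟨c, lt_of_le_of_lt ?_ hδε⟩
    have hcV : rowMul (vecPoly c) V =ᵐ[periodMeasure] ↑↑(c.sum fun i a => a • b i) := by
      have h1 : ∀ᵐ x ∂periodMeasure, ∀ i ∈ c.support, (c i • b i : Lp _ _ _) x =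
          c i • rowMul (vecExpo (i.1 : ℤ) i.2) V x :=
        (ae_ball_iff c.support.countable_toSet).2 fun i _ => by
          filter_upwards [Lp.coeFn_smul (c i) (b i), (hbm i).coeFn_toLp] with x h1 h2
          rw [h1, Pi.smul_apply, h2]
      filter_upwards [Lp.coeFn_finsetSum c.support fun i => c i • b i, h1] with x h2 h3
      rw [Finsupp.sum, h2, Finset.sum_apply, Finset.sum_congr rfl h3, vecPoly_eq]
      simp only [rowMul, Finset.sum_apply, Pi.smul_apply, ← WithLp.toLp_smul, ← smul_vecMul,
        ← WithLp.toLp_sum, ← sum_vecMul]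
    have hsub : rowMul (p - vecPoly c) V =ᵐ[periodMeasure]
        ↑↑(P - c.sum fun i a => a • b i) := by
      filter_upwards [hpV, hcV, Lp.coeFn_sub P (c.sum fun i a => a • b i)] with x h1 h2 h3
      rw [h3, Pi.sub_apply, ← h1, ← h2]
      simp only [rowMul, Pi.sub_apply, sub_vecMul]; rfl
    rw [hV.energy_eq, eLpNorm_congr_ae hsub]
    rw [dist_eq_norm] at hgδ
    gcongr
    rw [← Lp.enorm_def, ← ofReal_norm]
    exact ENNReal.ofReal_le_ofReal hgδ.le

/-! ### The parallel sum `F (F + G)⁻¹ G` and completion of the square -/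

section pointwise

variable {F G : Matrix (Fin T) (Fin T) ℂ}

lemma quad_inv_vecMul_le (hF : F.PosSemidef) (hG : G.PosSemidef) (hu : IsUnit (F + G).det)
    (a : Fin T → ℂ) : quad (F + G)⁻¹ (a ᵥ* F) ≤ quad F a := by
  set z := (a ᵥ* F) ᵥ* (F + G)⁻¹ with hz
  have hq : sesq F a z = quad (F + G)⁻¹ (a ᵥ* F) := by
    rw [sesq_eq_vecMul, hz, star_vecMul, conjTranspose_nonsing_inv, (hF.add hG).1.eq]
    exact sesq_self_eq_quad (hF.add hG).1.inv _
  have h1 := norm_sesq_le hF a z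
  have h0 := quad_nonneg (hF.add hG).inv (a ᵥ* F)
  rw [hq, Complex.norm_real, Real.norm_of_nonneg h0] at h1
  have h2 : quad F z ≤ quad (F + G)⁻¹ (a ᵥ* F) := by
    rw [← quad_vecMul_inv (hF.add hG).1 hu, quad_add_weight]
    exact le_add_of_nonneg_right (quad_nonneg hG _)
  have h3 : quad (F + G)⁻¹ (a ᵥ* F) ^ 2 ≤ quad F a * quad (F + G)⁻¹ (a ᵥ* F) := by
    calc quad (F + G)⁻¹ (a ᵥ* F) ^ 2 ≤ (√(quad F a) * √(quad F z)) ^ 2 := by gcongr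
      _ = quad F a * quad F z := by
        rw [mul_pow, Real.sq_sqrt (quad_nonneg hF _), Real.sq_sqrt (quad_nonneg hF _)]
      _ ≤ _ := mul_le_mul_of_nonneg_left h2 (quad_nonneg hF _)
  rcases h0.eq_or_lt with h4 | h4
  · rw [← h4]; exact quad_nonneg hF a
  · exact le_of_mul_le_mul_right (by linarith [sq (quad (F + G)⁻¹ (a ᵥ* F))]) h4

lemma parallelSum_eq (hu : IsUnit (F + G).det) :
    F * (F + G)⁻¹ * G = F - F * (F + G)⁻¹ * F := by
  have h : F * (F + G)⁻¹ * (F + G) = F := by rw [mul_assoc, nonsing_inv_mul _ hu, mul_one]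
  rw [mul_add] at h
  exact eq_sub_of_add_eq (by rw [add_comm]; exact h)

lemma sesq_mul_inv_mul (hF : F.IsHermitian) (a b : Fin T → ℂ) :
    sesq (F * (F + G)⁻¹ * F) a b = sesq (F + G)⁻¹ (a ᵥ* F) (b ᵥ* F) := by
  simp only [sesq, star_vecMul, hF.eq, dotProduct_mulVec, vecMul_vecMul, mul_assoc, mulVec_mulVec]

lemma quad_parallelSum (hF : F.PosSemidef) (hu : IsUnit (F + G).det) (a : Fin T → ℂ) :
    quad (F * (F + G)⁻¹ * G) a = quad F a - quad (F + G)⁻¹ (a ᵥ* F) := by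
  rw [parallelSum_eq hu, quad, sesq, sub_mulVec, dotProduct_sub, Complex.sub_re]
  congr 1
  exact congrArg Complex.re (sesq_mul_inv_mul hF.1 a a)

lemma posSemidef_parallelSum (hF : F.PosSemidef) (hG : G.PosSemidef) (hu : IsUnit (F + G).det) :
    (F * (F + G)⁻¹ * G).PosSemidef := by
  have hH : (F * (F + G)⁻¹ * G).IsHermitian := by
    rw [parallelSum_eq hu]
    refine hF.1.sub ?_
    have := isHermitian_mul_mul_conjTranspose F (hF.add hG).1.inv
    rwa [hF.1.eq] at this
  refine PosSemidef.of_dotProduct_mulVec_nonneg hH fun v => ?_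
  have h1 := sesq_self_eq_quad hH (star v)
  rw [sesq, star_star] at h1
  rw [h1, quad_parallelSum hF hu]
  exact_mod_cast sub_nonneg.2 (quad_inv_vecMul_le hF hG hu _)

/-- Completion of the square in the mean-square error. -/
lemma quad_sub_add_quad (hF : F.PosSemidef) (hG : G.PosSemidef) (hu : IsUnit (F + G).det)
    (a h : Fin T → ℂ) : quad F (a - h) + quad G h =
      quad (F + G) (h - a ᵥ* (F * (F + G)⁻¹)) + quad (F * (F + G)⁻¹ * G) a := by
  set z := a ᵥ* (F * (F + G)⁻¹) with hz
  have h1 : sesq (F + G) h z = sesq F h a := by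
    rw [hz, ← vecMul_vecMul, sesq, star_vecMul, conjTranspose_nonsing_inv, (hF.add hG).1.eq,
      mulVec_mulVec, mul_nonsing_inv _ hu, one_mulVec, star_vecMul, hF.1.eq, sesq]
  have h2 : quad (F + G) z = quad (F + G)⁻¹ (a ᵥ* F) := by
    rw [← quad_vecMul_inv (hF.add hG).1 hu, vecMul_vecMul]
  have h3 := congrArg Complex.re (star_sesq hF.1 a h)
  simp only [Complex.star_def, Complex.conj_re] at h3
  have hneg : ∀ (W : Matrix (Fin T) (Fin T) ℂ) (u v : Fin T → ℂ),
      (sesq W u (-v)).re = -(sesq W u v).re := fun W u v => by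
    simp [sesq, mulVec_neg]
  rw [quad_parallelSum hF hu, sub_eq_add_neg a h, sub_eq_add_neg h z, quad_add hF.1,
    quad_add (hF.add hG).1, quad_neg, quad_neg, hneg, hneg, h1, h2, h3, quad_add_weight]
  ring

end pointwise

/-- The function `F (F + G)⁻¹ G`. -/
def parallelSum (F G : MatFun T) : MatFun T := fun x => F x * (F x + G x)⁻¹ * G x

section densities

variable {F G : MatFun T} {a h : VecFun T}

lemma vecMul_mem_L2_inv (hF : IsSpectralDensity F) (hG : IsSpectralDensity G)
    (hm : MinimalityCondition F G) (ha : AEStronglyMeasurable a periodMeasure)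
    (haF : energy F a < ⊤) : (fun x => a x ᵥ* F x) ∈ L2 fun x => (F x + G x)⁻¹ := by
  refine ⟨AEStronglyMeasurable.vecMul ha hF.isWeight.meas, lt_of_le_of_lt (energy_mono_ae ?_) haF⟩
  filter_upwards [hF.2, hG.2, hm.1] with x h1 h2 h3 using quad_inv_vecMul_le h1 h2 h3 _

lemma vecMul_mul_inv_mem_L2 (hF : IsSpectralDensity F) (hG : IsSpectralDensity G)
    (hm : MinimalityCondition F G) (ha : AEStronglyMeasurable a periodMeasure)
    (haF : energy F a < ⊤) : (fun x => a x ᵥ* (F x * (F x + G x)⁻¹)) ∈ L2 (F + G) := by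
  have hW := hm.isRegularWeight hF hG
  have h1 := vecMul_mem_L2_inv hF hG hm ha haF
  simp only [← vecMul_vecMul]
  refine ⟨AEStronglyMeasurable.vecMul h1.1 (AEStronglyMeasurable.matrix_inv hW.weight.meas), ?_⟩
  exact (hW.energy_vecMul_inv fun x => a x ᵥ* F x).trans_lt h1.2

lemma integrable_mul_inv_apply (hF : IsSpectralDensity F) (hG : IsSpectralDensity G)
    (hm : MinimalityCondition F G) (i j : Fin T) :
    Integrable (fun x => (F x * (F x + G x)⁻¹) i j) periodMeasure := by
  have h1 := (hm.isRegularWeight hF hG).integrable_apply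
    (vecMul_mul_inv_mem_L2 (a := fun _ => Pi.single i 1) hF hG hm aestronglyMeasurable_const
      (IsRegularWeight.const_mem_L2 hF _).2) j
  simpa using h1

lemma isSpectralDensity_parallelSum (hF : IsSpectralDensity F) (hG : IsSpectralDensity G)
    (hm : MinimalityCondition F G) : IsSpectralDensity (parallelSum F G) := by
  refine ⟨fun i j => ?_, ?_⟩
  · have hmem : ∀ i : Fin T, (fun x => Pi.single (M := fun _ => ℂ) i 1 ᵥ* F x) ∈
        L2 fun x => (F x + G x)⁻¹ := fun i =>
      vecMul_mem_L2_inv hF hG hm aestronglyMeasurable_const (IsRegularWeight.const_mem_L2 hF _).2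
    have h1 := integrable_sesq (hm.isRegularWeight hF hG).inv.weight (hmem i) (hmem j)
    refine ((hF.1 i j).sub h1).congr ?_
    filter_upwards [hF.2, hm.1] with x h2 h3
    rw [parallelSum, parallelSum_eq h3]
    have h4 := sesq_mul_inv_mul (G := G x) h2.1 (Pi.single i 1) (Pi.single j 1)
    rw [sesq_single] at h4
    simp only [Matrix.sub_apply, h4, Pi.sub_apply]
    rfl
  · filter_upwards [hF.2, hG.2, hm.1] with x h1 h2 h3 using posSemidef_parallelSum h1 h2 h3

end densities

namespace FilteringProblem

variable (X : FilteringProblem T) {F G : MatFun T}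

/-! ### The transfer function `A` -/

lemma not_mem_U_iff {n : ℤ} : n ∉ X.U ↔ n ∈ X.obs := by
  simp only [U, obs, Set.mem_union, Set.mem_ofPred_eq, not_or, Set.mem_sdiff, not_le]
  constructor
  · exact fun h => ⟨by omega, h.1⟩
  · exact fun h => ⟨h.2, by omega⟩

lemma not_mem_obs_iff {n : ℤ} : n ∉ X.obs ↔ n ∈ X.U := by
  rw [← not_mem_U_iff, not_not]

section A

variable {X} (hX : X.SummableCoeffs)
include hX

lemma SummableCoeffs.summable_norm_apply (i : Fin T) : Summable fun j : X.ZS => ‖X.a j i‖ :=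
  Summable.of_nonneg_of_le (fun _ => norm_nonneg _) (fun j =>
    Finset.single_le_sum (f := fun k => ‖X.a j k‖) (fun _ _ => norm_nonneg _)
      (Finset.mem_univ i)) hX

lemma SummableCoeffs.hasSum_A (x : ℝ) (i : Fin T) :
    HasSum (fun j : X.ZS => X.a j i * expo (-(j : ℤ)) x) (X.A x i) := by
  have h1 : ∀ i, Summable fun j : X.ZS => (expo (-(j : ℤ)) x • X.a j) i := fun i =>
    Summable.of_norm (by simpa using hX.summable_norm_apply i)
  have h2 := (Pi.hasSum.1 (Pi.summable.2 h1).hasSum) i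
  simpa [A, mul_comm] using h2

lemma SummableCoeffs.norm_A_le (x : ℝ) (i : Fin T) :
    ‖X.A x i‖ ≤ ∑' j : X.ZS, ∑ k, ‖X.a j k‖ := by
  rw [← (hX.hasSum_A x i).tsum_eq]
  refine tsum_of_norm_bounded hX.hasSum fun j => ?_
  rw [norm_mul, norm_expo, mul_one]
  exact Finset.single_le_sum (f := fun k => ‖X.a j k‖) (fun _ _ => norm_nonneg _)
    (Finset.mem_univ i)

lemma SummableCoeffs.continuous_A : Continuous X.A := by
  refine continuous_pi fun i => ?_
  have h : (fun x => X.A x i) = fun x => ∑' j : X.ZS, X.a j i * expo (-(j : ℤ)) x :=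
    funext fun x => (hX.hasSum_A x i).tsum_eq.symm
  rw [h]
  refine continuous_tsum (fun j => continuous_const.mul (continuous_expo _))
    (hX.summable_norm_apply i) fun j x => ?_
  simp

lemma SummableCoeffs.A_mem_L2 {W : MatFun T} (hW : IsSpectralDensity W) : X.A ∈ L2 W :=
  ⟨hX.continuous_A.aestronglyMeasurable, energy_lt_top_of_bounded hW hX.norm_A_le⟩

lemma SummableCoeffs.hasSum_mean_A_mul {g : ℝ → ℂ} (hg : Integrable g periodMeasure)
    (i : Fin T) :
    HasSum (fun j : X.ZS => X.a j i * mean fun x => expo (-(j : ℤ)) x * g x)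
      (mean fun x => X.A x i * g x) := by
  have hi : ∀ j : X.ZS, Integrable (fun x => X.a j i * (expo (-(j : ℤ)) x * g x))
      periodMeasure := fun j => by
    refine Integrable.const_mul ?_ _
    simpa only [mul_comm] using Integrable.mul_expo hg (-(j : ℤ))
  have h1 := hasSum_integral_of_summable_integral_norm hi (by
    simp only [norm_mul, norm_expo, one_mul, integral_const_mul]
    exact (hX.summable_norm_apply i).mul_right _)
  have h2 := h1.mul_left (2 * Real.pi : ℂ)⁻¹
  have h3 : (fun x => ∑' j : X.ZS, X.a j i * (expo (-(j : ℤ)) x * g x)) =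
      fun x => X.A x i * g x := by
    ext x
    simp only [← mul_assoc]
    rw [tsum_mul_right, (hX.hasSum_A x i).tsum_eq]
  rw [h3] at h2
  refine h2.congr_fun fun j => ?_
  rw [← mean_const_mul]; rfl

end A

end FilteringProblem

namespace FilteringProblem

variable {X : FilteringProblem T} {F G : MatFun T}

/-! ### The operators in terms of Fourier coefficients -/

lemma SummableCoeffs.Ra_apply (hX : X.SummableCoeffs) (hF : IsSpectralDensity F)
    (hG : IsSpectralDensity G) (hm : MinimalityCondition F G) (k : ℤ) (p : Fin T) :
    X.Ra F G k p = fcoef (fun x => (X.A x ᵥ* (F x * (F x + G x)⁻¹)) p) k := by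
  have hi := integrable_mul_inv_apply hF hG hm
  have h1 : ∀ q, HasSum (fun j : X.ZS => (X.a j ᵥ* blockR F G k j) q)
      (fcoef (fun x => (X.A x ᵥ* (F x * (F x + G x)⁻¹)) q) k) := fun q => by
    have hAi : ∀ i, Integrable (fun x => X.A x i *
        ((F x * (F x + G x)⁻¹) i q * expo (-k) x)) periodMeasure := fun i =>
      (Integrable.mul_expo (hi i q) (-k)).bdd_mul
        (((continuous_apply i).comp hX.continuous_A).aestronglyMeasurable)
        (.of_forall fun x => hX.norm_A_le x i)
    have h2 := hasSum_sum (s := Finset.univ) fun i _ =>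
      hX.hasSum_mean_A_mul (Integrable.mul_expo (hi i q) (-k)) i
    rw [← mean_finsetSum _ fun i _ => hAi i] at h2
    have h3 : (fun x => ∑ i, X.A x i * ((F x * (F x + G x)⁻¹) i q * expo (-k) x)) =
        fun x => (X.A x ᵥ* (F x * (F x + G x)⁻¹)) q * expo (-k) x := by
      ext x; simp only [vecMul, dotProduct, Finset.sum_mul, mul_assoc]
    rw [h3] at h2
    refine h2.congr_fun fun j => ?_
    rw [vecMul, dotProduct]
    refine Finset.sum_congr rfl fun i _ => ?_
    congr 1
    simp only [blockR, of_apply, fcoef]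
    congr 1
    ext x
    rw [show -(k + (j : ℤ)) = -(j : ℤ) + -k by ring, expo_add]
    ring
  have h4 := (Pi.hasSum.2 h1).tsum_eq
  exact congrFun h4 p

lemma SummableCoeffs.Qaa_eq (hX : X.SummableCoeffs) (hF : IsSpectralDensity F)
    (hG : IsSpectralDensity G) (hm : MinimalityCondition F G) :
    X.Qaa F G = mean fun x => sesq (parallelSum F G x) (X.A x) (X.A x) := by
  have hQ := (isSpectralDensity_parallelSum hF hG hm).1
  have hAc : ∀ i, Continuous fun x => X.A x i := fun i =>
    (continuous_apply i).comp hX.continuous_A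
  have hQA : ∀ i l, Integrable (fun x => parallelSum F G x i l * star (X.A x l))
      periodMeasure := fun i l =>
    (hQ i l).mul_bdd (continuous_star.comp (hAc l)).aestronglyMeasurable
      (.of_forall fun x => (norm_star _).trans_le (hX.norm_A_le x l))
  have hQA' : ∀ i, Integrable (fun x => (parallelSum F G x *ᵥ star (X.A x)) i)
      periodMeasure := fun i => by
    simp only [mulVec, dotProduct, Pi.star_apply]
    exact integrable_finsetSum _ fun l _ => hQA i l
  -- the inner sum
  have h1 : ∀ (k : ℤ) (i l : Fin T), HasSum
      (fun j : X.ZS => blockQ F G k j i l * star (X.a j l))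
      (mean fun x => expo (-k) x * (parallelSum F G x i l * star (X.A x l))) := fun k i l => by
    have hstar : Integrable (fun x => star (parallelSum F G x i l) * expo k x) periodMeasure :=
      Integrable.mul_expo ((hQ i l).congr' (continuous_star.comp_aestronglyMeasurable (hQ i l).1)
        (.of_forall fun x => (norm_star _).symm)) k
    have h2 := (hX.hasSum_mean_A_mul hstar l).star
    rw [← mean_star] at h2
    have h3 : (fun x => star (X.A x l * (star (parallelSum F G x i l) * expo k x))) =
        fun x => expo (-k) x * (parallelSum F G x i l * star (X.A x l)) := by
      ext x; simp only [star_mul', star_star, star_expo]; ring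
    rw [h3] at h2
    refine h2.congr_fun fun j => ?_
    rw [star_mul', ← mean_star, mul_comm (blockQ F G k j i l)]
    congr 1
    simp only [blockQ, of_apply, fcoef]
    congr 1
    ext x
    rw [show -(k - (j : ℤ)) = (j : ℤ) + -k by ring, expo_add]
    simp only [star_mul', star_star, star_expo, neg_neg, parallelSum]
    ring
  have h4 : ∀ k : X.ZS, ∑' j : X.ZS, X.a k ⬝ᵥ (blockQ F G k j *ᵥ star (X.a j)) =
      ∑ i, X.a k i * mean fun x => expo (-(k : ℤ)) x *
        (parallelSum F G x *ᵥ star (X.A x)) i := fun k => by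
    have h5 := hasSum_sum (s := Finset.univ) fun i _ =>
      (hasSum_sum (s := Finset.univ) fun l _ => h1 k i l).mul_left (X.a k i)
    refine Eq.trans (HasSum.tsum_eq (h5.congr_fun fun j => ?_)) ?_
    · simp [dotProduct, mulVec]
    · refine Finset.sum_congr rfl fun i _ => ?_
      rw [← mean_finsetSum]
      · simp only [mulVec, dotProduct, Finset.mul_sum, Pi.star_apply]
      · intro l _
        simpa only [mul_comm (expo _ _)] using Integrable.mul_expo (hQA i l) (-(k : ℤ))
  have h6 := hasSum_sum (s := Finset.univ) fun i _ => hX.hasSum_mean_A_mul (hQA' i) i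
  rw [← mean_finsetSum _ fun i _ => (hQA' i).bdd_mul (hAc i).aestronglyMeasurable
    (.of_forall fun x => hX.norm_A_le x i)] at h6
  rw [Qaa]
  simp only [h4]
  exact h6.tsum_eq

lemma trigSum_apply (u : ℤ →₀ (Fin T → ℂ)) (x : ℝ) (i : Fin T) :
    trigSum u x i = ∑ k ∈ u.support, u k i * expo k x := by
  simp [trigSum, Finsupp.sum, Finset.sum_apply, mul_comm]

lemma trigSum_add (u v : ℤ →₀ (Fin T → ℂ)) : trigSum (u + v) = trigSum u + trigSum v := by
  ext x i
  simp only [trigSum, Pi.add_apply]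
  rw [Finsupp.sum_add_index' (by simp) (by simp)]
  rfl

lemma trigSum_zero : trigSum (0 : ℤ →₀ (Fin T → ℂ)) = 0 := by
  ext x i; simp [trigSum]

lemma trigSum_single (n : ℤ) (v : Fin T → ℂ) :
    trigSum (Finsupp.single n v) = fun x => expo n x • v := by
  ext x i; simp [trigSum]

lemma fcoef_trigSum (u : ℤ →₀ (Fin T → ℂ)) (k : ℤ) (i : Fin T) :
    fcoef (fun x => trigSum u x i) k = u k i := by
  simp only [trigSum_apply]
  rw [fcoef_finsetSum _ fun j _ => (integrable_expo j).const_mul _]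
  simp only [fcoef_const_mul, fcoef_expo, mul_ite, mul_one, mul_zero]
  rw [Finset.sum_ite_eq']
  split_ifs with h
  · rfl
  · rw [Finsupp.notMem_support_iff.1 h]; rfl

lemma trigSum_mem_L2 {W : MatFun T} (hW : IsSpectralDensity W) (u : ℤ →₀ (Fin T → ℂ)) :
    trigSum u ∈ L2 W := by
  refine ⟨?_, energy_lt_top_of_bounded hW (C := ∑ k ∈ u.support, ‖u k‖) fun x i => ?_⟩
  · refine aestronglyMeasurable_vec_iff.2 fun i => ?_
    simp only [trigSum_apply]
    exact (continuous_finsetSum _ fun k _ =>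
      continuous_const.mul (continuous_expo k)).aestronglyMeasurable
  · rw [trigSum_apply]
    refine (norm_sum_le _ _).trans (Finset.sum_le_sum fun k _ => ?_)
    rw [norm_mul, norm_expo, mul_one]
    exact norm_le_pi_norm _ _

lemma opB_apply (hm : MinimalityCondition F G) (u : ℤ →₀ (Fin T → ℂ)) (k : ℤ) (p : Fin T) :
    opB F G u k p = fcoef (fun x => (trigSum u x ᵥ* (F x + G x)⁻¹) p) k := by
  have hi := hm.2
  have h1 : ∀ j i, Integrable (fun x => u j i * ((F x + G x)⁻¹ i p * expo j x))
      periodMeasure := fun j i => (Integrable.mul_expo (hi i p) j).const_mul _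
  have h2 : (fun x => (trigSum u x ᵥ* (F x + G x)⁻¹) p) =
      fun x => ∑ j ∈ u.support, ∑ i, u j i * ((F x + G x)⁻¹ i p * expo j x) := by
    ext x
    rw [vecMul, dotProduct, Finset.sum_comm]
    refine Finset.sum_congr rfl fun i _ => ?_
    rw [trigSum_apply, Finset.sum_mul]
    exact Finset.sum_congr rfl fun j _ => by ring
  rw [h2, fcoef_finsetSum _ fun j _ => integrable_finsetSum _ fun i _ => h1 j i, opB, Finsupp.sum,
    Finset.sum_apply]
  refine Finset.sum_congr rfl fun j _ => ?_
  rw [fcoef_finsetSum _ fun i _ => h1 j i, vecMul, dotProduct]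
  refine Finset.sum_congr rfl fun i _ => ?_
  rw [fcoef_const_mul, fcoef_mul_expo]
  rfl

lemma SummableCoeffs.RaInner_eq (hX : X.SummableCoeffs) (hF : IsSpectralDensity F)
    (hG : IsSpectralDensity G) (hm : MinimalityCondition F G) (u : ℤ →₀ (Fin T → ℂ)) :
    X.RaInner F G u = mean fun x => (X.A x ᵥ* (F x * (F x + G x)⁻¹)) ⬝ᵥ star (trigSum u x) := by
  set z : VecFun T := fun x => X.A x ᵥ* (F x * (F x + G x)⁻¹) with hz
  have hzL := vecMul_mul_inv_mem_L2 hF hG hm hX.continuous_A.aestronglyMeasurable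
    (hX.A_mem_L2 hF).2
  have hzi : ∀ p, Integrable (fun x => z x p) periodMeasure := fun p =>
    (hm.isRegularWeight hF hG).integrable_apply hzL p
  have h1 : ∀ k p, Integrable (fun x => z x p * expo (-k) x * star (u k p)) periodMeasure :=
    fun k p => (Integrable.mul_expo (hzi p) _).mul_const _
  have h2 : (fun x => z x ⬝ᵥ star (trigSum u x)) =
      fun x => ∑ k ∈ u.support, ∑ p, z x p * expo (-k) x * star (u k p) := by
    ext x
    rw [dotProduct, Finset.sum_comm]
    refine Finset.sum_congr rfl fun p _ => ?_
    rw [Pi.star_apply, trigSum_apply, star_sum, Finset.mul_sum]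
    refine Finset.sum_congr rfl fun k _ => ?_
    rw [star_mul', star_expo]; ring
  rw [h2, mean_finsetSum _ fun k _ => integrable_finsetSum _ fun p _ => h1 k p, RaInner,
    Finsupp.sum]
  refine Finset.sum_congr rfl fun k _ => ?_
  rw [mean_finsetSum _ fun p _ => h1 k p, dotProduct]
  refine Finset.sum_congr rfl fun p _ => ?_
  rw [mean_mul_const, hX.Ra_apply hF hG hm]
  rfl

/-! ### The closed span of the observations -/

lemma exists_bound_of_mem_obsPoly {q : VecFun T} (hq : q ∈ X.obsPoly) :
    Continuous q ∧ (∃ C : ℝ, ∀ x i, ‖q x i‖ ≤ C) ∧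
      ∀ i, ∀ n ∉ X.obs, fcoef (fun x => q x i) n = 0 := by
  induction hq using Submodule.span_induction with
  | mem f hf =>
    obtain ⟨m, hm, k, rfl⟩ := hf
    refine ⟨continuous_vecExpo m k, ⟨1, fun x i => norm_vecExpo_apply_le m k i x⟩,
      fun i n hn => ?_⟩
    by_cases hi : i = k
    · subst hi
      simp only [Pi.single_eq_same]
      rw [show (fun x => expo m x) = expo m from rfl, fcoef_expo, if_neg (by rintro rfl; exact hn hm)]
    · simp [hi, fcoef, mean]
  | zero => exact ⟨continuous_zero, ⟨0, fun x i => by simp⟩, fun i n _ => by simp [fcoef, mean]⟩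
  | add f g _ _ hf hg =>
    obtain ⟨hf1, ⟨C, hC⟩, hf3⟩ := hf
    obtain ⟨hg1, ⟨D, hD⟩, hg3⟩ := hg
    refine ⟨hf1.add hg1, ⟨C + D, fun x i => (norm_add_le _ _).trans (add_le_add (hC x i) (hD x i))⟩,
      fun i n hn => ?_⟩
    have h1 : Integrable (fun x => f x i) periodMeasure :=
      Continuous.integrable_periodMeasure ((continuous_apply i).comp hf1)
    have h2 : Integrable (fun x => g x i) periodMeasure :=
      Continuous.integrable_periodMeasure ((continuous_apply i).comp hg1)
    have h3 := fcoef_add h1 h2 n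
    rw [hf3 i n hn, hg3 i n hn, add_zero] at h3
    exact h3
  | smul c f _ hf =>
    obtain ⟨hf1, ⟨C, hC⟩, hf3⟩ := hf
    refine ⟨hf1.const_smul c, ⟨‖c‖ * C, fun x i => ?_⟩, fun i n hn => ?_⟩
    · rw [Pi.smul_apply, Pi.smul_apply, norm_smul]
      exact mul_le_mul_of_nonneg_left (hC x i) (norm_nonneg _)
    · have h3 := fcoef_const_mul c (fun x => f x i) n
      rw [hf3 i n hn, mul_zero] at h3
      exact h3

lemma obsPoly_mem_L2 {W : MatFun T} (hW : IsSpectralDensity W) {q : VecFun T}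
    (hq : q ∈ X.obsPoly) : q ∈ L2 W := by
  obtain ⟨h1, ⟨C, hC⟩, -⟩ := exists_bound_of_mem_obsPoly hq
  exact ⟨h1.aestronglyMeasurable, energy_lt_top_of_bounded hW hC⟩

lemma obsPoly_mem_L2s {W : MatFun T} (hW : IsSpectralDensity W) {q : VecFun T}
    (hq : q ∈ X.obsPoly) : q ∈ X.L2s W :=
  ⟨obsPoly_mem_L2 hW hq, fun ε hε => ⟨q, hq, by
    rw [sub_self]; simpa [energy_eq_lintegral_quad, quad, sesq] using hε⟩⟩

lemma vecPoly_mem_obsPoly (c : X.obs × Fin T →₀ ℂ) : vecPoly c ∈ X.obsPoly := by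
  rw [vecPoly_eq]
  exact Submodule.sum_mem _ fun p _ => Submodule.smul_mem _ _
    (Submodule.subset_span ⟨p.1, p.1.2, p.2, rfl⟩)

lemma fcoef_eq_zero_of_mem_L2s {W : MatFun T} (hW : IsRegularWeight W) {h : VecFun T}
    (hh : h ∈ X.L2s W) (k : Fin T) {n : ℤ} (hn : n ∉ X.obs) : fcoef (fun x => h x k) n = 0 := by
  choose q hq hqe using fun m : ℕ => hh.2 ((m : ℝ≥0∞) + 1)⁻¹ (by simp)
  have h1 : Tendsto (fun m => energy W (h - q m)) atTop (𝓝 0) := by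
    have h2 : Tendsto (fun m : ℕ => ((m : ℝ≥0∞) + 1)⁻¹) atTop (𝓝 0) := by
      have := (tendsto_add_atTop_iff_nat 1).2 ENNReal.tendsto_inv_nat_nhds_zero
      simpa using this
    exact tendsto_of_tendsto_of_tendsto_of_le_of_le tendsto_const_nhds h2
      (fun _ => zero_le) fun m => (hqe m).le
  have h3 := hW.tendsto_fcoef (fun m => obsPoly_mem_L2 hW.density (hq m)) hh.1 h1 k n
  simp only [(exists_bound_of_mem_obsPoly (hq _)).2.2 k n hn] at h3
  exact (tendsto_nhds_unique h3 tendsto_const_nhds)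

/-- For a regular weight, `L₂ˢ(W)` consists of the elements of `L₂(W)` whose frequencies are times
of observation. The remainder `r` of the projection of such a function onto `L₂ˢ(W)` has frequencies
in the set of observation times while `r W` has frequencies in `U`, so that `∫ r W r* = 0` by
Smirnov's theorem. -/
theorem mem_L2s_of_fcoef_eq_zero {W : MatFun T} (hW : IsRegularWeight W) {h : VecFun T}
    (hh : h ∈ L2 W) (h0 : ∀ k, ∀ n ∉ X.obs, fcoef (fun x => h x k) n = 0) : h ∈ X.L2s W := by
  obtain ⟨p, hp, horth, happ⟩ := hW.exists_projection X.obs hh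
  have hpS : p ∈ X.L2s W := ⟨hp, fun ε hε => by
    obtain ⟨c, hc⟩ := happ ε hε
    exact ⟨vecPoly c, vecPoly_mem_obsPoly c, hc⟩⟩
  have hr : h - p ∈ L2 W := L2.sub hW.weight hh hp
  have hrW : (fun x => (h - p) x ᵥ* W x) ∈ L2 fun x => (W x)⁻¹ :=
    ⟨AEStronglyMeasurable.vecMul hr.1 hW.weight.meas, by
      rw [hW.energy_inv_vecMul]; exact hr.2⟩
  have h1 : ∫ x, ((h - p) x ᵥ* W x) ⬝ᵥ star ((h - p) x) ∂periodMeasure = 0 := by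
    refine X.integral_dotProduct_star_eq_zero (f := fun x => (h - p) x ᵥ* W x) (g := h - p)
      (fun k => hW.inv.integrable_apply hrW k) (fun k => hW.integrable_apply hr k)
      (fun k n hn => horth n (X.not_mem_U_iff.1 hn) k) (fun k n hn => ?_) ?_
    · have := fcoef_sub (hW.integrable_apply hh k) (hW.integrable_apply hp k) n
      rw [h0 k n hn, fcoef_eq_zero_of_mem_L2s hW hpS k hn, sub_zero] at this
      exact this
    · simpa only [← sesq_eq_vecMul] using integrable_sesq hW.weight hr hr
  have h2 : energy W (h - p) = 0 := by
    rw [← ofReal_re_integral_sesq_self hW.weight hr]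
    simp only [sesq_eq_vecMul, h1, Complex.zero_re, ENNReal.ofReal_zero]
  have h3 := hW.ae_eq_of_energy_sub_eq_zero hh.1 hp.1 h2
  refine ⟨hh, fun ε hε => ?_⟩
  obtain ⟨q, hq, hqe⟩ := hpS.2 ε hε
  refine ⟨q, hq, lt_of_eq_of_lt (energy_congr_ae (h3.mono fun x hx => ?_)) hqe⟩
  rw [Pi.sub_apply, Pi.sub_apply, hx]

end FilteringProblem

namespace FilteringProblem

variable {X : FilteringProblem T} {F G : MatFun T}

/-! ### The optimal estimate -/

/-- The finitely supported sequence with the coefficients of a trigonometric polynomial. -/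
lemma exists_trigSum_eq_vecPoly {A : Set ℤ} (c : A × Fin T →₀ ℂ) :
    ∃ u : ℤ →₀ (Fin T → ℂ), (∀ k ∉ A, u k = 0) ∧ trigSum u = vecPoly c := by
  induction c using Finsupp.induction_linear with
  | zero => exact ⟨0, fun _ _ => rfl, by rw [trigSum_zero]; ext x i; simp [vecPoly]⟩
  | add f g hf hg =>
    obtain ⟨u, hu, hu'⟩ := hf
    obtain ⟨v, hv, hv'⟩ := hg
    refine ⟨u + v, fun k hk => by simp [hu k hk, hv k hk], ?_⟩
    rw [trigSum_add, hu', hv']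
    ext x i
    simp only [vecPoly, Pi.add_apply]
    rw [Finsupp.sum_add_index' (by simp) (by intros; rw [add_smul])]
    rfl
  | single p a =>
    refine ⟨Finsupp.single p.1 (Pi.single p.2 a), fun k hk => ?_, ?_⟩
    · rw [Finsupp.single_apply, if_neg (by rintro rfl; exact hk p.1.2)]
    · rw [trigSum_single]
      ext x i
      by_cases hi : i = p.2
      · subst hi; simp [vecPoly, mul_comm]
      · simp [vecPoly, hi]

section

variable (hX : X.SummableCoeffs) (hF : IsSpectralDensity F) (hG : IsSpectralDensity G)
  (hm : MinimalityCondition F G)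
include hX hF hG hm

lemma SummableCoeffs.vecMul_A_mem_L2 :
    (fun x => X.A x ᵥ* (F x * (F x + G x)⁻¹)) ∈ L2 (F + G) :=
  vecMul_mul_inv_mem_L2 hF hG hm hX.continuous_A.aestronglyMeasurable (hX.A_mem_L2 hF).2

/-- `B⁻¹ R a` exists: its symbol is the projection of `Aᵀ F` onto the closed span of the
frequencies in `U` in `L₂((F + G)⁻¹)`. -/
theorem SummableCoeffs.exists_isInvBRa : ∃ c C, X.IsInvBRa F G c C := by
  have hW := hm.isRegularWeight hF hG
  have hAF : (fun x => X.A x ᵥ* F x) ∈ L2 fun x => (F x + G x)⁻¹ :=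
    vecMul_mem_L2_inv hF hG hm hX.continuous_A.aestronglyMeasurable (hX.A_mem_L2 hF).2
  obtain ⟨C, hC, horth, happ⟩ := hW.inv.exists_projection X.U hAF
  choose q hq using fun n : ℕ => happ ((n : ℝ≥0∞) + 1)⁻¹ (by simp)
  choose u hu0 huq using fun n => exists_trigSum_eq_vecPoly (q n)
  have hlim : Tendsto (fun n => energy (fun x => (F x + G x)⁻¹) (C - trigSum (u n))) atTop
      (𝓝 0) := by
    have h2 : Tendsto (fun m : ℕ => ((m : ℝ≥0∞) + 1)⁻¹) atTop (𝓝 0) := by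
      have := (tendsto_add_atTop_iff_nat 1).2 ENNReal.tendsto_inv_nat_nhds_zero
      simpa using this
    refine tendsto_of_tendsto_of_tendsto_of_le_of_le tendsto_const_nhds h2
      (fun _ => zero_le) fun m => ?_
    dsimp only
    rw [huq]
    exact (hq m).le
  have huL : ∀ n, trigSum (u n) ∈ L2 fun x => (F x + G x)⁻¹ := fun n =>
    trigSum_mem_L2 hW.inv.density _
  refine ⟨fun k i => fcoef (fun x => C x i) k, C, u, hu0, fun k => ?_, hC.1, hlim, fun k hk => ?_⟩
  · refine tendsto_pi_nhds.2 fun i => ?_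
    have := hW.inv.tendsto_fcoef huL hC hlim i k
    simpa only [fcoef_trigSum] using this
  · refine tendsto_pi_nhds.2 fun p => ?_
    simp only [opB_apply hm, hX.Ra_apply hF hG hm]
    have hinv : ∀ {h : VecFun T}, h ∈ L2 (fun x => (F x + G x)⁻¹) →
        (fun x => h x ᵥ* (F x + G x)⁻¹) ∈ L2 (F + G) := fun {h} hh =>
      ⟨AEStronglyMeasurable.vecMul hh.1 hW.inv.weight.meas,
        (hW.energy_vecMul_inv h).trans_lt hh.2⟩
    have h3 := hW.tendsto_fcoef (fun n => hinv (huL n)) (hinv hC) (hlim.congr fun n => by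
      refine (hW.energy_vecMul_inv (C - trigSum (u n))).symm.trans
        (congrArg _ (funext fun x => ?_))
      simp only [Pi.sub_apply, sub_vecMul, Pi.add_apply]) p k
    have h4 : fcoef (fun x => (C x ᵥ* (F x + G x)⁻¹) p) k =
        fcoef (fun x => (X.A x ᵥ* (F x * (F x + G x)⁻¹)) p) k := by
      have h5 := fcoef_sub (hW.integrable_apply (hX.vecMul_A_mem_L2 hF hG hm) p)
        (hW.integrable_apply (hinv hC) p) k
      have h6 := horth k hk p
      simp only [sub_vecMul, vecMul_vecMul, Pi.sub_apply, Pi.add_apply] at h6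
      rw [h6] at h5
      exact (sub_eq_zero.1 h5.symm).symm
    rw [← h4]
    exact h3

variable {u : ℕ → ℤ →₀ (Fin T → ℂ)} {c : ℤ → Fin T → ℂ} {C : VecFun T}

omit hX in
lemma ApproxInvBRa.mem_L2 (hA : X.ApproxInvBRa F G u c C) : C ∈ L2 fun x => (F x + G x)⁻¹ := by
  have hW := (hm.isRegularWeight hF hG).inv
  obtain ⟨n, hn⟩ := (hA.symbol.eventually (gt_mem_nhds ENNReal.zero_lt_top)).exists
  have hu : trigSum (u n) ∈ L2 fun x => (F x + G x)⁻¹ := trigSum_mem_L2 hW.density _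
  have := L2.add hW.weight (a := C - trigSum (u n)) ⟨hA.measurable.sub hu.1, hn⟩ hu
  rwa [sub_add_cancel] at this

omit hX in
lemma ApproxInvBRa.vecMul_inv_mem_L2 (hA : X.ApproxInvBRa F G u c C) :
    (fun x => C x ᵥ* (F x + G x)⁻¹) ∈ L2 (F + G) := by
  have hW := hm.isRegularWeight hF hG
  have hC := hA.mem_L2 hF hG hm
  exact ⟨AEStronglyMeasurable.vecMul hC.1 hW.inv.weight.meas,
    (hW.energy_vecMul_inv C).trans_lt hC.2⟩

omit hX in
lemma ApproxInvBRa.fcoef_eq_zero (hA : X.ApproxInvBRa F G u c C) (i : Fin T) {n : ℤ}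
    (hn : n ∉ X.U) : fcoef (fun x => C x i) n = 0 := by
  have hW := (hm.isRegularWeight hF hG).inv
  have h := hW.tendsto_fcoef (fun m => trigSum_mem_L2 hW.density (u m)) (hA.mem_L2 hF hG hm)
    hA.symbol i n
  simp only [fcoef_trigSum, hA.support _ n hn, Pi.zero_apply] at h
  exact tendsto_nhds_unique h tendsto_const_nhds

lemma ApproxInvBRa.specChar_mem_L2 (hA : X.ApproxInvBRa F G u c C) :
    X.specChar F G C ∈ L2 (F + G) :=
  L2.sub (hm.isRegularWeight hF hG).weight (hX.vecMul_A_mem_L2 hF hG hm)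
    (hA.vecMul_inv_mem_L2 hF hG hm)

/-- The equation `B c = R a` says that the frequencies of `h(F, G)` are times of observation. -/
lemma ApproxInvBRa.fcoef_specChar (hA : X.ApproxInvBRa F G u c C) (p : Fin T) {n : ℤ}
    (hn : n ∉ X.obs) : fcoef (fun x => X.specChar F G C x p) n = 0 := by
  have hW := hm.isRegularWeight hF hG
  have hCL := hA.vecMul_inv_mem_L2 hF hG hm
  have h1 := fcoef_sub (hW.integrable_apply (hX.vecMul_A_mem_L2 hF hG hm) p)
    (hW.integrable_apply hCL p) n
  refine h1.trans (sub_eq_zero.2 ?_)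
  have huL : ∀ m, (fun x => trigSum (u m) x ᵥ* (F x + G x)⁻¹) ∈ L2 (F + G) := fun m =>
    ⟨AEStronglyMeasurable.vecMul (trigSum_mem_L2 hF _).1 hW.inv.weight.meas,
      (hW.energy_vecMul_inv _).trans_lt (trigSum_mem_L2 hW.inv.density _).2⟩
  have h2 := hW.tendsto_fcoef huL hCL (hA.symbol.congr fun m => by
      refine (hW.energy_vecMul_inv (C - trigSum (u m))).symm.trans
        (congrArg _ (funext fun x => ?_))
      simp only [Pi.sub_apply, sub_vecMul, Pi.add_apply]) p n
  have h3 := tendsto_pi_nhds.1 (hA.equation n (X.not_mem_obs_iff.1 hn)) p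
  simp only [opB_apply hm, hX.Ra_apply hF hG hm] at h3
  exact tendsto_nhds_unique h3 h2

lemma ApproxInvBRa.specChar_mem_L2s (hA : X.ApproxInvBRa F G u c C) :
    X.specChar F G C ∈ X.L2s (F + G) :=
  mem_L2s_of_fcoef_eq_zero (hm.isRegularWeight hF hG) (hA.specChar_mem_L2 hX hF hG hm)
    fun p _ hn => hA.fcoef_specChar hX hF hG hm p hn

omit hX in
/-- The symbol `C` is orthogonal to the estimates based on the observations. -/
lemma ApproxInvBRa.integral_dotProduct_star (hA : X.ApproxInvBRa F G u c C) {d : VecFun T}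
    (hd : d ∈ X.L2s (F + G)) : ∫ x, d x ⬝ᵥ star (C x) ∂periodMeasure = 0 := by
  have hW := hm.isRegularWeight hF hG
  have hC := hA.mem_L2 hF hG hm
  have hi := hW.integrable_dotProduct hd.1 hC
  have hs : ∀ x, C x ⬝ᵥ star (d x) = star (d x ⬝ᵥ star (C x)) := fun x => by
    rw [← star_dotProduct_star, star_star]
  have h1 := X.integral_dotProduct_star_eq_zero (f := C) (g := d)
    (fun k => hW.inv.integrable_apply hC k) (fun k => hW.integrable_apply hd.1 k)
    (fun k n hn => hA.fcoef_eq_zero hF hG hm k hn)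
    (fun k n hn => fcoef_eq_zero_of_mem_L2s hW hd k hn) (by
      simp only [hs]
      exact hi.congr' (continuous_star.comp_aestronglyMeasurable hi.1)
        (.of_forall fun x => (norm_star _).symm))
  simp only [hs, Complex.star_def, integral_conj] at h1
  exact (map_eq_zero _).1 h1

omit hX in
lemma ApproxInvBRa.energy_sub (hA : X.ApproxInvBRa F G u c C) {d : VecFun T}
    (hd : d ∈ X.L2s (F + G)) : energy (F + G) (d - fun x => C x ᵥ* (F x + G x)⁻¹) =
      energy (F + G) d + energy (fun x => (F x + G x)⁻¹) C := by
  have hW := hm.isRegularWeight hF hG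
  have hCL := hA.vecMul_inv_mem_L2 hF hG hm
  have hneg : -(fun x => C x ᵥ* (F x + G x)⁻¹) ∈ L2 (F + G) :=
    ⟨hCL.1.neg, (energy_neg _ _).trans_lt hCL.2⟩
  have h1 : energy (F + G) (fun x => C x ᵥ* (F x + G x)⁻¹) =
    energy (fun x => (F x + G x)⁻¹) C := hW.energy_vecMul_inv C
  rw [sub_eq_add_neg, energy_add_of_orthogonal hW.weight hd.1 hneg, energy_neg, h1]
  have h2 := hA.integral_dotProduct_star hF hG hm hd
  rw [← neg_eq_zero, ← integral_neg] at h2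
  refine Eq.trans (integral_congr_ae ?_) h2
  filter_upwards [hW.weight.psd, hW.unit] with x h3 h4
  simp only [sesq, Pi.neg_apply, star_neg, mulVec_neg, dotProduct_neg, star_vecMul,
    Pi.add_apply] at h3 h4 ⊢
  rw [conjTranspose_nonsing_inv, h3.1.eq, mulVec_mulVec, mul_nonsing_inv _ h4, one_mulVec]

lemma SummableCoeffs.err_eq {h : VecFun T} (hh : AEStronglyMeasurable h periodMeasure) :
    X.err h F G = ENNReal.ofReal (2 * Real.pi)⁻¹ *
      (energy (F + G) (h - fun x => X.A x ᵥ* (F x * (F x + G x)⁻¹)) +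
        energy (parallelSum F G) X.A) := by
  have hA := hX.continuous_A.aestronglyMeasurable (μ := periodMeasure)
  have hW := hm.isRegularWeight hF hG
  have hz := (hX.vecMul_A_mem_L2 hF hG hm).1
  rw [err]
  congr 1
  simp only [energy_eq_lintegral_quad]
  rw [← lintegral_add_left' (hF.isWeight.aemeasurable_ofReal_quad (hA.sub hh)),
    ← lintegral_add_left' (hW.weight.aemeasurable_ofReal_quad (hh.sub hz))]
  refine lintegral_congr_ae ?_
  filter_upwards [hF.2, hG.2, hm.1] with x h1 h2 h3
  refine (ENNReal.ofReal_add (quad_nonneg h1 _) (quad_nonneg h2 _)).symm.trans ?_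
  refine Eq.trans ?_ (ENNReal.ofReal_add (quad_nonneg (h1.add h2) _)
    (quad_nonneg (posSemidef_parallelSum h1 h2 h3) _))
  exact congrArg _ (quad_sub_add_quad h1 h2 h3 _ _)

lemma ApproxInvBRa.err_specChar (hA : X.ApproxInvBRa F G u c C) :
    X.err (X.specChar F G C) F G = ENNReal.ofReal (2 * Real.pi)⁻¹ *
      (energy (fun x => (F x + G x)⁻¹) C + energy (parallelSum F G) X.A) := by
  rw [hX.err_eq hF hG hm (hA.specChar_mem_L2 hX hF hG hm).1]
  congr 2
  refine Eq.trans ?_ ((hm.isRegularWeight hF hG).energy_vecMul_inv C)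
  rw [← energy_neg]
  refine congrArg _ (funext fun x => ?_)
  simp only [specChar, Pi.neg_apply, Pi.sub_apply, Pi.add_apply]
  abel

/-- The mean-square error exceeds its minimum by the squared distance to the optimal estimate. -/
theorem ApproxInvBRa.err_eq_add (hA : X.ApproxInvBRa F G u c C) {h : VecFun T}
    (hh : h ∈ X.L2s (F + G)) : X.err h F G = X.err (X.specChar F G C) F G +
      ENNReal.ofReal (2 * Real.pi)⁻¹ * energy (F + G) (h - X.specChar F G C) := by
  have hW := hm.isRegularWeight hF hG
  have hd : h - X.specChar F G C ∈ X.L2s (F + G) :=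
    mem_L2s_of_fcoef_eq_zero hW (L2.sub hW.weight hh.1 (hA.specChar_mem_L2 hX hF hG hm))
      fun k n hn => by
        have := fcoef_sub (hW.integrable_apply hh.1 k)
          (hW.integrable_apply (hA.specChar_mem_L2 hX hF hG hm) k) n
        rw [fcoef_eq_zero_of_mem_L2s hW hh k hn, hA.fcoef_specChar hX hF hG hm k hn,
          sub_zero] at this
        exact this
  have h1 := hA.energy_sub hF hG hm hd
  have h2 : (h - X.specChar F G C) - (fun x => C x ᵥ* (F x + G x)⁻¹) =
      h - fun x => X.A x ᵥ* (F x * (F x + G x)⁻¹) := by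
    ext x i
    simp only [specChar, Pi.sub_apply]; ring
  rw [h2] at h1
  rw [hX.err_eq hF hG hm hh.1.1, hA.err_specChar hX hF hG hm, h1, ← mul_add]
  congr 1
  ring

theorem ApproxInvBRa.isOptimal (hA : X.ApproxInvBRa F G u c C) :
    X.IsOptimal (X.specChar F G C) F G :=
  ⟨hA.specChar_mem_L2s hX hF hG hm, fun g hg => by
    rw [hA.err_eq_add hX hF hG hm hg]; exact le_self_add⟩

lemma ApproxInvBRa.minErr_eq (hA : X.ApproxInvBRa F G u c C) :
    X.minErr F G = X.err (X.specChar F G C) F G := by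
  have h := hA.isOptimal hX hF hG hm
  exact le_antisymm (iInf₂_le _ h.1) (le_iInf₂ h.2)

/-- The real number `⟨R a, B⁻¹ R a⟩ + ⟨Q a, a⟩`. -/
lemma ApproxInvBRa.tendsto_value (hA : X.ApproxInvBRa F G u c C) :
    Tendsto (fun n => X.RaInner F G (u n) + X.Qaa F G) atTop
      (𝓝 ((meanR (fun x => quad (F x + G x)⁻¹ (C x)) +
        meanR (fun x => quad (parallelSum F G x) (X.A x)) : ℝ) : ℂ)) := by
  have hW := hm.isRegularWeight hF hG
  have hQ := isSpectralDensity_parallelSum hF hG hm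
  have hC := hA.mem_L2 hF hG hm
  have hz := hX.vecMul_A_mem_L2 hF hG hm
  have huL : ∀ n, trigSum (u n) ∈ L2 fun x => (F x + G x)⁻¹ := fun n =>
    trigSum_mem_L2 hW.inv.density _
  rw [Complex.ofReal_add]
  refine Tendsto.add ?_ ?_
  · simp only [hX.RaInner_eq hF hG hm]
    have hiC := hW.integrable_dotProduct hz hC
    -- replace `h(F, G) + C (F + G)⁻¹` by its second summand, using orthogonality
    have h1 : ((meanR (fun x => quad (F x + G x)⁻¹ (C x)) : ℝ) : ℂ) =
        mean fun x => (X.A x ᵥ* (F x * (F x + G x)⁻¹)) ⬝ᵥ star (C x) := by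
      have h2 := hA.integral_dotProduct_star hF hG hm (hA.specChar_mem_L2s hX hF hG hm)
      have h3 : Integrable (fun x => X.specChar F G C x ⬝ᵥ star (C x)) periodMeasure :=
        hW.integrable_dotProduct (hA.specChar_mem_L2 hX hF hG hm) hC
      rw [← mean_ofReal]
      have h4 : mean (fun x => (X.A x ᵥ* (F x * (F x + G x)⁻¹)) ⬝ᵥ star (C x)) -
          mean (fun x => X.specChar F G C x ⬝ᵥ star (C x)) =
          mean fun x => (quad (F x + G x)⁻¹ (C x) : ℂ) := by
        rw [← mean_sub hiC h3]
        refine mean_congr_ae ?_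
        filter_upwards [hW.inv.weight.psd] with x hx
        have hx' : (F x + G x)⁻¹.PosSemidef := hx
        rw [← sub_dotProduct, ← sesq_self_eq_quad hx'.1, sesq_eq_vecMul]
        congr 1
        simp only [specChar, sub_sub_cancel]
      rw [← h4, mean, mean, h2, mul_zero, sub_zero]
    rw [h1]
    have h5 : Tendsto (fun n => ∫⁻ x, ‖(X.A x ᵥ* (F x * (F x + G x)⁻¹)) ⬝ᵥ
        star ((C - trigSum (u n)) x)‖ₑ ∂periodMeasure) atTop (𝓝 0) := by
      have h6 := ENNReal.Tendsto.const_mul (a := energy (F + G)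
          (fun x => X.A x ᵥ* (F x * (F x + G x)⁻¹)) ^ (1 / 2 : ℝ))
        ((ENNReal.continuous_rpow_const (y := 1 / 2)).tendsto 0 |>.comp hA.symbol)
        (.inr (ENNReal.rpow_lt_top_of_nonneg (by norm_num) hz.2.ne).ne)
      rw [ENNReal.zero_rpow_of_pos (by norm_num), mul_zero] at h6
      exact tendsto_of_tendsto_of_tendsto_of_le_of_le tendsto_const_nhds h6 (fun _ => zero_le)
        fun n => hW.lintegral_enorm_dotProduct_le hz.1 (hC.1.sub (huL n).1)
    have h7 : ∀ n, Integrable (fun x => (X.A x ᵥ* (F x * (F x + G x)⁻¹)) ⬝ᵥ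
        star ((C - trigSum (u n)) x)) periodMeasure := fun n =>
      hW.integrable_dotProduct hz (L2.sub hW.inv.weight hC (huL n))
    rw [tendsto_iff_norm_sub_tendsto_zero]
    have h8 := ((ENNReal.tendsto_toReal ENNReal.zero_ne_top).comp h5).const_mul (2 * Real.pi)⁻¹
    rw [ENNReal.toReal_zero, mul_zero] at h8
    refine squeeze_zero (fun _ => norm_nonneg _) (fun n => ?_) h8
    rw [norm_sub_rev, ← mean_sub hiC (hW.integrable_dotProduct hz (huL n))]
    refine (norm_mean_le _).trans_eq ?_
    rw [Function.comp_apply, ← ofReal_integral_norm_eq_lintegral_enorm (h7 n),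
      ENNReal.toReal_ofReal (integral_nonneg fun _ => norm_nonneg _)]
    simp only [← dotProduct_sub, ← star_sub, Pi.sub_apply]
  · rw [hX.Qaa_eq hF hG hm, ← mean_ofReal]
    rw [mean_congr_ae (hQ.2.mono fun x hx => sesq_self_eq_quad hx.1 _)]
    exact tendsto_const_nhds

lemma ApproxInvBRa.minErr_eq_ofReal (hA : X.ApproxInvBRa F G u c C) :
    X.minErr F G = ENNReal.ofReal (meanR (fun x => quad (F x + G x)⁻¹ (C x)) +
        meanR (fun x => quad (parallelSum F G x) (X.A x))) := by
  have hW : IsWeight fun x => (F x + G x)⁻¹ := (hm.isRegularWeight hF hG).inv.weight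
  have hQ := isSpectralDensity_parallelSum hF hG hm
  have h1 : 0 ≤ ∫ x, quad (F x + G x)⁻¹ (C x) ∂periodMeasure := integral_quad_nonneg hW C
  have h2 : 0 ≤ ∫ x, quad (parallelSum F G x) (X.A x) ∂periodMeasure :=
    integral_quad_nonneg hQ.isWeight X.A
  rw [hA.minErr_eq hX hF hG hm, hA.err_specChar hX hF hG hm,
    energy_eq_ofReal_integral hW (hA.mem_L2 hF hG hm),
    energy_eq_ofReal_integral hQ.isWeight (hX.A_mem_L2 hQ)]
  have h3 : 0 ≤ (2 * Real.pi)⁻¹ := inv_nonneg.2 Real.two_pi_pos.le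
  rw [meanR, meanR, ← mul_add, ENNReal.ofReal_mul h3, ← ENNReal.ofReal_add h1 h2]

/-- The value `⟨R a, B⁻¹ R a⟩ + ⟨Q a, a⟩` is the mean-square error of the optimal estimate. -/
theorem IsOperatorValue.nonneg_and_minErr_eq {v : ℝ} (hv : X.IsOperatorValue F G v) :
    0 ≤ v ∧ X.minErr F G = ENNReal.ofReal v := by
  obtain ⟨u, c, C, hA, hlim⟩ := hv
  have h1 := tendsto_nhds_unique hlim (hA.tendsto_value hX hF hG hm)
  rw [Complex.ofReal_inj] at h1
  rw [hA.minErr_eq_ofReal hX hF hG hm, h1]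
  refine ⟨add_nonneg ?_ ?_, rfl⟩
  · exact mul_nonneg (inv_nonneg.2 Real.two_pi_pos.le)
      (integral_quad_nonneg (hm.isRegularWeight hF hG).inv.weight C)
  · exact mul_nonneg (inv_nonneg.2 Real.two_pi_pos.le)
      (integral_quad_nonneg (isSpectralDensity_parallelSum hF hG hm).isWeight X.A)

lemma SummableCoeffs.exists_isOperatorValue : ∃ v, X.IsOperatorValue F G v := by
  obtain ⟨c, C, u, hA⟩ := hX.exists_isInvBRa hF hG hm
  exact ⟨_, u, c, C, hA, hA.tendsto_value hX hF hG hm⟩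

end

end FilteringProblem

/-! ### Mixtures of spectral densities -/

/-- The combination `a F + b F₀` of two matrix functions with real coefficients. -/
def mixture (a b : ℝ) (F F₀ : MatFun T) : MatFun T := fun x => (a : ℂ) • F x + (b : ℂ) • F₀ x

section mix

variable {a b : ℝ} {F G F₀ G₀ : MatFun T} {h : VecFun T}

lemma IsSpectralDensity.smul (hF : IsSpectralDensity F) (ha : 0 ≤ a) :
    IsSpectralDensity fun x => (a : ℂ) • F x :=
  ⟨fun i j => (hF.1 i j).const_mul (a : ℂ), hF.2.mono fun _ hx =>
    hx.smul (Complex.zero_le_real.2 ha)⟩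

lemma IsSpectralDensity.mix (hF : IsSpectralDensity F) (hF₀ : IsSpectralDensity F₀) (ha : 0 ≤ a)
    (hb : 0 ≤ b) : IsSpectralDensity (mixture a b F F₀) :=
  (hF.smul ha).add (hF₀.smul hb)

lemma quad_mix (x : ℝ) (v : Fin T → ℂ) :
    quad (mixture a b F F₀ x) v = a * quad (F x) v + b * quad (F₀ x) v := by
  rw [mixture, quad_add_weight, quad_smul_weight, quad_smul_weight]

lemma energy_mix (hF : IsSpectralDensity F) (hF₀ : IsSpectralDensity F₀) (ha : 0 ≤ a)
    (hb : 0 ≤ b) (hh : AEStronglyMeasurable h periodMeasure) :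
    energy (mixture a b F F₀) h = ENNReal.ofReal a * energy F h + ENNReal.ofReal b * energy F₀ h := by
  rw [← energy_smul_weight ha, ← energy_smul_weight hb,
    ← energy_add_weight (hF.smul ha).isWeight (hF₀.smul hb).isWeight hh]
  rfl

/-- The minimality condition passes from a pair to the mixtures in which it takes part. -/
lemma MinimalityCondition.mix (hm : MinimalityCondition F₀ G₀) (hF : IsSpectralDensity F)
    (hG : IsSpectralDensity G) (hF₀ : IsSpectralDensity F₀) (hG₀ : IsSpectralDensity G₀)
    (ha : 0 ≤ a) (hb : 0 < b) : MinimalityCondition (mixture a b F F₀) (mixture a b G G₀) := by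
  have hW := ((hF.mix hF₀ ha hb.le).add (hG.mix hG₀ ha hb.le)).isWeight
  have hle : ∀ᵐ x ∂periodMeasure, ∀ v,
      b * quad (F₀ x + G₀ x) v ≤ quad (mixture a b F F₀ x + mixture a b G G₀ x) v := by
    filter_upwards [hF.2, hG.2] with x h1 h2 v
    rw [quad_add_weight, quad_add_weight, quad_mix, quad_mix]
    nlinarith [mul_nonneg ha (quad_nonneg h1 v), mul_nonneg ha (quad_nonneg h2 v)]
  have hW₀ := (hF₀.add hG₀).2
  have hu : ∀ᵐ x ∂periodMeasure, IsUnit (mixture a b F F₀ x + mixture a b G G₀ x).det := by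
    filter_upwards [hW.psd, hW₀, hm.1, hle] with x h1 h2 h3 h4
    exact PosSemidef.isUnit_det_of_le hb h1 h2 h3 h4
  have htr : Integrable (fun x => b⁻¹ * ((F₀ x + G₀ x)⁻¹.trace).re) periodMeasure := by
    have h1 : Integrable (fun x => (F₀ x + G₀ x)⁻¹.trace) periodMeasure :=
      integrable_finsetSum _ fun k _ => hm.2 k k
    exact h1.re.const_mul _
  refine ⟨hu, fun i j => htr.mono' ?_ ?_⟩
  · exact aestronglyMeasurable_matrix_iff.1 (AEStronglyMeasurable.matrix_inv hW.meas) i j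
  · filter_upwards [hW.psd, hW₀, hm.1, hle, hu] with x h1 h2 h3 h4 h5
    have h1' : (mixture a b F F₀ x + mixture a b G G₀ x).PosSemidef := h1
    refine (norm_apply_le_re_trace h1'.inv i j).trans ?_
    simp only [Matrix.trace, diag_apply, Complex.re_sum, Finset.mul_sum]
    refine Finset.sum_le_sum fun k _ => ?_
    rw [← quad_single, ← quad_single]
    exact quad_inv_le hb h1 h2 h5 h3 h4 _

end mix

namespace FilteringProblem

variable {X : FilteringProblem T} {F G F₀ G₀ : MatFun T} {h : VecFun T} {a b : ℝ}

/-! ### The mean-square error as a function of the densities -/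

lemma err_mix (hX : X.SummableCoeffs) (hF : IsSpectralDensity F) (hG : IsSpectralDensity G)
    (hF₀ : IsSpectralDensity F₀) (hG₀ : IsSpectralDensity G₀) (ha : 0 ≤ a) (hb : 0 ≤ b)
    (hh : AEStronglyMeasurable h periodMeasure) :
    X.err h (mixture a b F F₀) (mixture a b G G₀) =
      ENNReal.ofReal a * X.err h F G + ENNReal.ofReal b * X.err h F₀ G₀ := by
  have hA := hX.continuous_A.aestronglyMeasurable (μ := periodMeasure)
  rw [err, err, err, energy_mix hF hF₀ ha hb (hA.sub hh), energy_mix hG hG₀ ha hb hh]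
  ring

lemma err_lt_top (hX : X.SummableCoeffs) (hF : IsSpectralDensity F) (hG : IsSpectralDensity G)
    (hh : h ∈ L2 (F + G)) : X.err h F G < ⊤ := by
  have h1 := (energy_add_weight hF.isWeight hG.isWeight hh.1).symm.trans_lt hh.2
  refine ENNReal.mul_lt_top ENNReal.ofReal_lt_top (ENNReal.add_lt_top.2 ⟨?_, ?_⟩)
  · exact (L2.sub hF.isWeight (hX.A_mem_L2 hF) ⟨hh.1, le_self_add.trans_lt h1⟩).2
  · exact le_add_self.trans_lt h1

/-- The error of an estimate is approached by estimates based on finitely many observations. -/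
lemma exists_obsPoly_err_lt (hX : X.SummableCoeffs) (hF : IsSpectralDensity F)
    (hG : IsSpectralDensity G) (hh : h ∈ X.L2s (F + G)) {r : ℝ≥0∞} (hr : X.err h F G < r) :
    ∃ q ∈ X.obsPoly, X.err q F G < r := by
  have hA := hX.continuous_A.aestronglyMeasurable (μ := periodMeasure)
  obtain ⟨η, hη, hη0⟩ : ∃ η : ℝ, ENNReal.ofReal (1 + η) * X.err h F G < r ∧ 0 < η := by
    have h1 : Tendsto (fun η : ℝ => ENNReal.ofReal (1 + η) * X.err h F G) (𝓝[>] 0)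
        (𝓝 (ENNReal.ofReal (1 + 0) * X.err h F G)) := by
      refine ENNReal.Tendsto.mul_const (ENNReal.tendsto_ofReal ?_) (.inl (by simp))
      exact ((continuous_const.add continuous_id).tendsto 0).mono_left nhdsWithin_le_nhds
    rw [add_zero, ENNReal.ofReal_one, one_mul] at h1
    exact ((h1.eventually (gt_mem_nhds hr)).and self_mem_nhdsWithin).exists
  set K := ENNReal.ofReal (2 * Real.pi)⁻¹ with hK
  obtain ⟨ε, hε, hε0⟩ : ∃ ε : ℝ≥0∞, ENNReal.ofReal (1 + η) * X.err h F G +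
      K * ENNReal.ofReal (1 + η⁻¹) * ε < r ∧ 0 < ε := by
    have h1 : Tendsto (fun ε : ℝ≥0∞ => ENNReal.ofReal (1 + η) * X.err h F G +
        K * ENNReal.ofReal (1 + η⁻¹) * ε) (𝓝[>] 0) (𝓝 (ENNReal.ofReal (1 + η) * X.err h F G +
          K * ENNReal.ofReal (1 + η⁻¹) * 0)) := by
      refine tendsto_const_nhds.add (ENNReal.Tendsto.const_mul ?_ (.inr ?_))
      · exact tendsto_id.mono_left nhdsWithin_le_nhds
      · exact ENNReal.mul_ne_top ENNReal.ofReal_ne_top ENNReal.ofReal_ne_top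
    rw [mul_zero, add_zero] at h1
    exact ((h1.eventually (gt_mem_nhds hη)).and self_mem_nhdsWithin).exists
  obtain ⟨q, hq, hqε⟩ := hh.2 ε hε0
  refine ⟨q, hq, lt_of_le_of_lt ?_ hε⟩
  have hqm := (obsPoly_mem_L2 hF hq).1
  have h1 := energy_add_le (b := h - q) hF.isWeight (hA.sub hh.1.1) hη0
  have h2 := energy_add_le (b := q - h) hG.isWeight hh.1.1 hη0
  rw [sub_add_sub_cancel] at h1
  rw [add_sub_cancel, energy_sub_comm] at h2
  rw [energy_add_weight hF.isWeight hG.isWeight (hh.1.1.sub hqm)] at hqε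
  calc X.err q F G ≤ K * ((ENNReal.ofReal (1 + η) * energy F (X.A - h) +
        ENNReal.ofReal (1 + η⁻¹) * energy F (h - q)) + (ENNReal.ofReal (1 + η) * energy G h +
        ENNReal.ofReal (1 + η⁻¹) * energy G (h - q))) :=
        mul_le_mul_right (add_le_add h1 h2) _
    _ = ENNReal.ofReal (1 + η) * X.err h F G +
        K * ENNReal.ofReal (1 + η⁻¹) * (energy F (h - q) + energy G (h - q)) := by
        rw [err]; ring
    _ ≤ _ := by gcongr

lemma exists_obsPoly_err_lt_of_minErr_lt (hX : X.SummableCoeffs) (hF : IsSpectralDensity F)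
    (hG : IsSpectralDensity G) {r : ℝ≥0∞} (hr : X.minErr F G < r) :
    ∃ q ∈ X.obsPoly, X.err q F G < r := by
  simp only [minErr, iInf_lt_iff] at hr
  obtain ⟨h, hh, hr⟩ := hr
  exact exists_obsPoly_err_lt hX hF hG hh hr

/-- The minimal error is a concave function of the pair of densities. -/
lemma minErr_mix_ge (hX : X.SummableCoeffs) (hF : IsSpectralDensity F) (hG : IsSpectralDensity G)
    (hF₀ : IsSpectralDensity F₀) (hG₀ : IsSpectralDensity G₀) (ha : 0 ≤ a) (hb : 0 ≤ b) :
    ENNReal.ofReal a * X.minErr F G + ENNReal.ofReal b * X.minErr F₀ G₀ ≤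
      X.minErr (mixture a b F F₀) (mixture a b G G₀) := by
  refine le_of_forall_gt fun r hr => ?_
  obtain ⟨q, hq, hqr⟩ :=
    exists_obsPoly_err_lt_of_minErr_lt hX (hF.mix hF₀ ha hb) (hG.mix hG₀ ha hb) hr
  rw [err_mix hX hF hG hF₀ hG₀ ha hb (obsPoly_mem_L2 hF hq).1] at hqr
  refine lt_of_le_of_lt ?_ hqr
  gcongr
  · exact iInf₂_le _ (obsPoly_mem_L2s (hF.add hG) hq)
  · exact iInf₂_le _ (obsPoly_mem_L2s (hF₀.add hG₀) hq)

/-- The error is lower semicontinuous along estimates that converge almost everywhere. -/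
lemma err_le_of_tendsto_ae (hX : X.SummableCoeffs) (hF : IsSpectralDensity F)
    (hG : IsSpectralDensity G) (hh : AEStronglyMeasurable h periodMeasure) {q : ℕ → VecFun T}
    (hq : ∀ n, AEStronglyMeasurable (q n) periodMeasure)
    (hlim : ∀ᵐ x ∂periodMeasure, Tendsto (fun n => q n x) atTop (𝓝 (h x))) {r : ℕ → ℝ≥0∞}
    {r₀ : ℝ≥0∞} (hr : Tendsto r atTop (𝓝 r₀)) (hle : ∀ n, X.err (q n) F G ≤ r n) :
    X.err h F G ≤ r₀ := by
  have hA := hX.continuous_A.aestronglyMeasurable (μ := periodMeasure)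
  have hm : ∀ {g : VecFun T}, AEStronglyMeasurable g periodMeasure →
      AEMeasurable (fun x => ENNReal.ofReal (quad (F x) ((X.A - g) x)) +
        ENNReal.ofReal (quad (G x) (g x))) periodMeasure := fun hg =>
    (hF.isWeight.aemeasurable_ofReal_quad (hA.sub hg)).add
      (hG.isWeight.aemeasurable_ofReal_quad hg)
  have herr : ∀ {g : VecFun T}, AEStronglyMeasurable g periodMeasure → X.err g F G =
      ENNReal.ofReal (2 * Real.pi)⁻¹ * ∫⁻ x, (ENNReal.ofReal (quad (F x) ((X.A - g) x)) +
        ENNReal.ofReal (quad (G x) (g x))) ∂periodMeasure := fun hg => by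
    rw [lintegral_add_left' (hF.isWeight.aemeasurable_ofReal_quad (hA.sub hg))]
    rfl
  have hc : ∀ W : Matrix (Fin T) (Fin T) ℂ, Continuous fun v => ENNReal.ofReal (quad W v) :=
    fun W => ENNReal.continuous_ofReal.comp (Complex.continuous_re.comp
      (continuous_sesq.comp (continuous_const.prodMk (continuous_id.prodMk continuous_id))))
  rw [herr hh, ← lintegral_const_mul'' _ (hm hh)]
  have h1 : ∫⁻ x, ENNReal.ofReal (2 * Real.pi)⁻¹ * (ENNReal.ofReal (quad (F x) ((X.A - h) x)) +
      ENNReal.ofReal (quad (G x) (h x))) ∂periodMeasure =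
      ∫⁻ x, liminf (fun n => ENNReal.ofReal (2 * Real.pi)⁻¹ *
        (ENNReal.ofReal (quad (F x) ((X.A - q n) x)) +
        ENNReal.ofReal (quad (G x) (q n x)))) atTop ∂periodMeasure := by
    refine lintegral_congr_ae ?_
    filter_upwards [hlim] with x hx
    refine (Tendsto.liminf_eq (ENNReal.Tendsto.const_mul (Tendsto.add ?_ ?_)
      (.inr ENNReal.ofReal_ne_top))).symm
    · exact ((hc (F x)).tendsto _).comp (tendsto_const_nhds.sub hx)
    · exact ((hc (G x)).tendsto _).comp hx
  rw [h1]
  refine (lintegral_liminf_le' fun n => (hm (hq n)).const_mul _).trans ?_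
  rw [← hr.liminf_eq]
  refine liminf_le_liminf (.of_forall fun n => ?_)
  rw [lintegral_const_mul'' _ (hm (hq n)), ← herr (hq n)]
  exact hle n

end FilteringProblem

/-! ### Least favorable densities and robust estimates for convex classes -/

/-- A convex class of spectral densities. -/
structure IsConvexClass (D : Set (MatFun T)) : Prop where
  density : ∀ F ∈ D, IsSpectralDensity F
  mix_mem : ∀ F ∈ D, ∀ F₀ ∈ D, ∀ a b : ℝ, 0 ≤ a → 0 ≤ b → a + b = 1 → mixture a b F F₀ ∈ D

namespace FilteringProblem

variable {X : FilteringProblem T} {F G F₀ G₀ : MatFun T} {DF DG : Set (MatFun T)}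
  {u : ℕ → ℤ →₀ (Fin T → ℂ)} {c : ℤ → Fin T → ℂ} {C : VecFun T}

section

variable (hX : X.SummableCoeffs) (hDF : IsConvexClass DF) (hDG : IsConvexClass DG)
  (hF₀ : F₀ ∈ DF) (hG₀ : G₀ ∈ DG) (hm : MinimalityCondition F₀ G₀)
include hX hDF hDG hF₀ hG₀ hm

/-- A pair that maximizes the minimal error among the pairs with the minimality condition maximizes
it among all pairs: these pairs are approached along segments inside the smaller family. -/
lemma SolvesExtremal.isLeastFavorable (h : X.SolvesExtremal DF DG F₀ G₀) :
    X.IsLeastFavorable DF DG F₀ G₀ := by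
  obtain ⟨-, -, v₀, hv₀, hmax⟩ := h
  refine ⟨hF₀, hG₀, fun F hF G hG => ?_⟩
  have sF := hDF.density F hF
  have sG := hDG.density G hG
  have sF₀ := hDF.density F₀ hF₀
  have sG₀ := hDG.density G₀ hG₀
  rw [(hv₀.nonneg_and_minErr_eq hX sF₀ sG₀ hm).2]
  have h1 : Tendsto (fun n : ℕ => ENNReal.ofReal (1 - 1 / ((n : ℝ) + 1)) * X.minErr F G) atTop
      (𝓝 (ENNReal.ofReal (1 - 0) * X.minErr F G)) := by
    refine ENNReal.Tendsto.mul_const (ENNReal.tendsto_ofReal ?_) (.inl (by simp))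
    exact tendsto_const_nhds.sub tendsto_one_div_add_atTop_nhds_zero_nat
  rw [sub_zero, ENNReal.ofReal_one, one_mul] at h1
  refine le_of_tendsto' h1 fun n => ?_
  have ht : 0 < 1 / ((n : ℝ) + 1) := by positivity
  have ht1 : 0 ≤ 1 - 1 / ((n : ℝ) + 1) := by
    rw [sub_nonneg, div_le_one (by positivity)]
    linarith [Nat.cast_nonneg (α := ℝ) n]
  have hmt := hm.mix sF sG sF₀ sG₀ ht1 ht
  have hmF := hDF.mix_mem F hF F₀ hF₀ _ _ ht1 ht.le (by ring)
  have hmG := hDG.mix_mem G hG G₀ hG₀ _ _ ht1 ht.le (by ring)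
  obtain ⟨v, hv⟩ := hX.exists_isOperatorValue (hDF.density _ hmF) (hDG.density _ hmG) hmt
  have h2 := minErr_mix_ge hX sF sG sF₀ sG₀ ht1 ht.le
  rw [(hv.nonneg_and_minErr_eq hX (hDF.density _ hmF) (hDG.density _ hmG) hmt).2] at h2
  exact le_self_add.trans (h2.trans (ENNReal.ofReal_le_ofReal (hmax _ hmF _ hmG hmt v hv)))

lemma IsLeastFavorable.solvesExtremal (h : X.IsLeastFavorable DF DG F₀ G₀) :
    X.SolvesExtremal DF DG F₀ G₀ := by
  obtain ⟨v₀, hv₀⟩ :=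
    hX.exists_isOperatorValue (hDF.density F₀ hF₀) (hDG.density G₀ hG₀) hm
  refine ⟨hF₀, hG₀, v₀, hv₀, fun F hF G hG hFG v hv => ?_⟩
  have h1 := h.2.2 F hF G hG
  have h2 := hv₀.nonneg_and_minErr_eq hX (hDF.density F₀ hF₀) (hDG.density G₀ hG₀) hm
  rw [(hv.nonneg_and_minErr_eq hX (hDF.density F hF) (hDG.density G hG) hFG).2, h2.2] at h1
  exact (ENNReal.ofReal_le_ofReal_iff h2.1).1 h1

/-- Saddle point property. The optimal estimate for a least favorable pair has its largest error at
that pair. Along the segment from `(F₀, G₀)` to `(F, G)`, near-optimal estimates `q` for the mixture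
with weight `t` of `(F, G)` satisfy `Δ(q; F, G) ≤ Δ(F₀, G₀) + t` and are close to the optimal
estimate for `(F₀, G₀)`; then `t → 0`. -/
theorem ApproxInvBRa.err_le_of_isLeastFavorable (hA : X.ApproxInvBRa F₀ G₀ u c C)
    (h : X.IsLeastFavorable DF DG F₀ G₀) (hF : F ∈ DF) (hG : G ∈ DG) :
    X.err (X.specChar F₀ G₀ C) F G ≤ X.err (X.specChar F₀ G₀ C) F₀ G₀ := by
  have sF := hDF.density F hF
  have sG := hDG.density G hG
  have sF₀ := hDF.density F₀ hF₀
  have sG₀ := hDG.density G₀ hG₀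
  have hW := hm.isRegularWeight sF₀ sG₀
  have hhL := hA.specChar_mem_L2 hX sF₀ sG₀ hm
  set h₀ := X.specChar F₀ G₀ C with hh₀
  set V := (X.err h₀ F₀ G₀).toReal with hV
  have hVe : X.err h₀ F₀ G₀ = ENNReal.ofReal V :=
    (ENNReal.ofReal_toReal (err_lt_top hX sF₀ sG₀ hhL).ne).symm
  have hV0 : 0 ≤ V := ENNReal.toReal_nonneg
  set K := (2 * Real.pi)⁻¹ with hK
  have hK0 : 0 < K := inv_pos.2 Real.two_pi_pos
  have key : ∀ n : ℕ, ∃ q ∈ X.obsPoly, X.err q F G ≤ ENNReal.ofReal (V + 1 / ((n : ℝ) + 2)) ∧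
      energy (F₀ + G₀) (q - h₀) ≤ ENNReal.ofReal (K⁻¹ * (2 * ((V + 1) * (1 / ((n : ℝ) + 2))))) := by
    intro n
    set t := 1 / ((n : ℝ) + 2) with ht
    have ht0 : 0 < t := by positivity
    -- the weight `1 - t` of `(F₀, G₀)` stays away from zero
    have ht1 : t ≤ 1 / 2 := by
      rw [ht]; gcongr; linarith [Nat.cast_nonneg (α := ℝ) n]
    have hs0 : 0 ≤ 1 - t := by linarith
    have h1 : X.minErr (mixture t (1 - t) F F₀) (mixture t (1 - t) G G₀) <
        ENNReal.ofReal (V + t ^ 2) := by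
      refine (h.2.2 _ (hDF.mix_mem F hF F₀ hF₀ _ _ ht0.le hs0 (by ring)) _
        (hDG.mix_mem G hG G₀ hG₀ _ _ ht0.le hs0 (by ring))).trans_lt ?_
      rw [hA.minErr_eq hX sF₀ sG₀ hm, hVe, ENNReal.ofReal_lt_ofReal_iff (by positivity)]
      linarith [pow_pos ht0 2]
    obtain ⟨q, hq, hqe⟩ := exists_obsPoly_err_lt_of_minErr_lt hX (sF.mix sF₀ ht0.le hs0)
      (sG.mix sG₀ ht0.le hs0) h1
    have hqL := obsPoly_mem_L2 (sF.add sG) hq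
    have hqL₀ := obsPoly_mem_L2s (sF₀.add sG₀) hq
    rw [err_mix hX sF sG sF₀ sG₀ ht0.le hs0 hqL.1, hA.err_eq_add hX sF₀ sG₀ hm hqL₀, hVe] at hqe
    have hdt := (L2.sub hW.weight hqL₀.1 hhL).2
    set e := (X.err q F G).toReal
    set d := (energy (F₀ + G₀) (q - h₀)).toReal
    have he : X.err q F G = ENNReal.ofReal e :=
      (ENNReal.ofReal_toReal (err_lt_top hX sF sG hqL).ne).symm
    have hd : energy (F₀ + G₀) (q - h₀) = ENNReal.ofReal d :=
      (ENNReal.ofReal_toReal hdt.ne).symm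
    have he0 : 0 ≤ e := ENNReal.toReal_nonneg
    have hd0 : 0 ≤ d := ENNReal.toReal_nonneg
    have hKd : 0 ≤ K * d := by positivity
    rw [he, hd, ← ENNReal.ofReal_mul hK0.le, ← ENNReal.ofReal_add hV0 hKd,
      ← ENNReal.ofReal_mul ht0.le, ← ENNReal.ofReal_mul hs0,
      ← ENNReal.ofReal_add (by positivity) (mul_nonneg hs0 (by positivity)),
      ENNReal.ofReal_lt_ofReal_iff (by positivity)] at hqe
    refine ⟨q, hq, ?_, ?_⟩
    · rw [he]
      refine ENNReal.ofReal_le_ofReal (le_of_mul_le_mul_left (a := t) ?_ ht0)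
      nlinarith [mul_nonneg hs0 hKd]
    · rw [hd]
      refine ENNReal.ofReal_le_ofReal ?_
      rw [inv_mul_eq_div, le_div_iff₀ hK0]
      nlinarith [mul_nonneg ht0.le he0]
  choose q hq hqe hqd using key
  have hlim : Tendsto (fun n : ℕ => 1 / ((n : ℝ) + 2)) atTop (𝓝 0) := by
    have := (tendsto_add_atTop_iff_nat 1).2
      (tendsto_one_div_add_atTop_nhds_zero_nat (𝕜 := ℝ))
    refine this.congr fun n => ?_
    push_cast; ring
  have hqm : ∀ n, AEStronglyMeasurable (q n) periodMeasure := fun n => (obsPoly_mem_L2 sF (hq n)).1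
  have hd0 : Tendsto (fun n => energy (F₀ + G₀) (q n - h₀)) atTop (𝓝 0) := by
    have h1 := ENNReal.tendsto_ofReal (((hlim.const_mul (V + 1)).const_mul 2).const_mul K⁻¹)
    simp only [mul_zero, ENNReal.ofReal_zero] at h1
    exact tendsto_of_tendsto_of_tendsto_of_le_of_le tendsto_const_nhds h1 (fun _ => zero_le) hqd
  have hL1 : Tendsto (fun n => ∫⁻ x, ‖(q n - h₀) x‖ₑ ∂periodMeasure) atTop (𝓝 0) := by
    have h1 := tendsto_finsetSum Finset.univ fun k _ =>
      hW.tendsto_lintegral_enorm_apply (fun n => (hqm n).sub hhL.1) hd0 k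
    rw [Finset.sum_const_zero] at h1
    refine tendsto_of_tendsto_of_tendsto_of_le_of_le tendsto_const_nhds h1 (fun _ => zero_le)
      fun n => ?_
    dsimp only
    rw [← lintegral_finsetSum' _ fun k _ =>
      (aestronglyMeasurable_vec_iff.1 ((hqm n).sub hhL.1) k).enorm]
    refine lintegral_mono fun x => ?_
    rw [← ofReal_norm]
    simp only [← ofReal_norm]
    rw [← ENNReal.ofReal_sum_of_nonneg fun _ _ => norm_nonneg _]
    exact ENNReal.ofReal_le_ofReal ((pi_norm_le_iff_of_nonneg
      (Finset.sum_nonneg fun _ _ => norm_nonneg _)).2 fun k =>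
        Finset.single_le_sum (f := fun k => ‖(q n - h₀) x k‖) (fun _ _ => norm_nonneg _)
          (Finset.mem_univ k))
  obtain ⟨σ, hσ, hσlim⟩ := exists_subseq_tendsto_ae_zero (fun n => (hqm n).sub hhL.1) hL1
  rw [hVe]
  have hr : Tendsto (fun n : ℕ => ENNReal.ofReal (V + 1 / (((σ n : ℕ) : ℝ) + 2))) atTop
      (𝓝 (ENNReal.ofReal V)) := by
    have h1 := ENNReal.tendsto_ofReal ((hlim.const_add V).comp hσ.tendsto_atTop)
    rwa [add_zero] at h1
  refine err_le_of_tendsto_ae hX sF sG hhL.1 (fun n => hqm (σ n)) ?_ hr fun n => hqe (σ n)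
  filter_upwards [hσlim] with x hx
  have := hx.add_const (h₀ x)
  simpa using this

/-- The optimal estimate for `(F₀, G₀)` belongs to `H_D` when it has finite error on `D`. Its
frequencies are times of observation, and this determines membership for the pair
`(F + F₀, G + G₀)`, which satisfies the minimality condition. -/
lemma ApproxInvBRa.specChar_mem_HD (hA : X.ApproxInvBRa F₀ G₀ u c C)
    (h : ∀ F ∈ DF, ∀ G ∈ DG, X.err (X.specChar F₀ G₀ C) F G < ⊤) :
    X.specChar F₀ G₀ C ∈ X.HD DF DG := by
  intro F hF G hG
  have sF := hDF.density F hF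
  have sG := hDG.density G hG
  have sF₀ := hDF.density F₀ hF₀
  have sG₀ := hDG.density G₀ hG₀
  have hhL := hA.specChar_mem_L2 hX sF₀ sG₀ hm
  have herr := h F hF G hG
  have hfc := fun p (n : ℤ) (hn : n ∉ X.obs) => hA.fcoef_specChar hX sF₀ sG₀ hm p hn
  set h₀ := X.specChar F₀ G₀ C
  have hAm := hX.A_mem_L2 sF
  have h1 : energy F (X.A - h₀) + energy G h₀ < ⊤ := by
    by_contra hne
    rw [not_lt, top_le_iff] at hne
    rw [err, hne, ENNReal.mul_top (by simp [Real.pi_pos])] at herr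
    exact lt_irrefl _ herr
  rw [ENNReal.add_lt_top] at h1
  have h2 : h₀ ∈ L2 (F + G) := by
    refine ⟨hhL.1, ?_⟩
    rw [energy_add_weight sF.isWeight sG.isWeight hhL.1, ENNReal.add_lt_top]
    refine ⟨?_, h1.2⟩
    have h3 := L2.sub sF.isWeight hAm ⟨hAm.1.sub hhL.1, h1.1⟩
    rw [sub_sub_cancel] at h3
    exact h3.2
  have hmm := hm.mix sF sG sF₀ sG₀ zero_le_one one_pos
  have hW := hmm.isRegularWeight (sF.mix sF₀ zero_le_one zero_le_one)
    (sG.mix sG₀ zero_le_one zero_le_one)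
  have hsum : mixture 1 1 F F₀ + mixture 1 1 G G₀ = (F + G) + (F₀ + G₀) := by
    funext x
    simp only [mixture, Complex.ofReal_one, one_smul, Pi.add_apply]
    abel
  rw [hsum] at hW
  have h4 : ∀ {g : VecFun T}, AEStronglyMeasurable g periodMeasure →
      energy ((F + G) + (F₀ + G₀)) g = energy (F + G) g + energy (F₀ + G₀) g := fun hg =>
    energy_add_weight (sF.add sG).isWeight (sF₀.add sG₀).isWeight hg
  have h5 := mem_L2s_of_fcoef_eq_zero (X := X) hW (h := h₀)
    ⟨hhL.1, by rw [h4 hhL.1]; exact ENNReal.add_lt_top.2 ⟨h2.2, hhL.2⟩⟩ hfc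
  refine ⟨h2, fun ε hε => ?_⟩
  obtain ⟨q, hq, hqε⟩ := h5.2 ε hε
  refine ⟨q, hq, lt_of_le_of_lt ?_ hqε⟩
  rw [h4 (hhL.1.sub (obsPoly_mem_L2 sF hq).1)]
  exact le_self_add

lemma ApproxInvBRa.isMinimaxRobust (hA : X.ApproxInvBRa F₀ G₀ u c C)
    (h : X.IsLeastFavorable DF DG F₀ G₀) (hHD : X.specChar F₀ G₀ C ∈ X.HD DF DG) :
    X.IsMinimaxRobust DF DG (X.specChar F₀ G₀ C) := by
  have sF₀ := hDF.density F₀ hF₀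
  have sG₀ := hDG.density G₀ hG₀
  refine ⟨hHD, _, ⟨⟨F₀, hF₀, G₀, hG₀, rfl⟩, ?_⟩, fun g hg => ?_⟩
  · rintro _ ⟨F, hF, G, hG, rfl⟩
    exact hA.err_le_of_isLeastFavorable hX hDF hDG hF₀ hG₀ hm h hF hG
  · refine ((hA.isOptimal hX sF₀ sG₀ hm).2 g (hg F₀ hF₀ G₀ hG₀)).trans ?_
    exact le_iSup₂_of_le F₀ hF₀ (le_iSup₂_of_le G₀ hG₀ le_rfl)

lemma ApproxInvBRa.ae_eq_of_isMinimaxRobust (hA : X.ApproxInvBRa F₀ G₀ u c C)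
    (h : X.IsLeastFavorable DF DG F₀ G₀) (hHD : X.specChar F₀ G₀ C ∈ X.HD DF DG) {g : VecFun T}
    (hg : X.IsMinimaxRobust DF DG g) : g =ᵐ[periodMeasure] X.specChar F₀ G₀ C := by
  have sF₀ := hDF.density F₀ hF₀
  have sG₀ := hDG.density G₀ hG₀
  obtain ⟨hgD, m, ⟨-, hm1⟩, hm2⟩ := hg
  have hgL := hgD F₀ hF₀ G₀ hG₀
  have hhL := hA.specChar_mem_L2 hX sF₀ sG₀ hm
  have h1 : X.err g F₀ G₀ ≤ X.err (X.specChar F₀ G₀ C) F₀ G₀ := by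
    refine (hm1 ⟨F₀, hF₀, G₀, hG₀, rfl⟩).trans ((hm2 _ hHD).trans ?_)
    exact iSup₂_le fun F hF => iSup₂_le fun G hG =>
      hA.err_le_of_isLeastFavorable hX hDF hDG hF₀ hG₀ hm h hF hG
  rw [hA.err_eq_add hX sF₀ sG₀ hm hgL] at h1
  have h2 : ENNReal.ofReal (2 * Real.pi)⁻¹ *
      energy (F₀ + G₀) (g - X.specChar F₀ G₀ C) = 0 := by
    by_contra hne
    exact absurd h1 (not_le.2 (ENNReal.lt_add_right (err_lt_top hX sF₀ sG₀ hhL).ne hne))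
  refine (hm.isRegularWeight sF₀ sG₀).ae_eq_of_energy_sub_eq_zero hgL.1.1 hhL.1 ?_
  refine (mul_eq_zero.1 h2).resolve_left ?_
  simp [Real.pi_pos]

/-- An estimate that is optimal for `(F₀, G₀)` and has its largest error there makes `(F₀, G₀)`
least favorable. -/
lemma ApproxInvBRa.isLeastFavorable_of_err_le (hA : X.ApproxInvBRa F₀ G₀ u c C)
    (h : ∀ F ∈ DF, ∀ G ∈ DG,
      X.err (X.specChar F₀ G₀ C) F G ≤ X.err (X.specChar F₀ G₀ C) F₀ G₀) :
    X.IsLeastFavorable DF DG F₀ G₀ ∧ X.specChar F₀ G₀ C ∈ X.HD DF DG := by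
  have sF₀ := hDF.density F₀ hF₀
  have sG₀ := hDG.density G₀ hG₀
  have hHD := hA.specChar_mem_HD hX hDF hDG hF₀ hG₀ hm fun F hF G hG =>
    (h F hF G hG).trans_lt (err_lt_top hX sF₀ sG₀ (hA.specChar_mem_L2 hX sF₀ sG₀ hm))
  refine ⟨⟨hF₀, hG₀, fun F hF G hG => ?_⟩, hHD⟩
  rw [hA.minErr_eq hX sF₀ sG₀ hm]
  exact (iInf₂_le _ (hHD F hF G hG)).trans (h F hF G hG)

end

end FilteringProblem

/-! ### Classes given by linear functionals of the density -/

section pairing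

variable {B F G : Matrix (Fin T) (Fin T) ℂ}

lemma pairing_add (B F G : Matrix (Fin T) (Fin T) ℂ) :
    pairing B (F + G) = pairing B F + pairing B G := by
  simp only [pairing, Matrix.add_apply, mul_add, Finset.sum_add_distrib]

lemma pairing_sub (B F G : Matrix (Fin T) (Fin T) ℂ) :
    pairing B (F - G) = pairing B F - pairing B G := by
  simp only [pairing, Matrix.sub_apply, mul_sub, Finset.sum_sub_distrib]

lemma pairing_smul (c : ℂ) (B F : Matrix (Fin T) (Fin T) ℂ) :
    pairing B (c • F) = c * pairing B F := by
  simp only [pairing, Matrix.smul_apply, smul_eq_mul, Finset.mul_sum, mul_left_comm]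

lemma pairing_one (F : Matrix (Fin T) (Fin T) ℂ) : pairing 1 F = F.trace := by
  simp [pairing, Matrix.one_apply, Matrix.trace]

lemma pairing_single (i j : Fin T) (F : Matrix (Fin T) (Fin T) ℂ) :
    pairing (Matrix.single i j 1) F = F i j := by
  simp [pairing, Matrix.single_apply, ite_and]

lemma pairing_smul_left (c : ℂ) (B F : Matrix (Fin T) (Fin T) ℂ) :
    pairing (c • B) F = c * pairing B F := by
  simp only [pairing, Matrix.smul_apply, smul_eq_mul, Finset.mul_sum, mul_assoc]

lemma pairing_sum_left {ι : Type*} (s : Finset ι) (B : ι → Matrix (Fin T) (Fin T) ℂ)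
    (F : Matrix (Fin T) (Fin T) ℂ) : pairing (∑ i ∈ s, B i) F = ∑ i ∈ s, pairing (B i) F := by
  simp only [pairing, Matrix.sum_apply, Finset.sum_mul]
  symm
  rw [Finset.sum_comm]
  exact Finset.sum_congr rfl fun k _ => Finset.sum_comm

lemma pairing_conjTranspose (hF : F.IsHermitian) : pairing Bᴴ F = star (pairing B F) := by
  simp only [pairing, star_sum, star_mul', conjTranspose_apply]
  rw [Finset.sum_comm]
  refine Finset.sum_congr rfl fun k _ => Finset.sum_congr rfl fun l _ => ?_
  rw [hF.apply]

lemma sesq_self_eq_pairing (F : Matrix (Fin T) (Fin T) ℂ) (r : Fin T → ℂ) :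
    sesq F r r = pairing (vecMulVec (star r) r)ᵀ F := by
  simp only [sesq, pairing, dotProduct, mulVec, Finset.mul_sum, transpose_apply, vecMulVec_apply,
    Pi.star_apply]
  exact Finset.sum_congr rfl fun k _ => Finset.sum_congr rfl fun l _ => by ring

/-- The equation for `\overline{y} yᵀ` divided by the density on both sides. -/
lemma vecMulVec_vecMul_inv {W M : Matrix (Fin T) (Fin T) ℂ} {y : Fin T → ℂ}
    (hW : W.IsHermitian) (hu : IsUnit W.det) (h : vecMulVec (star y) y = W * M * W) :
    vecMulVec (star (y ᵥ* W⁻¹)) (y ᵥ* W⁻¹) = M := by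
  rw [star_vecMul, hW.inv.eq, ← mul_vecMulVec, ← vecMulVec_mul, h]
  simp only [Matrix.mul_assoc, mul_nonsing_inv _ hu, Matrix.mul_one]
  rw [← Matrix.mul_assoc, nonsing_inv_mul _ hu, Matrix.one_mul]

lemma IsSpectralDensity.integrable_pairing {F : MatFun T} (hF : IsSpectralDensity F)
    (B : Matrix (Fin T) (Fin T) ℂ) : Integrable (fun x => pairing B (F x)) periodMeasure :=
  integrable_finsetSum _ fun i _ => integrable_finsetSum _ fun j _ => (hF.1 i j).const_mul _

end pairing

/-- Spectral densities with prescribed means of the functionals `⟨B i, F⟩`. -/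
def momentClass {ι : Type*} (B : ι → Matrix (Fin T) (Fin T) ℂ) (p : ι → ℂ) : Set (MatFun T) :=
  {F | IsSpectralDensity F ∧ ∀ i, mean (fun x => pairing (B i) (F x)) = p i}

/-- Spectral densities for which the functionals `⟨B i, G⟩` are close to `⟨B i, G₁⟩` in `L₂`. -/
def deviationClass {ι : Type*} (B : ι → Matrix (Fin T) (Fin T) ℂ) (δ : ι → ℝ) (G₁ : MatFun T) :
    Set (MatFun T) :=
  {G | IsSpectralDensity G ∧ ∀ i,
    Integrable (fun x => ‖pairing (B i) (G x - G₁ x)‖ ^ 2) periodMeasure ∧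
    meanR (fun x => ‖pairing (B i) (G x - G₁ x)‖ ^ 2) ≤ δ i}

section classes

variable {ι : Type*} {B : ι → Matrix (Fin T) (Fin T) ℂ} {p : ι → ℂ} {δ : ι → ℝ} {G₁ : MatFun T}

lemma isConvexClass_momentClass : IsConvexClass (momentClass B p) where
  density _ hF := hF.1
  mix_mem F hF F₀ hF₀ a b ha hb hab := by
    refine ⟨hF.1.mix hF₀.1 ha hb, fun i => ?_⟩
    simp only [mixture, pairing_add, pairing_smul]
    rw [mean_add ((hF.1.integrable_pairing _).const_mul _)
      ((hF₀.1.integrable_pairing _).const_mul _), mean_const_mul, mean_const_mul, hF.2, hF₀.2,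
      ← add_mul, ← Complex.ofReal_add, hab, Complex.ofReal_one, one_mul]

lemma isConvexClass_deviationClass (hG₁ : IsSpectralDensity G₁) :
    IsConvexClass (deviationClass B δ G₁) where
  density _ hG := hG.1
  mix_mem G hG G₀ hG₀ a b ha hb hab := by
    refine ⟨hG.1.mix hG₀.1 ha hb, fun i => ?_⟩
    have h1 : ∀ x, ‖pairing (B i) (mixture a b G G₀ x - G₁ x)‖ ^ 2 ≤
        a * ‖pairing (B i) (G x - G₁ x)‖ ^ 2 + b * ‖pairing (B i) (G₀ x - G₁ x)‖ ^ 2 := by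
      intro x
      have h2 : pairing (B i) (mixture a b G G₀ x - G₁ x) =
          a * pairing (B i) (G x - G₁ x) + b * pairing (B i) (G₀ x - G₁ x) := by
        have h3 : (a : ℂ) + b = 1 := by exact_mod_cast hab
        simp only [mixture, pairing_add, pairing_smul, pairing_sub]
        linear_combination pairing (B i) (G₁ x) * h3
      have h4 : ‖pairing (B i) (mixture a b G G₀ x - G₁ x)‖ ≤
          a * ‖pairing (B i) (G x - G₁ x)‖ + b * ‖pairing (B i) (G₀ x - G₁ x)‖ := by
        rw [h2]
        refine (norm_add_le _ _).trans_eq ?_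
        rw [norm_mul, norm_mul, Complex.norm_real, Complex.norm_real, Real.norm_of_nonneg ha,
          Real.norm_of_nonneg hb]
      refine (pow_le_pow_left₀ (norm_nonneg _) h4 2).trans ?_
      obtain rfl : b = 1 - a := by linarith
      nlinarith [mul_nonneg (mul_nonneg ha hb)
        (sq_nonneg (‖pairing (B i) (G x - G₁ x)‖ - ‖pairing (B i) (G₀ x - G₁ x)‖))]
    have hi := ((hG.2 i).1.const_mul a).add ((hG₀.2 i).1.const_mul b)
    have hmeas : AEStronglyMeasurable (fun x => ‖pairing (B i) (mixture a b G G₀ x - G₁ x)‖ ^ 2)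
        periodMeasure := by
      simp only [pairing_sub]
      exact (((hG.1.mix hG₀.1 ha hb).integrable_pairing _).sub
        (hG₁.integrable_pairing _)).1.norm.pow 2
    have hint : Integrable (fun x => ‖pairing (B i) (mixture a b G G₀ x - G₁ x)‖ ^ 2)
        periodMeasure := hi.mono' hmeas (.of_forall fun x => by
      rw [Real.norm_of_nonneg (by positivity)]; exact h1 x)
    refine ⟨hint, ?_⟩
    calc meanR (fun x => ‖pairing (B i) (mixture a b G G₀ x - G₁ x)‖ ^ 2)
        ≤ a * meanR (fun x => ‖pairing (B i) (G x - G₁ x)‖ ^ 2) +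
          b * meanR (fun x => ‖pairing (B i) (G₀ x - G₁ x)‖ ^ 2) := by
          have h5 := integral_mono hint hi h1
          simp only [Pi.add_apply] at h5
          rw [integral_add ((hG.2 i).1.const_mul a) ((hG₀.2 i).1.const_mul b),
            integral_const_mul, integral_const_mul] at h5
          have h6 : 0 ≤ (2 * Real.pi)⁻¹ := inv_nonneg.2 Real.two_pi_pos.le
          simp only [meanR]
          nlinarith [mul_le_mul_of_nonneg_left h5 h6]
      _ ≤ a * δ i + b * δ i := by
          gcongr
          · exact (hG.2 i).2
          · exact (hG₀.2 i).2
      _ = δ i := by rw [← add_mul, hab, one_mul]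

variable [Fintype ι] {F F₀ G G₀ : MatFun T} {r : VecFun T}

/-- If `\overline{r} rᵀ` is a constant combination of the matrices that define a moment class, the
energy of `r` is constant on this class. -/
lemma energy_eq_of_mem_momentClass {κ : ι → ℂ}
    (hr : ∀ᵐ x ∂periodMeasure, vecMulVec (star (r x)) (r x) = (∑ i, κ i • B i)ᵀ)
    (hF : F ∈ momentClass B p) (hF₀ : F₀ ∈ momentClass B p) : energy F r = energy F₀ r := by
  have key : ∀ F ∈ momentClass B p,
      energy F r = ENNReal.ofReal (∑ i, κ i * (2 * Real.pi * p i)).re := by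
    intro F hF
    have hi : ∀ i ∈ Finset.univ, Integrable (fun x => κ i * pairing (B i) (F x)) periodMeasure :=
      fun i _ => (hF.1.integrable_pairing (B i)).const_mul (κ i)
    have h1 : ∀ᵐ x ∂periodMeasure, quad (F x) (r x) = (∑ i, κ i * pairing (B i) (F x)).re := by
      filter_upwards [hr] with x hx
      rw [quad, sesq_self_eq_pairing, hx, transpose_transpose, pairing_sum_left]
      simp only [pairing_smul_left]
    have h2 : Integrable (fun x => (∑ i, κ i * pairing (B i) (F x)).re) periodMeasure :=
      (integrable_finsetSum _ hi).re
    rw [energy_eq_lintegral_quad, lintegral_congr_ae (h1.mono fun x hx => by rw [hx]),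
      ← ofReal_integral_eq_lintegral_ofReal h2]
    · congr 1
      have h3 := integral_re (integrable_finsetSum Finset.univ hi)
      refine h3.trans (congrArg Complex.re ?_)
      rw [integral_finsetSum _ hi]
      refine Finset.sum_congr rfl fun i _ => ?_
      rw [integral_const_mul, integral_eq_two_pi_mul_mean, hF.2]
    · filter_upwards [h1, hF.1.2] with x hx h3
      rw [← hx]
      exact quad_nonneg h3 _
  rw [key F hF, key F₀ hF₀]

/-- If `\overline{r} rᵀ` is a combination of the matrices that define a deviation class, with
coefficients proportional to the deviations of `G₀`, and the constraints are active at `G₀`, then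
the energy of `r` is largest at `G₀`: this is the first order condition for the maximum of a linear
functional under convex quadratic constraints. -/
lemma energy_le_of_mem_deviationClass {b : ι → ℝ} (hb : ∀ i, 0 ≤ b i)
    (hr : ∀ᵐ x ∂periodMeasure, vecMulVec (star (r x)) (r x) =
      (∑ i, ((b i : ℂ) * pairing (B i) (G₀ x - G₁ x)) • (B i)ᴴ)ᵀ)
    (hG₀ : G₀ ∈ deviationClass B δ G₁)
    (hact : ∀ i, meanR (fun x => ‖pairing (B i) (G₀ x - G₁ x)‖ ^ 2) = δ i)
    (hG : G ∈ deviationClass B δ G₁) (hrm : AEStronglyMeasurable r periodMeasure) :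
    energy G r ≤ energy G₀ r := by
  have hquad : ∀ {G : MatFun T}, IsSpectralDensity G → ∀ᵐ x ∂periodMeasure, quad (G x) (r x) =
      (∑ i, (b i : ℂ) * pairing (B i) (G₀ x - G₁ x) * star (pairing (B i) (G x))).re := by
    intro G hG
    filter_upwards [hr, hG.2] with x hx hGx
    rw [quad, sesq_self_eq_pairing, hx, transpose_transpose, pairing_sum_left]
    simp only [pairing_smul_left, pairing_conjTranspose hGx.1]
  set S : MatFun T → ℝ → ℝ := fun G x => ∑ i, b i / 2 * ‖pairing (B i) (G x - G₁ x)‖ ^ 2 with hS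
  have hSi : ∀ {G}, G ∈ deviationClass B δ G₁ → Integrable (S G) periodMeasure := fun hG =>
    integrable_finsetSum _ fun i _ => (hG.2 i).1.const_mul _
  have hS0 : ∀ G x, 0 ≤ S G x := fun G x =>
    Finset.sum_nonneg fun i _ => mul_nonneg (div_nonneg (hb i) zero_le_two) (by positivity)
  have hpt : ∀ᵐ x ∂periodMeasure,
      quad (G x) (r x) + S G₀ x ≤ quad (G₀ x) (r x) + S G x := by
    filter_upwards [hquad hG.1, hquad hG₀.1] with x h1 h2
    rw [h1, h2, Complex.re_sum, Complex.re_sum, hS, ← Finset.sum_add_distrib,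
      ← Finset.sum_add_distrib]
    refine Finset.sum_le_sum fun i _ => ?_
    rw [pairing_sub, pairing_sub]
    generalize pairing (B i) (G₀ x) = g₀
    generalize pairing (B i) (G x) = g
    generalize pairing (B i) (G₁ x) = g₁
    -- `Re (d (e - d)*) ≤ (|e|² - |d|²) / 2` for the deviations `d` of `G₀` and `e` of `G`
    rw [← Complex.normSq_eq_norm_sq, ← Complex.normSq_eq_norm_sq, Complex.normSq_apply,
      Complex.normSq_apply]
    simp only [Complex.mul_re, Complex.mul_im, Complex.star_def, Complex.conj_re,
      Complex.conj_im, Complex.ofReal_re, Complex.ofReal_im, Complex.sub_re, Complex.sub_im]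
    nlinarith [mul_nonneg (hb i) (sq_nonneg (g.re - g₀.re)),
      mul_nonneg (hb i) (sq_nonneg (g.im - g₀.im))]
  have hadd : ∀ {G G' : MatFun T}, G ∈ deviationClass B δ G₁ → G' ∈ deviationClass B δ G₁ →
      ∫⁻ x, ENNReal.ofReal (quad (G x) (r x) + S G' x) ∂periodMeasure =
        energy G r + ENNReal.ofReal (∫ x, S G' x ∂periodMeasure) := by
    intro G G' hG hG'
    rw [ofReal_integral_eq_lintegral_ofReal (hSi hG') (.of_forall (hS0 G')),
      energy_eq_lintegral_quad, ← lintegral_add_left' (hG.1.isWeight.aemeasurable_ofReal_quad hrm)]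
    refine lintegral_congr_ae ?_
    filter_upwards [hG.1.2] with x hx
    exact ENNReal.ofReal_add (quad_nonneg hx _) (hS0 G' x)
  have h1 := lintegral_mono_ae (hpt.mono fun x hx => ENNReal.ofReal_le_ofReal hx)
  rw [hadd hG hG₀, hadd hG₀ hG] at h1
  have h2 : ∫ x, S G x ∂periodMeasure ≤ ∫ x, S G₀ x ∂periodMeasure := by
    rw [hS, integral_finsetSum _ fun i _ => (hG.2 i).1.const_mul _,
      integral_finsetSum _ fun i _ => (hG₀.2 i).1.const_mul _]
    refine Finset.sum_le_sum fun i _ => ?_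
    rw [integral_const_mul, integral_const_mul]
    refine mul_le_mul_of_nonneg_left ?_ (div_nonneg (hb i) zero_le_two)
    have h3 := (hG.2 i).2
    rw [← hact i] at h3
    exact le_of_mul_le_mul_left h3 (inv_pos.2 Real.two_pi_pos)
  have h3 : energy G r + ENNReal.ofReal (∫ x, S G₀ x ∂periodMeasure) ≤
      energy G₀ r + ENNReal.ofReal (∫ x, S G₀ x ∂periodMeasure) :=
    h1.trans (by gcongr)
  exact (ENNReal.add_le_add_iff_right ENNReal.ofReal_ne_top).1 h3

end classes

/-! ### The four pairs of classes -/

namespace ClassPair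

/-- Each `D₀ᵏ` is a moment class, and the relation on `r_G` says that `\overline{r_G} r_Gᵀ` is a
constant combination of the matrices that define the class. -/
lemma DF_eq_momentClass (D : ClassPair T) : ∃ (ι : Type) (_ : Fintype ι)
    (B : ι → Matrix (Fin T) (Fin T) ℂ) (p : ι → ℂ), D.DF = momentClass B p ∧
      ∀ F G y, D.RelationF F G y → ∃ κ : ι → ℂ, ∀ᵐ x ∂periodMeasure,
        vecMulVec (star (y x)) (y x) = (F x + G x) * (∑ i, κ i • B i)ᵀ * (F x + G x) := by
  cases D with
  | first p δ G₁ =>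
    refine ⟨Unit, inferInstance, fun _ => 1, fun _ => p, ?_, ?_⟩
    · simp [DF, momentClass, pairing_one]
    · rintro F G y ⟨α, h⟩
      refine ⟨fun _ => ((α ^ 2 : ℝ) : ℂ), h.mono fun x hx => ?_⟩
      rw [hx]
      generalize F x + G x = W
      simp [sq]
  | second p δ G₁ =>
    refine ⟨Fin T, inferInstance, fun k => Matrix.single k k 1, fun k => p k, ?_, ?_⟩
    · simp [DF, momentClass, pairing_single]
    · rintro F G y ⟨α, h⟩
      refine ⟨fun k => ((α k ^ 2 : ℝ) : ℂ), h.mono fun x hx => ?_⟩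
      rw [hx]
      congr 2
      ext i j
      simp [Matrix.sum_apply, Matrix.single_apply, diagonal_apply, ite_and]
      rcases eq_or_ne i j with rfl | hij
      · simp
      · simp [hij, hij.symm]
  | third p δ B₁ B₂ G₁ =>
    refine ⟨Unit, inferInstance, fun _ => B₁, fun _ => p, ?_, ?_⟩
    · simp [DF, momentClass]
    · rintro F G y ⟨α, h⟩
      refine ⟨fun _ => ((α ^ 2 : ℝ) : ℂ), h.mono fun x hx => ?_⟩
      rw [hx]
      simp
  | fourth P δ G₁ =>
    refine ⟨Fin T × Fin T, inferInstance, fun k => Matrix.single k.1 k.2 1, fun k => P k.1 k.2,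
      ?_, ?_⟩
    · simp [DF, momentClass, pairing_single]
    · rintro F G y ⟨α, h⟩
      refine ⟨fun k => α k.2 * star (α k.1), h.mono fun x hx => ?_⟩
      rw [hx]
      congr 2
      ext i j
      simp [Matrix.sum_apply, Matrix.single_apply, vecMulVec_apply, Fintype.sum_prod_type, ite_and]

/-- A scalar matrix of size at least two has rank one only if it vanishes. -/
lemma eq_zero_of_vecMulVec_eq_smul_one {c : ℂ} {u v : Fin T → ℂ} {i j : Fin T} (hij : i ≠ j)
    (h : vecMulVec u v = c • (1 : Matrix (Fin T) (Fin T) ℂ)) : c = 0 := by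
  have h1 := congrFun (congrFun h i) i
  have h2 := congrFun (congrFun h j) j
  have h3 := congrFun (congrFun h i) j
  simp only [vecMulVec_apply, Matrix.smul_apply, Matrix.one_apply, if_neg hij, if_true,
    smul_eq_mul, mul_one, mul_zero] at h1 h2 h3
  have : c * c = 0 := by
    linear_combination (-u j * v j) * h1 - c * h2 + u j * v i * h3
  exact mul_self_eq_zero.1 this

/-- Each `D_{2δ}ᵏ` is a deviation class, and the relation on `r_F` says that `\overline{r_F} r_Fᵀ`
is a combination of the matrices that define the class, with coefficients proportional to the
deviations. In the third class the matrix `\overline{r_F} r_Fᵀ`, of rank one, is a multiple of the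
identity matrix, so it vanishes unless the size is one, where `B₂` is itself a scalar. -/
lemma DG_eq_deviationClass (D : ClassPair T) (hD : D.Valid) : ∃ (ι : Type) (_ : Fintype ι)
    (B : ι → Matrix (Fin T) (Fin T) ℂ) (δ : ι → ℝ) (G₁ : MatFun T), IsSpectralDensity G₁ ∧
      D.DG = deviationClass B δ G₁ ∧ (∀ G, D.Active G →
        ∀ i, meanR (fun x => ‖pairing (B i) (G x - G₁ x)‖ ^ 2) = δ i) ∧
      ∀ F G z, (∀ᵐ x ∂periodMeasure, (F x + G x).PosSemidef) →
        (∀ᵐ x ∂periodMeasure, IsUnit (F x + G x).det) → D.RelationG F G z →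
        ∃ b : ι → ℝ, (∀ i, 0 ≤ b i) ∧ ∀ᵐ x ∂periodMeasure,
          vecMulVec (star (z x)) (z x) = (F x + G x) *
            (∑ i, ((b i : ℂ) * pairing (B i) (G x - G₁ x)) • (B i)ᴴ)ᵀ * (F x + G x) := by
  cases D with
  | first p δ G₁ =>
    refine ⟨Unit, inferInstance, fun _ => 1, fun _ => δ, G₁, hD, ?_, ?_, ?_⟩
    · simp [DG, deviationClass, pairing_one]
    · intro G h _
      simpa [Active, pairing_one] using h
    · rintro F G z - - ⟨β, h⟩
      refine ⟨fun _ => β ^ 2, fun _ => sq_nonneg _, h.mono fun x hx => ?_⟩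
      rw [hx]
      generalize F x + G x = W
      simp [sq, pairing_one]
  | second p δ G₁ =>
    refine ⟨Fin T, inferInstance, fun k => Matrix.single k k 1, δ, G₁, hD, ?_, ?_, ?_⟩
    · simp [DG, deviationClass, pairing_single]
    · intro G h k
      simpa [Active, pairing_single] using h k
    · rintro F G z - - ⟨β, h⟩
      refine ⟨fun k => β k ^ 2, fun _ => sq_nonneg _, h.mono fun x hx => ?_⟩
      rw [hx]
      congr 2
      ext i j
      simp [Matrix.sum_apply, Matrix.single_apply, diagonal_apply, ite_and, pairing_single,
        conjTranspose_single]
      rcases eq_or_ne i j with rfl | hij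
      · simp
      · simp [hij, hij.symm]
  | third p δ B₁ B₂ G₁ =>
    refine ⟨Unit, inferInstance, fun _ => B₂, fun _ => δ, G₁, hD.2.2, ?_, ?_, ?_⟩
    · simp [DG, deviationClass]
    · intro G h _
      exact h
    · rintro F G z hp hu ⟨β, h⟩
      rcases subsingleton_or_nontrivial (Fin T) with hT | hT
      · rcases isEmpty_or_nonempty (Fin T) with hE | ⟨⟨i⟩⟩
        · exact ⟨0, fun _ => le_rfl, .of_forall fun x => Subsingleton.elim _ _⟩
        · have h1 := hD.2.1.diag_pos (i := i)
          have h2 : B₂ i i = ((B₂ i i).re : ℂ) := (Complex.ext rfl (Complex.lt_def.1 h1).2.symm)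
          have h3 : 0 < (B₂ i i).re := (Complex.lt_def.1 h1).1
          have h4 : B₂ = ((B₂ i i).re : ℂ) • (1 : Matrix (Fin T) (Fin T) ℂ) := by
            ext j k
            rw [Subsingleton.elim j i, Subsingleton.elim k i, ← h2]
            simp
          refine ⟨fun _ => β ^ 2 / (B₂ i i).re, fun _ => by positivity, h.mono fun x hx => ?_⟩
          rw [hx]
          have h5 : ((B₂ i i).re : ℂ) ≠ 0 := by exact_mod_cast h3.ne'
          have h6 : B₂ᴴᵀ = ((B₂ i i).re : ℂ) • (1 : Matrix (Fin T) (Fin T) ℂ) := by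
            rw [hD.2.1.1.eq, h4]; simp
          rw [Finset.univ_unique, Finset.sum_singleton, transpose_smul, h6]
          simp only [smul_smul, Matrix.mul_smul, Matrix.smul_mul, Matrix.mul_one, sq]
          congr 1
          push_cast
          field_simp
      · obtain ⟨i, j, hij⟩ := exists_pair_ne (Fin T)
        refine ⟨0, fun _ => le_rfl, ?_⟩
        filter_upwards [h, hp, hu] with x hx h1 h2
        have h3 : vecMulVec (star (z x)) (z x) = (F x + G x) *
            ((((β ^ 2 : ℝ) : ℂ) * pairing B₂ (G x - G₁ x)) • 1) * (F x + G x) := by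
          rw [hx]
          generalize F x + G x = W
          simp [sq W]
        have h4 := eq_zero_of_vecMulVec_eq_smul_one hij (vecMulVec_vecMul_inv h1.1 h2 h3)
        rw [hx, h4]
        simp
  | fourth P δ G₁ =>
    refine ⟨Fin T × Fin T, inferInstance, fun k => Matrix.single k.1 k.2 1, fun k => δ k.1 k.2,
      G₁, hD.2, ?_, ?_, ?_⟩
    · simp [DG, deviationClass, pairing_single]
    · intro G h k
      simpa [Active, pairing_single] using h k.1 k.2
    · rintro F G z - - ⟨β, hβ, h⟩
      refine ⟨fun k => β k.1 k.2, fun k => hβ k.1 k.2, h.mono fun x hx => ?_⟩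
      rw [hx]
      congr 2
      ext i j
      simp [Matrix.sum_apply, Matrix.single_apply, pairing_single, Fintype.sum_prod_type, ite_and,
        conjTranspose_single]

lemma isConvexClass_DF (D : ClassPair T) : IsConvexClass D.DF := by
  obtain ⟨ι, _, B, p, h, -⟩ := D.DF_eq_momentClass
  rw [h]
  exact isConvexClass_momentClass

lemma isConvexClass_DG (D : ClassPair T) (hD : D.Valid) : IsConvexClass D.DG := by
  obtain ⟨ι, _, B, δ, G₁, hG₁, h, -⟩ := D.DG_eq_deviationClass hD
  rw [h]
  exact isConvexClass_deviationClass hG₁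

end ClassPair

namespace FilteringProblem

variable {X : FilteringProblem T} {F G F₀ G₀ : MatFun T} {u : ℕ → ℤ →₀ (Fin T → ℂ)}
  {c : ℤ → Fin T → ℂ} {C : VecFun T}

/-- The function `r_F` is the optimal estimate itself; its counterpart `r_G` is `A - h⁰`. -/
lemma specChar_eq_numF_vecMul (C : VecFun T) (x : ℝ) :
    X.specChar F G C x = X.numF F C x ᵥ* (F x + G x)⁻¹ := by
  rw [specChar, numF, sub_vecMul, vecMul_vecMul]

lemma A_sub_specChar_eq_numG_vecMul (C : VecFun T) {x : ℝ} (hu : IsUnit (F x + G x).det) :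
    X.A x - X.specChar F G C x = X.numG G C x ᵥ* (F x + G x)⁻¹ := by
  have h1 : X.A x = (X.A x ᵥ* F x + X.A x ᵥ* G x) ᵥ* (F x + G x)⁻¹ := by
    rw [← vecMul_add, vecMul_vecMul, mul_nonsing_inv _ hu, vecMul_one]
  conv_lhs => rw [h1]
  rw [specChar, numG, add_vecMul, add_vecMul, vecMul_vecMul]
  abel

/-- Under the relations for the class, the optimal estimate for `(F₀, G₀)` has its largest error
there. -/
lemma ApproxInvBRa.err_le_of_relations (hX : X.SummableCoeffs) {D : ClassPair T} (hD : D.Valid)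
    (hF₀ : F₀ ∈ D.DF) (hG₀ : G₀ ∈ D.DG) (hm : MinimalityCondition F₀ G₀)
    (hA : X.ApproxInvBRa F₀ G₀ u c C) (hRF : D.RelationF F₀ G₀ (X.numG G₀ C))
    (hRG : D.RelationG F₀ G₀ (X.numF F₀ C)) (hact : D.Active G₀) (hF : F ∈ D.DF) (hG : G ∈ D.DG) :
    X.err (X.specChar F₀ G₀ C) F G ≤ X.err (X.specChar F₀ G₀ C) F₀ G₀ := by
  have sF₀ := D.isConvexClass_DF.density F₀ hF₀
  have sG₀ := (D.isConvexClass_DG hD).density G₀ hG₀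
  have hp : ∀ᵐ x ∂periodMeasure, (F₀ x + G₀ x).PosSemidef := (sF₀.add sG₀).2
  have h1 : energy F (X.A - X.specChar F₀ G₀ C) = energy F₀ (X.A - X.specChar F₀ G₀ C) := by
    obtain ⟨ι, _, B, p, h, hrel⟩ := D.DF_eq_momentClass
    obtain ⟨κ, hκ⟩ := hrel _ _ _ hRF
    rw [h] at hF hF₀
    refine energy_eq_of_mem_momentClass (κ := κ) ?_ hF hF₀
    filter_upwards [hκ, hp, hm.1] with x hx h2 h3
    rw [Pi.sub_apply, A_sub_specChar_eq_numG_vecMul C h3]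
    exact vecMulVec_vecMul_inv h2.1 h3 hx
  have h2 : energy G (X.specChar F₀ G₀ C) ≤ energy G₀ (X.specChar F₀ G₀ C) := by
    obtain ⟨ι, _, B, δ, G₁, -, h, hact', hrel⟩ := D.DG_eq_deviationClass hD
    obtain ⟨b, hb, hb'⟩ := hrel _ _ _ hp hm.1 hRG
    rw [h] at hG hG₀
    refine energy_le_of_mem_deviationClass hb ?_ hG₀ (hact' G₀ hact) hG
      (hA.specChar_mem_L2 hX sF₀ sG₀ hm).1
    filter_upwards [hb', hp, hm.1] with x hx h2 h3
    rw [specChar_eq_numF_vecMul]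
    exact vecMulVec_vecMul_inv h2.1 h3 hx
  rw [err, err, h1]
  gcongr

end FilteringProblem

end

theorem theorem3 {T : ℕ} (X : FilteringProblem T) (hX : X.SummableCoeffs)
    (D : ClassPair T) (hD : D.Valid)
    (F₀ G₀ : MatFun T) (hF₀ : F₀ ∈ D.DF) (hG₀ : G₀ ∈ D.DG) (hmin : MinimalityCondition F₀ G₀) :
    -- the sequence `B⁻¹ R a` exists
    (∃ c C, X.IsInvBRa F₀ G₀ c C) ∧
    -- least favorable means solving the extremal problem
    (X.SolvesExtremal D.DF D.DG F₀ G₀ ↔ X.IsLeastFavorable D.DF D.DG F₀ G₀) ∧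
    ∀ c C, X.IsInvBRa F₀ G₀ c C →
      X.IsOptimal (X.specChar F₀ G₀ C) F₀ G₀ ∧
      -- the spectral characteristic of a least favorable pair is minimax-robust
      (X.IsLeastFavorable D.DF D.DG F₀ G₀ → X.specChar F₀ G₀ C ∈ X.HD D.DF D.DG →
        X.IsMinimaxRobust D.DF D.DG (X.specChar F₀ G₀ C) ∧
        ∀ h, X.IsMinimaxRobust D.DF D.DG h → h =ᵐ[periodMeasure] X.specChar F₀ G₀ C) ∧
      -- the relations determine a least favorable pair and the minimax-robust characteristic
      (D.RelationF F₀ G₀ (X.numG G₀ C) → D.RelationG F₀ G₀ (X.numF F₀ C) → D.Active G₀ →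
        X.SolvesExtremal D.DF D.DG F₀ G₀ ∧
        X.IsLeastFavorable D.DF D.DG F₀ G₀ ∧
        X.specChar F₀ G₀ C ∈ X.HD D.DF D.DG ∧
        X.IsMinimaxRobust D.DF D.DG (X.specChar F₀ G₀ C) ∧
        ∀ h, X.IsMinimaxRobust D.DF D.DG h → h =ᵐ[periodMeasure] X.specChar F₀ G₀ C) := by
  have sF₀ := D.isConvexClass_DF.density F₀ hF₀
  have cG := D.isConvexClass_DG hD
  have sG₀ := cG.density G₀ hG₀
  refine ⟨hX.exists_isInvBRa sF₀ sG₀ hmin,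
    ⟨fun h => h.isLeastFavorable hX D.isConvexClass_DF cG hF₀ hG₀ hmin,
      fun h => h.solvesExtremal hX D.isConvexClass_DF cG hF₀ hG₀ hmin⟩, ?_⟩
  rintro c C ⟨u, hA⟩
  have robust : X.IsLeastFavorable D.DF D.DG F₀ G₀ → X.specChar F₀ G₀ C ∈ X.HD D.DF D.DG →
      X.IsMinimaxRobust D.DF D.DG (X.specChar F₀ G₀ C) ∧
      ∀ h, X.IsMinimaxRobust D.DF D.DG h → h =ᵐ[periodMeasure] X.specChar F₀ G₀ C :=
    fun hlf hHD => ⟨hA.isMinimaxRobust hX D.isConvexClass_DF cG hF₀ hG₀ hmin hlf hHD,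
      fun _ hh => hA.ae_eq_of_isMinimaxRobust hX D.isConvexClass_DF cG hF₀ hG₀ hmin hlf hHD hh⟩
  refine ⟨hA.isOptimal hX sF₀ sG₀ hmin, robust, fun hRF hRG hact => ?_⟩
  obtain ⟨hlf, hHD⟩ := hA.isLeastFavorable_of_err_le hX D.isConvexClass_DF cG hF₀ hG₀ hmin
    fun F hF G hG => hA.err_le_of_relations hX hD hF₀ hG₀ hmin hRF hRG hact hF hG
  exact ⟨hlf.solvesExtremal hX D.isConvexClass_DF cG hF₀ hG₀ hmin, hlf, hHD, robust hlf hHD⟩
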